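/- Conventions. For $x\in\mathbb R^n$ and $s>0$ let $\rho_s(x)=e^{-\pi\|x/s\|^2}$. For a full-rank lattice $L\subset\mathbb R^n$, given by an arbitrary basis $B$ (the columns of an invertible matrix), let $L^*=\{y:\langle x,y\rangle\in\mathbb Z\ \forall x\in L\}$, with dual basis the columns of $(B^{T})^{-1}$; let $D_{L,r}$ be the distribution on $L$ with mass $\rho_r(x)/\rho_r(L)$ at $x$; and let $\eta_\varepsilon(L)$ be the smallest $s>0$ with $\rho_{1/s}(L^*\setminus\{0\})\le\varepsilon$. $\Psi_\beta$ is the distribution on $\mathbb T=\mathbb R/\mathbb Z$ of a centred normal variable of standard deviation $\beta/\sqrt{2\pi}$ modulo $1$. For $s\in\mathbb Z_p^n$ and a distribution $\phi$ on $\mathbb T$, $A_{s,\phi}$ is the distribution on $\mathbb Z_p^n\times\mathbb T$ of $(a,\langle a,s\rangle/p+e)$ with $a$ uniform in $\mathbb Z_p^n$ and $e\sim\phi$ independent. A (possibly randomized) oracle solves $\mathrm{LWE}_{p,\phi}$ if for every $s\in\mathbb Z_p^n$, given independent samples from $A_{s,\phi}$, it outputs $s$ with probability $1-2^{-\Omega(n)}$.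 A function $f$ is negligible if $n^cf(n)\to0$ for every $c>0$. Algorithms are classical randomized programs on a machine with exact real arithmetic: $+,-,\times,/,\sqrt{\cdot}$, comparisons and drawing a sample of density $e^{-\pi x^2}$ cost one step each, $\lfloor t\rfloor$ costs about $\log_2(2+|t|)$ steps, and an oracle call costs as many steps as there are numbers passed to and returned by the oracle. An algorithm is efficient if on all inputs, whatever the random choices, its number of steps is polynomial in the input length, i.e. in $n$ plus the bit lengths of the integer parts of all numbers in the input and of the entries of the dual basis. Lemma. Let $\varepsilon=\varepsilon(n)>0$ be a negligible function, $p=p(n)\ge2$ an integer, and $\alpha=\alpha(n)\in(0,1)$ a real number. Assume that we have access to an oracle $W$ that solves $\mathrm{LWE}_{p,\Psi_\alpha}$ given a polynomial number of samples. (1) There are a constant $c>0$, an efficient classical algorithm with access to $W$, and constants $\delta>0$, $n_0$ such that for all $n\ge n_0$, all lattices $L\subset\mathbb R^n$ given by a basis, all $r>\sqrt2\,p\,\eta_\varepsilon(L)$ and all $x\in\mathbb R^n$ at distance at most $\alpha p/(\sqrt2\,r)$ from $L^*$, the algorithm, given the basis, $p$, $\alpha$, $r$, $x$ and $n^c$ independent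 samples from $D_{L,r}$, outputs the closest point of $L^*$ to $x$ with probability at least $1-2^{-\delta n}$ over the samples, its own randomness and that of $W$. That is, it solves $\mathrm{CVP}_{L^*,\alpha p/(\sqrt2 r)}$. (2) There are an efficient classical algorithm without oracle and a negligible function $\mu$ such that for all $n$ and all $L,r,x$ as in (1), and for every closest point $\kappa\in L^*$ to $x$, the following holds, where $s\in\mathbb Z_p^n$ is the coefficient vector of $\kappa$ in the dual basis, reduced modulo $p$: given the basis, $p$, $\alpha$, $r$, $x$ and one sample from $D_{L,r}$, the algorithm outputs an element of $\mathbb Z_p^n\times\mathbb T$ whose distribution is, for some $0<\beta\le\alpha$, within $\mu(n)$ in total variation of $A_{s,\Psi_\beta}$. -/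

import Mathlib

open MeasureTheory ProbabilityTheory

noncomputable section

namespace LWERed

/-! ### Gaussians, lattices, smoothing parameter -/

/-- `ℝⁿ` with the Euclidean norm. -/
abbrev E (n : ℕ) : Type := EuclideanSpace ℝ (Fin n)

/-- The Gaussian function `ρ_s(x) = exp(-π ‖x/s‖²)`. -/
def rho {n : ℕ} (s : ℝ) (x : E n) : ℝ := Real.exp (-Real.pi * (‖x‖ / s) ^ 2)

/-- The lattice whose basis vectors are the columns of `B`. -/
def lattice {n : ℕ} (B : Matrix (Fin n) (Fin n) ℝ) : Submodule ℤ (E n) :=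
  Submodule.span ℤ (Set.range fun j => WithLp.toLp 2 fun i => B i j)

/-- The dual lattice `L* = {y | ⟨x, y⟩ ∈ ℤ for all x ∈ L}`. -/
def dualLattice {n : ℕ} (L : Submodule ℤ (E n)) : Submodule ℤ (E n) :=
  LinearMap.BilinForm.dualSubmodule (innerₗ (E n)) L

/-- The smoothing parameter: the smallest `s > 0` with `ρ_{1/s}(L* \ {0}) ≤ ε`. -/
def smoothing {n : ℕ} (L : Submodule ℤ (E n)) (ε : ℝ) : ℝ :=
  sInf {s : ℝ | 0 < s ∧
    ∑' y : {y : E n // y ∈ dualLattice L ∧ y ≠ 0}, ENNReal.ofReal (rho (1 / s) y.1)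
      ≤ ENNReal.ofReal ε}

/-- The discrete Gaussian distribution `D_{L,r}`, giving mass `ρ_r(x) / ρ_r(L)` to `x ∈ L`. -/
def discreteGaussian {n : ℕ} (L : Submodule ℤ (E n)) (r : ℝ) : Measure (E n) :=
  (∑' x : L, ENNReal.ofReal (rho r x.1))⁻¹ •
    Measure.sum fun x : L => ENNReal.ofReal (rho r x.1) • Measure.dirac x.1

/-- `y` is a closest point of the lattice `L` to `x`. -/
def IsClosest {n : ℕ} (L : Submodule ℤ (E n)) (x y : E n) : Prop :=
  y ∈ L ∧ ∀ z ∈ L, dist x y ≤ dist x z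

/-- The one-dimensional distribution `ν_β`: centred normal with standard deviation `β / √(2π)`. -/
def nu (β : ℝ) : Measure ℝ := gaussianReal 0 (Real.toNNReal (β ^ 2 / (2 * Real.pi)))

/-- The periodic normal distribution `Ψ_β` on `𝕋 = ℝ/ℤ`. -/
def Psi (β : ℝ) : Measure UnitAddCircle := (nu β).map fun t : ℝ => (t : UnitAddCircle)

/-! ### Learning with errors -/

/-- One LWE sample `(a, b)`, with `a ∈ ℤ_pⁿ` and `b ∈ 𝕋`. -/
abbrev Sample (n p : ℕ) : Type := (Fin n → ZMod p) × UnitAddCircle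

/-- The distribution `A_{s,φ}`: output `(a, ⟨a,s⟩/p + e)` with `a` uniform in `ℤ_pⁿ` and `e ∼ φ`
independent. -/
def lweDist {n p : ℕ} (s : Fin n → ZMod p) (φ : Measure UnitAddCircle) : Measure (Sample n p) :=
  ((uniformOn (Set.univ : Set (Fin n → ZMod p))).prod φ).map fun q =>
    (q.1, (((((∑ i, q.1 i * s i : ZMod p).val : ℝ) / (p : ℝ)) : ℝ) : UnitAddCircle) + q.2)

/-- A (possibly randomized) procedure mapping `N n` LWE samples to an element of `ℤ_{p(n)}ⁿ`.
Its internal randomness is a point of the probability space `(Ω, P)`; each call uses a fresh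
independent one. No bound on its complexity is imposed. -/
structure Oracle (p N : ℕ → ℕ) (Ω : Type*) [MeasurableSpace Ω] where
  out : (n : ℕ) → (Fin (N n) → Sample n (p n)) → Ω → (Fin n → ZMod (p n))
  measurable_out : ∀ n, Measurable fun q : (Fin (N n) → Sample n (p n)) × Ω => out n q.1 q.2

/-- The oracle solves `LWE_{p,φ}`: for every secret `s`, given independent samples from `A_{s,φ}`,
it outputs `s` with probability `1 - 2^{-Ω(n)}`. -/
def Oracle.Solves {p N : ℕ → ℕ} {Ω : Type*} [MeasurableSpace Ω] (W : Oracle p N Ω)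
    (P : Measure Ω) (φ : ℕ → Measure UnitAddCircle) : Prop :=
  ∃ δ : ℝ, 0 < δ ∧ ∃ n₀ : ℕ, ∀ n, n₀ ≤ n → ∀ s : Fin n → ZMod (p n),
    ((Measure.pi fun _ : Fin (N n) => lweDist s (φ n)).prod P) {q | W.out n q.1 q.2 ≠ s}
      ≤ ENNReal.ofReal ((2 : ℝ) ^ (-(δ * n)))

/-! ### The machine model

Randomized real-number random access machines with an oracle, programmed in a structured language.
The memory consists of natural number registers (sizes, counters, indices) and of two-dimensional
real arrays. Arithmetic operations, comparisons, square roots, memory accesses and the generation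
of a sample from `ν_1` cost one step each. Rounding down `t` costs as many steps as `⌊t⌋` has binary
digits, the cost of computing `⌊t⌋` by binary search. All loops are bounded, so every program
halts; the semantics counts the steps. -/

/-- Expressions over the natural number registers. -/
inductive NExp where
  | lit (k : ℕ)
  | var (x : ℕ)
  | add (a b : NExp)
  | sub (a b : NExp)
  | mul (a b : NExp)

/-- Real expressions; `get a i j` reads entry `(i, j)` of array `a`. -/
inductive RExp where
  | lit (q : ℚ)
  | ofNat (e : NExp)
  | get (a : ℕ) (i j : NExp)
  | add (a b : RExp)
  | sub (a b : RExp)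
  | mul (a b : RExp)
  | div (a b : RExp)
  | sqrt (a : RExp)
  | floor (a : RExp)

/-- Programs. `gauss a i j` stores a fresh sample from `ν_1` in entry `(i, j)` of array `a`.
`call a o` passes the LWE samples whose `i`-th one is `((a[i,0], …, a[i,n-1]), a[i,n])` to the
oracle and stores the answer in `o[0,0], …, o[0,n-1]`. -/
inductive Prog where
  | skip
  | setN (x : ℕ) (e : NExp)
  | setR (a : ℕ) (i j : NExp) (e : RExp)
  | gauss (a : ℕ) (i j : NExp)
  | call (a o : ℕ)
  | seq (c d : Prog)
  | ifLe (e f : RExp) (c d : Prog)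
  | loop (x : ℕ) (e : NExp) (c : Prog)

/-- The program makes no oracle calls. -/
def Prog.OracleFree : Prog → Prop
  | .call _ _ => False
  | .seq c d => c.OracleFree ∧ d.OracleFree
  | .ifLe _ _ c d => c.OracleFree ∧ d.OracleFree
  | .loop _ _ c => c.OracleFree
  | _ => True

/-- A machine state: memory, numbers of Gaussian samples and of oracle calls used so far, and
number of steps made so far. -/
structure State where
  nat : ℕ → ℕ
  arr : ℕ → ℕ → ℕ → ℝ
  coins : ℕ
  calls : ℕ
  time : ℕ

/-- Number of binary digits of `|t|` rounded up to an integer. -/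
def bits (t : ℝ) : ℕ := Nat.size ⌈|t|⌉₊

def NExp.eval (σ : State) : NExp → ℕ
  | .lit k => k
  | .var x => σ.nat x
  | .add a b => a.eval σ + b.eval σ
  | .sub a b => a.eval σ - b.eval σ
  | .mul a b => a.eval σ * b.eval σ

def NExp.cost : NExp → ℕ
  | .lit _ => 1
  | .var _ => 1
  | .add a b => a.cost + b.cost + 1
  | .sub a b => a.cost + b.cost + 1
  | .mul a b => a.cost + b.cost + 1

def RExp.eval (σ : State) : RExp → ℝ
  | .lit q => (q : ℝ)
  | .ofNat e => (e.eval σ : ℝ)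
  | .get a i j => σ.arr a (i.eval σ) (j.eval σ)
  | .add a b => a.eval σ + b.eval σ
  | .sub a b => a.eval σ - b.eval σ
  | .mul a b => a.eval σ * b.eval σ
  | .div a b => a.eval σ / b.eval σ
  | .sqrt a => Real.sqrt (a.eval σ)
  | .floor a => (⌊a.eval σ⌋ : ℝ)

def RExp.cost (σ : State) : RExp → ℕ
  | .lit _ => 1
  | .ofNat e => e.cost + 1
  | .get _ i j => i.cost + j.cost + 1
  | .add a b => a.cost σ + b.cost σ + 1
  | .sub a b => a.cost σ + b.cost σ + 1
  | .mul a b => a.cost σ + b.cost σ + 1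
  | .div a b => a.cost σ + b.cost σ + 1
  | .sqrt a => a.cost σ + 1
  | .floor a => a.cost σ + bits (a.eval σ) + 1

def State.tick (σ : State) (t : ℕ) : State := { σ with time := σ.time + t }

def State.writeN (σ : State) (x v : ℕ) : State := { σ with nat := Function.update σ.nat x v }

def State.writeR (σ : State) (a i j : ℕ) (v : ℝ) : State :=
  { σ with arr := fun a' i' j' => if a' = a ∧ i' = i ∧ j' = j then v else σ.arr a' i' j' }

/-- A row of `n + 1` reals read as an LWE sample: `n` integers, taken modulo `p`, and a real number
taken modulo `1`. -/
def decode (n p : ℕ) (row : ℕ → ℝ) : Sample n p :=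
  (fun j => ((⌊row j⌋ : ℤ) : ZMod p), ((row n : ℝ) : UnitAddCircle))

section semantics

variable {p N : ℕ → ℕ} {Ω : Type*} [MeasurableSpace Ω]

/-- The effect of an oracle call in dimension `n` with internal randomness `w`; elements of `ℤ_p`
in the answer are represented by `0, …, p - 1`. -/
def State.oracleCall (σ : State) (W : Oracle p N Ω) (n : ℕ) (w : Ω) (a o : ℕ) : State :=
  { σ with
    arr := fun a' i' j' =>
      if h : a' = o ∧ i' = 0 ∧ j' < n then
        ((W.out n (fun i => decode n (p n) (σ.arr a i)) w ⟨j', h.2.2⟩).val : ℝ)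
      else σ.arr a' i' j'
    calls := σ.calls + 1 }

/-- Semantics with step count. `g k` is the `k`-th sample from `ν_1`, and `w k` is the internal
randomness of the `k`-th oracle call. -/
def Prog.exec (W : Oracle p N Ω) (n : ℕ) (g : ℕ → ℝ) (w : ℕ → Ω) : Prog → State → State
  | .skip, σ => σ.tick 1
  | .setN x e, σ => (σ.writeN x (e.eval σ)).tick (e.cost + 1)
  | .setR a i j e, σ =>
      (σ.writeR a (i.eval σ) (j.eval σ) (e.eval σ)).tick (i.cost + j.cost + e.cost σ + 1)
  | .gauss a i j, σ =>
      { (σ.writeR a (i.eval σ) (j.eval σ) (g σ.coins)).tick (i.cost + j.cost + 1) with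
        coins := σ.coins + 1 }
  | .call a o, σ => (σ.oracleCall W n (w σ.calls) a o).tick (N n * (n + 1) + n + 1)
  | .seq c d, σ => d.exec W n g w (c.exec W n g w σ)
  | .ifLe e f c d, σ =>
      if e.eval σ ≤ f.eval σ then c.exec W n g w (σ.tick (e.cost σ + f.cost σ + 1))
      else d.exec W n g w (σ.tick (e.cost σ + f.cost σ + 1))
  | .loop x e c, σ =>
      (List.range (e.eval σ)).foldl
        (fun τ i => c.exec W n g w ((τ.writeN x i).tick 1)) (σ.tick (e.cost + 1))

end semantics

/-! ### Inputs, outputs and resources of the reduction -/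

/-- The initial state on an input consisting of the dimension `n` (register `0`), a lattice basis
`B` (array `0`), the numbers `p, α, r` (row `0` of array `1`), a target point `x` (row `0` of array
`2`), and `m` further vectors `v` (the rows of array `3`). Everything else is zero. -/
def initState {n m : ℕ} (B : Matrix (Fin n) (Fin n) ℝ) (p : ℕ) (α r : ℝ) (x : E n)
    (v : Fin m → E n) : State where
  nat := fun k => if k = 0 then n else 0
  arr := fun a i j =>
    if a = 0 then (if h : i < n ∧ j < n then B ⟨i, h.1⟩ ⟨j, h.2⟩ else 0)
    else if a = 1 then
      (if i = 0 ∧ j = 0 then (p : ℝ) else if i = 0 ∧ j = 1 then α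
        else if i = 0 ∧ j = 2 then r else 0)
    else if a = 2 then (if h : i = 0 ∧ j < n then x ⟨j, h.2⟩ else 0)
    else if a = 3 then (if h : i < m ∧ j < n then v ⟨i, h.1⟩ ⟨j, h.2⟩ else 0)
    else 0
  coins := 0
  calls := 0
  time := 0

/-- The output is row `0` of array `4`. -/
def State.output (σ : State) : ℕ → ℝ := σ.arr 4 0

/-- The output, read as a vector. -/
def State.outputVec (σ : State) (n : ℕ) : E n := WithLp.toLp 2 fun j => σ.output j

/-- The length of the input: the dimension plus the lengths of all the numbers in it. The lengths of
the entries of the dual basis account for the digits of `B` after the binary point. -/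
def inputSize {n m : ℕ} (B : Matrix (Fin n) (Fin n) ℝ) (p : ℕ) (α r : ℝ) (x : E n)
    (v : Fin m → E n) : ℕ :=
  n + ∑ i, ∑ j, (bits (B i j) + bits (B⁻¹ i j)) + bits p + bits α + bits r + ∑ j, bits (x j)
    + ∑ k, ∑ j, bits (v k j)

section resources

variable {p N : ℕ → ℕ} {Ω : Type*} [MeasurableSpace Ω]

/-- With `m n` input vectors in dimension `n`, the program runs in time polynomial in the input
length, on all inputs, whatever the random choices are. -/
def Prog.PolyTime (Q : Prog) (W : Oracle p N Ω) (α : ℕ → ℝ) (m : ℕ → ℕ) : Prop :=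
  ∃ K : ℕ, ∀ (n : ℕ) (B : Matrix (Fin n) (Fin n) ℝ), B.det ≠ 0 →
    ∀ r : ℝ, 0 < r → ∀ (x : E n) (v : Fin (m n) → E n) (g : ℕ → ℝ) (w : ℕ → Ω),
      (Q.exec W n g w (initState B (p n) (α n) r x v)).time
        ≤ K * (inputSize B (p n) (α n) r x v + 1) ^ K

/-- The joint law of `m` independent samples from `D_{L,r}`, of the machine's Gaussian samples, and
of the internal randomness of the oracle calls. -/
def runLaw {n : ℕ} (L : Submodule ℤ (E n)) (r : ℝ) (m : ℕ) (P : Measure Ω) :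
    Measure ((Fin m → E n) × (ℕ → ℝ) × (ℕ → Ω)) :=
  (Measure.pi fun _ : Fin m => discreteGaussian L r).prod
    ((Measure.infinitePi fun _ : ℕ => nu 1).prod (Measure.infinitePi fun _ : ℕ => P))

end resources

end LWERed

end

open MeasureTheory ProbabilityTheory

noncomputable section

/-! ### Gaussians over ℤⁿ: summability, unfolding of integrals, Fourier transform -/

namespace LWERed

/-! Let κ be the dual lattice point closest to x, with coordinates k in the dual basis, and let z =
(x - κ)/p. For v in L with coordinates c, the number ⟨x,v⟩/p is ⟨k,c⟩/p + ⟨z,v⟩. Hence (c mod p,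
⟨x,v⟩/p + σg), with g a fresh normal variable, is an LWE sample with secret k mod p and noise ⟨z,v⟩
+ σg (`decode_eq_lweMap`). What has to be shown is that, for v from D_{L,r}, the pair (c mod p,
⟨z,v⟩ + σg) is almost a uniform residue and an independent normal variable of parameter β = √(σ² +
r²‖z‖²).

Up to a constant, the density of this pair at (a,t) is the sum of exp(-π(‖v‖²/r² + (t - ⟨z,v⟩)²/σ²))
over a coset of pL. Completing the square (`coset_term_eq`) turns it into exp(-πt²/β²) times the
mass of a shifted lattice under the quadratic form I/r² + zzᵀ/σ². By Poisson summation
(`abs_det_mul_tsum_gaussMat_sub_one_le`) this mass is, up to factors 1 ± ε, independent of the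
shift, because the form is at most 2/r² when r‖z‖ ≤ σ, and r > √2·p·s for some s whose dual mass is
at most ε. Thus the two laws bound each other up to the factor (1+ε)/(1-ε) (`jointLaw_le`). With σ =
α/√2 this gives the second claim (`sampleProg_close`).

For the closest vector problem the oracle returns k mod p. Subtracting that digit from the
coordinates of x and dividing by p gives a new instance with coordinates ⌊k/p⌋ and an error p times
smaller. After n rounds the error is divided by pⁿ, so its inner products with the samples are below
1/2 and rounding yields exact integer equations for the remaining coordinates. The samples span ℝⁿ
because they already span modulo 2, so these equations are solved by linear algebra; no basis
reduction is needed (`cvpRounds_spec`, `cvpFinish_spec`, `cvpProg_output`).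

The oracle expects noise exactly Ψ_α, whereas β depends on the unknown ‖x - κ‖. The program
therefore tries m guesses for r²‖z‖² and chooses σ accordingly. For the right guess, β² lies between
α²(1 - 1/(2m)) and α². A narrower normal law is bounded by α/β times the wider one
(`nu_le_smul_nu`), so on N ≤ m samples the oracle's failure probability grows only by the constant
factor ((1+ε)/(1-ε)·α/β)^N ≤ 8 (`ratio_pow_le`). The multiplicative form of the comparison is
essential: a merely negligible statistical distance would not keep the failure probability
exponentially small. Wrong guesses do no harm, since a candidate is output only if it lies within
αp/(√2 r) of x, and two dual lattice points are never both that close (`eq_of_close`).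

Rounding is the only operation whose cost depends on the data. The program rounds a number only if
its square is at most a bound computed from the input, which makes the running time polynomial
whatever the oracle answers; in a correct trial the guards never act. -/

open Matrix in
lemma mulVec_dot_le {n : ℕ} (M : Matrix (Fin n) (Fin n) ℝ) (z : Fin n → ℝ) :
    (M *ᵥ z) ⬝ᵥ (M *ᵥ z) ≤ (∑ i, ∑ j, M i j ^ 2) * (z ⬝ᵥ z) := by
  rw [Finset.sum_mul]
  refine Finset.sum_le_sum fun i _ => ?_
  simp only [dotProduct, mulVec, ← pow_two]
  exact Finset.sum_mul_sq_le_sq_mul_sq _ _ _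

-- Bound A⁻¹ by its Frobenius norm and apply it to A y.
open Matrix in
lemma exists_pos_le_mulVec_dot {n : ℕ} {A : Matrix (Fin n) (Fin n) ℝ} (hA : A.det ≠ 0) :
    ∃ c : ℝ, 0 < c ∧ ∀ y, c * (y ⬝ᵥ y) ≤ (A *ᵥ y) ⬝ᵥ (A *ᵥ y) := by
  set K := ∑ i, ∑ j, A⁻¹ i j ^ 2
  have hK : 0 ≤ K := Finset.sum_nonneg fun i _ => Finset.sum_nonneg fun j _ => sq_nonneg _
  -- K + 1 instead of K, because K vanishes when n = 0.
  refine ⟨(K + 1)⁻¹, by positivity, fun y => ?_⟩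
  rw [inv_mul_le_iff₀ (by positivity)]
  have h := mulVec_dot_le A⁻¹ (A *ᵥ y)
  rw [mulVec_mulVec, nonsing_inv_mul _ (isUnit_iff_ne_zero.mpr hA), one_mulVec] at h
  have h2 : 0 ≤ (A *ᵥ y) ⬝ᵥ (A *ᵥ y) := Finset.sum_nonneg fun i _ => mul_self_nonneg _
  nlinarith

/-- A finite set of index vectors lies in the box of its coordinate projections, and over a box the
sum of products factors. -/
lemma summable_prod_pi {ι κ : Type*} [Fintype ι] [DecidableEq ι] [DecidableEq κ]
    {f : κ → ℝ} (hf : Summable f) (h0 : ∀ k, 0 ≤ f k) :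
    Summable fun k : ι → κ => ∏ i, f (k i) := by
  refine summable_of_sum_le (c := ∏ _i : ι, ∑' k, f k)
    (fun k => Finset.prod_nonneg fun i _ => h0 _) fun s => ?_
  calc ∑ k ∈ s, ∏ i, f (k i)
      ≤ ∑ k ∈ Fintype.piFinset (fun i => s.image fun k => k i), ∏ i, f (k i) := by
        refine Finset.sum_le_sum_of_subset_of_nonneg (fun k hk => ?_)
          fun k _ _ => Finset.prod_nonneg fun i _ => h0 _
        exact Fintype.mem_piFinset.mpr fun i => Finset.mem_image_of_mem _ hk
    _ = ∏ i, ∑ k ∈ s.image (fun k => k i), f k := (Finset.prod_univ_sum _ _).symm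
    _ ≤ _ := Finset.prod_le_prod (fun i _ => Finset.sum_nonneg fun k _ => h0 k)
        fun i _ => hf.sum_le_tsum _ fun k _ => h0 k

lemma summable_exp_neg_int_sq {b : ℝ} (hb : 0 < b) :
    Summable fun k : ℤ => Real.exp (-b * (k : ℝ) ^ 2) := by
  have hn : Summable fun k : ℕ => Real.exp (-b * (k : ℝ) ^ 2) := by
    refine Summable.of_nonneg_of_le (fun _ => (Real.exp_pos _).le) (fun k => ?_)
      (Real.summable_exp_nat_mul_iff.mpr (neg_neg_of_pos hb))
    refine Real.exp_le_exp.mpr ?_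
    have : (k : ℝ) ≤ (k : ℝ) ^ 2 := by exact_mod_cast Nat.le_self_pow two_ne_zero k
    nlinarith
  refine Summable.of_nat_of_neg (by simpa using hn) (by simpa using hn)

lemma summable_exp_neg_dot {n : ℕ} {b : ℝ} (hb : 0 < b) :
    Summable fun k : Fin n → ℤ => Real.exp (-b * ∑ i, (k i : ℝ) ^ 2) := by
  have := summable_prod_pi (ι := Fin n) (summable_exp_neg_int_sq hb) fun _ => (Real.exp_pos _).le
  refine this.congr fun k => ?_
  rw [← Real.exp_sum, Finset.mul_sum]


/-- The cube `(0,1]ⁿ`. -/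
def unitCube (n : ℕ) : Set (Fin n → ℝ) := {x | ∀ i, x i ∈ Set.Ioc (0 : ℝ) (0 + 1)}

lemma measurableSet_unitCube (n : ℕ) : MeasurableSet (unitCube n) :=
  MeasurableSet.univ_pi' fun _ => measurableSet_Ioc

/-- The integer translates of the cube tile ℝⁿ. The cube is open on the left to match the domain of
integration in the formula for Fourier coefficients on the torus. -/
lemma hasSum_integral_unitCube {n : ℕ} {F : Type*} [NormedAddCommGroup F] [NormedSpace ℝ F]
    {f : (Fin n → ℝ) → F} (hf : Integrable f) :
    HasSum (fun k : Fin n → ℤ => ∫ x in unitCube n, f (x + fun i => (k i : ℝ))) (∫ x, f x) := by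
  set s : (Fin n → ℤ) → Set (Fin n → ℝ) := fun k => (fun x => x - fun i => (k i : ℝ)) ⁻¹' unitCube n
  have hs : ∀ k, MeasurableSet (s k) := fun k =>
    (measurable_id.sub_const _) (measurableSet_unitCube n)
  -- With cubes open on the left, the cube of x has index ⌈x⌉ - 1 rather than ⌊x⌋.
  have hmem : ∀ k x, x ∈ s k ↔ ∀ i, k i = ⌈x i⌉ - 1 := by
    intro k x
    simp only [s, unitCube, Set.mem_preimage, Set.mem_ofPred_eq, Pi.sub_apply, Set.mem_Ioc]
    refine forall_congr' fun i => ?_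
    rw [eq_sub_iff_add_eq, eq_comm, Int.ceil_eq_iff]
    push_cast
    constructor <;> rintro ⟨h1, h2⟩ <;> constructor <;> linarith
  have hd : Pairwise (Function.onFun Disjoint s) := by
    intro k l hkl
    refine Set.disjoint_left.mpr fun x hx hy => hkl ?_
    funext i
    rw [(hmem k x).mp hx i, (hmem l x).mp hy i]
  have hu : ⋃ k, s k = Set.univ :=
    Set.eq_univ_of_forall fun x => Set.mem_iUnion.mpr ⟨fun i => ⌈x i⌉ - 1, (hmem _ x).mpr fun _ => rfl⟩
  have h := hasSum_integral_iUnion (μ := volume) hs hd (f := f) hf.integrableOn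
  rw [hu, setIntegral_univ] at h
  convert h using 2 with k
  have := (measurePreserving_add_right volume (fun i => (k i : ℝ))).setIntegral_preimage_emb
    (measurableEmbedding_addRight _) f (s k)
  rw [← this]
  congr 2
  ext x
  simp [s]

lemma continuous_mulVec_exp {n : ℕ} (A : Matrix (Fin n) (Fin n) ℝ) :
    Continuous fun y => Real.exp (-Real.pi * (A.mulVec y ⬝ᵥ A.mulVec y)) := by
  unfold Matrix.mulVec dotProduct
  fun_prop

/-- The substitution z = A y turns the character of frequency m into one of frequency A⁻ᵀ m and the
Gaussian into the standard one, which is its own Fourier transform. -/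
lemma integral_mFourier_mul_gaussian {n : ℕ} {A : Matrix (Fin n) (Fin n) ℝ} (hA : A.det ≠ 0)
    (m : Fin n → ℤ) :
    ∫ y : Fin n → ℝ, UnitAddTorus.mFourier (-m) (fun i => (y i : UnitAddCircle)) *
      (Real.exp (-Real.pi * (A.mulVec y ⬝ᵥ A.mulVec y)) : ℂ) =
    |A.det|⁻¹ * (Real.exp (-Real.pi * (A⁻¹.transpose.mulVec (fun i => (m i : ℝ)) ⬝ᵥ
      A⁻¹.transpose.mulVec (fun i => (m i : ℝ)))) : ℂ) := by
  set u := A⁻¹.transpose.mulVec (fun i => (m i : ℝ)) with hu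
  set g : (Fin n → ℝ) → ℂ := fun z => Complex.exp (-(Real.pi : ℂ) * ∑ i, (z i : ℂ) ^ 2 +
    ∑ i, (-(2 * Real.pi * Complex.I * u i)) * (z i : ℂ)) with hg
  have hgc : Continuous g := by fun_prop
  have h1 : ∀ y : Fin n → ℝ, UnitAddTorus.mFourier (-m) (fun i => (y i : UnitAddCircle)) *
      (Real.exp (-Real.pi * (A.mulVec y ⬝ᵥ A.mulVec y)) : ℂ) = g (Matrix.toLin' A y) := by
    intro y
    simp only [UnitAddTorus.mFourier, ContinuousMap.coe_mk, fourier_coe_apply, hg,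
      ← Complex.exp_sum, Complex.ofReal_exp, ← Complex.exp_add, Matrix.toLin'_apply]
    congr 1
    have h2 : ∑ i, u i * (A.mulVec y) i = ∑ i, (m i : ℝ) * y i := by
      change u ⬝ᵥ A.mulVec y = (fun i => (m i : ℝ)) ⬝ᵥ y
      rw [hu, Matrix.dotProduct_mulVec, Matrix.vecMul_mulVec, Matrix.transpose_transpose,
        Matrix.nonsing_inv_mul _ (isUnit_iff_ne_zero.mpr hA)]
      simp
    have h3 : ∑ i, (-(2 * Real.pi * Complex.I * u i)) * ((A.mulVec y) i : ℂ)
        = -(2 * Real.pi * Complex.I) * ((∑ i, u i * (A.mulVec y) i : ℝ) : ℂ) := by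
      push_cast
      rw [Finset.mul_sum]
      exact Finset.sum_congr rfl fun i _ => by ring
    rw [h3, h2, add_comm]
    congr 1
    · simp only [dotProduct]; push_cast
      simp [pow_two]
    · push_cast
      rw [Finset.mul_sum]
      exact Finset.sum_congr rfl fun i _ => by simp; ring
  simp_rw [h1]
  have hm : Measurable (Matrix.toLin' A) := (LinearMap.continuous_of_finiteDimensional _).measurable
  rw [← integral_map (φ := Matrix.toLin' A) (f := g) hm.aemeasurable hgc.aestronglyMeasurable,
    Real.map_matrix_volume_pi_eq_smul_volume_pi hA, integral_smul_measure,
    GaussianFourier.integral_cexp_neg_mul_sum_add (by simpa using Real.pi_pos)]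
  have hpi : (Real.pi : ℂ) ≠ 0 := by exact_mod_cast Real.pi_ne_zero
  rw [div_self hpi, Complex.one_cpow, one_mul, ENNReal.toReal_ofReal (abs_nonneg _), abs_inv]
  simp only [Complex.real_smul, Complex.ofReal_inv, Complex.ofReal_exp]
  congr 2
  have : ∀ i, (-(2 * Real.pi * Complex.I * u i)) ^ 2 = -(4 * Real.pi ^ 2) * ((u i : ℂ) * u i) := by
    intro i
    linear_combination (4 * Real.pi ^ 2 * (u i : ℂ) ^ 2) * Complex.I_sq
  simp_rw [this, ← Finset.mul_sum]
  simp only [dotProduct]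
  push_cast
  field_simp

end LWERed

/-! ### Poisson summation for Gaussians with an arbitrary invertible matrix -/

namespace LWERed

/-- `exp(-π ‖A y‖²)`. -/
def gaussMat {n : ℕ} (A : Matrix (Fin n) (Fin n) ℝ) (y : Fin n → ℝ) : ℝ :=
  Real.exp (-Real.pi * (A.mulVec y ⬝ᵥ A.mulVec y))

lemma gaussMat_pos {n : ℕ} (A : Matrix (Fin n) (Fin n) ℝ) (y : Fin n → ℝ) : 0 < gaussMat A y :=
  Real.exp_pos _

lemma integrable_gaussMat {n : ℕ} {A : Matrix (Fin n) (Fin n) ℝ} (hA : A.det ≠ 0) :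
    Integrable (gaussMat A) := by
  have h := GaussianFourier.integrable_cexp_neg_mul_sum_add (b := Real.pi)
    (by simpa using Real.pi_pos) (0 : Fin n → ℂ)
  have hm : Measurable (Matrix.toLin' A) := (LinearMap.continuous_of_finiteDimensional _).measurable
  have h2 := (h.norm.smul_measure (c := ENNReal.ofReal |A.det⁻¹|) ENNReal.ofReal_ne_top)
  rw [← Real.map_matrix_volume_pi_eq_smul_volume_pi hA] at h2
  refine (h2.comp_measurable hm).congr (Filter.Eventually.of_forall fun y => ?_)
  simp only [Function.comp, Complex.norm_exp, gaussMat, dotProduct, Matrix.toLin'_apply]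
  congr 1
  simp [pow_two]

/-- Uses ‖θ + k‖² ≥ ‖k‖²/2 - ‖θ‖². The bound is uniform over bounded θ, so it serves both for
summability and for continuity of the sum in θ. -/
lemma gaussMat_add_le {n : ℕ} {A : Matrix (Fin n) (Fin n) ℝ} {c : ℝ} (hc : 0 < c)
    (hA : ∀ y, c * (y ⬝ᵥ y) ≤ (A.mulVec y) ⬝ᵥ (A.mulVec y)) {R : ℝ} {θ : Fin n → ℝ}
    (hθ : θ ⬝ᵥ θ ≤ R) (k : Fin n → ℤ) :
    gaussMat A (θ + fun i => (k i : ℝ)) ≤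
      Real.exp (Real.pi * c * R) * Real.exp (-(Real.pi * c / 2) * ∑ i, (k i : ℝ) ^ 2) := by
  rw [gaussMat, ← Real.exp_add, Real.exp_le_exp]
  have h1 := hA (θ + fun i => (k i : ℝ))
  have h2 : (∑ i, (k i : ℝ) ^ 2) / 2 - θ ⬝ᵥ θ ≤
      (θ + fun i => (k i : ℝ)) ⬝ᵥ (θ + fun i => (k i : ℝ)) := by
    simp only [dotProduct, Finset.sum_div, ← Finset.sum_sub_distrib]
    refine Finset.sum_le_sum fun i _ => ?_
    simp only [Pi.add_apply]
    nlinarith [sq_nonneg (2 * θ i + k i)]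
  have h3 : c * ((∑ i, (k i : ℝ) ^ 2) / 2 - R) ≤
      A.mulVec (θ + fun i => (k i : ℝ)) ⬝ᵥ A.mulVec (θ + fun i => (k i : ℝ)) :=
    (mul_le_mul_of_nonneg_left (by linarith) hc.le).trans h1
  nlinarith [mul_le_mul_of_nonneg_left h3 Real.pi_pos.le]

lemma summable_gaussMat {n : ℕ} {A : Matrix (Fin n) (Fin n) ℝ} (hA : A.det ≠ 0) (θ : Fin n → ℝ) :
    Summable fun k : Fin n → ℤ => gaussMat A (θ + fun i => (k i : ℝ)) := by
  obtain ⟨c, hc, h⟩ := exists_pos_le_mulVec_dot hA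
  exact Summable.of_nonneg_of_le (fun _ => (gaussMat_pos _ _).le)
    (fun k => gaussMat_add_le hc h le_rfl k)
    ((summable_exp_neg_dot (by have := Real.pi_pos; positivity)).mul_left _)

lemma summable_gaussMat_int {n : ℕ} {A : Matrix (Fin n) (Fin n) ℝ} (hA : A.det ≠ 0) :
    Summable fun k : Fin n → ℤ => gaussMat A fun i => (k i : ℝ) := by
  simpa using summable_gaussMat hA 0

lemma continuous_tsum_gaussMat {n : ℕ} {A : Matrix (Fin n) (Fin n) ℝ} (hA : A.det ≠ 0) :
    Continuous fun θ => ∑' k : Fin n → ℤ, gaussMat A (θ + fun i => (k i : ℝ)) := by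
  obtain ⟨c, hc, h⟩ := exists_pos_le_mulVec_dot hA
  refine continuous_iff_continuousAt.mpr fun θ => ?_
  have hcd : Continuous fun y : Fin n → ℝ => y ⬝ᵥ y := by unfold dotProduct; fun_prop
  have hU : {y : Fin n → ℝ | y ⬝ᵥ y < θ ⬝ᵥ θ + 1} ∈ nhds θ :=
    (isOpen_lt hcd continuous_const).mem_nhds (lt_add_one (θ ⬝ᵥ θ))
  refine ContinuousOn.continuousAt (continuousOn_tsum (fun k => ?_)
    ((summable_exp_neg_dot (b := Real.pi * c / 2) (by have := Real.pi_pos; positivity)).mul_left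
      (Real.exp (Real.pi * c * (θ ⬝ᵥ θ + 1)))) fun k y hy => ?_) hU
  · exact ((continuous_mulVec_exp A).comp (continuous_add_const _)).continuousOn
  · rw [Real.norm_of_nonneg (gaussMat_pos _ _).le]
    exact gaussMat_add_le hc h (le_of_lt hy) k

lemma isOpenQuotientMap_toTorus (n : ℕ) :
    IsOpenQuotientMap fun (θ : Fin n → ℝ) (i : Fin n) => (θ i : UnitAddCircle) :=
  IsOpenQuotientMap.piMap (f := fun (_ : Fin n) (t : ℝ) => (t : UnitAddCircle)) fun _ =>
    QuotientAddGroup.isOpenQuotientMap_mk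

/-- The sum of the translates of the Gaussian by integer vectors. -/
def sumGauss {n : ℕ} {A : Matrix (Fin n) (Fin n) ℝ} (hA : A.det ≠ 0) : C(Fin n → ℝ, ℂ) :=
  ⟨fun θ => ((∑' k : Fin n → ℤ, gaussMat A (θ + fun i => (k i : ℝ)) : ℝ) : ℂ),
    Complex.continuous_ofReal.comp (continuous_tsum_gaussMat hA)⟩

/-- The projection to the torus. -/
def toTorus (n : ℕ) : C(Fin n → ℝ, UnitAddTorus (Fin n)) :=
  ⟨fun θ i => (θ i : UnitAddCircle), (isOpenQuotientMap_toTorus n).continuous⟩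

lemma sumGauss_factors {n : ℕ} {A : Matrix (Fin n) (Fin n) ℝ} (hA : A.det ≠ 0) :
    Function.FactorsThrough (sumGauss hA) (toTorus n) := by
  intro θ θ' h
  have h1 : ∀ i, ∃ l : ℤ, θ' i + l = θ i := fun i => by
    have h2 : ((θ i - θ' i : ℝ) : UnitAddCircle) = 0 := by
      rw [AddCircle.coe_sub, sub_eq_zero]
      exact congrFun h i
    obtain ⟨l, hl⟩ := (AddCircle.coe_eq_zero_iff _).mp h2
    exact ⟨l, by rw [zsmul_one] at hl; linarith⟩
  choose l hl using h1
  simp only [sumGauss, ContinuousMap.coe_mk]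
  rw [← (Equiv.addRight l).tsum_eq fun k : Fin n → ℤ => gaussMat A (θ' + fun i => (k i : ℝ))]
  congr 2
  funext k
  congr 1
  funext i
  simp only [Pi.add_apply, Equiv.coe_addRight, Int.cast_add, ← hl]
  ring

/-- The Gaussian made periodic, as a function on the torus. -/
def periodicGauss {n : ℕ} {A : Matrix (Fin n) (Fin n) ℝ} (hA : A.det ≠ 0) :
    C(UnitAddTorus (Fin n), ℂ) :=
  Topology.IsQuotientMap.lift (f := toTorus n) (isOpenQuotientMap_toTorus n).isQuotientMap
    (sumGauss hA) (sumGauss_factors hA)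

lemma periodicGauss_coe {n : ℕ} {A : Matrix (Fin n) (Fin n) ℝ} (hA : A.det ≠ 0) (θ : Fin n → ℝ) :
    periodicGauss hA (fun i => (θ i : UnitAddCircle)) =
      ((∑' k : Fin n → ℤ, gaussMat A (θ + fun i => (k i : ℝ)) : ℝ) : ℂ) :=
  congrArg (fun g : C(Fin n → ℝ, ℂ) => g θ) (Topology.IsQuotientMap.lift_comp
    (f := toTorus n) (isOpenQuotientMap_toTorus n).isQuotientMap (sumGauss hA)
    (sumGauss_factors hA))

/-- Unfolding: a character is periodic, so the integral over the cube of its product with the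
periodized Gaussian is the integral over ℝⁿ of its product with the Gaussian itself. -/
lemma mFourierCoeff_periodicGauss {n : ℕ} {A : Matrix (Fin n) (Fin n) ℝ} (hA : A.det ≠ 0)
    (m : Fin n → ℤ) :
    UnitAddTorus.mFourierCoeff (periodicGauss hA) m =
      |A.det|⁻¹ * (gaussMat A⁻¹.transpose (fun i => (m i : ℝ)) : ℂ) := by
  rw [UnitAddTorus.mFourierCoeff_eq_integral _ _ 0]
  set e : (Fin n → ℝ) → ℂ := fun x => UnitAddTorus.mFourier (-m) (fun i => (x i : UnitAddCircle))
  have hec : Continuous e :=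
    (UnitAddTorus.mFourier (-m)).continuous.comp (isOpenQuotientMap_toTorus n).continuous
  have he1 : ∀ x, ‖e x‖ ≤ 1 := fun x =>
    ((UnitAddTorus.mFourier (-m)).norm_coe_le_norm _).trans_eq UnitAddTorus.mFourier_norm
  have hep : ∀ x (k : Fin n → ℤ), e (x + fun i => (k i : ℝ)) = e x := by
    intro x k
    simp only [e]
    congr 1
    funext i
    simp
  set h : (Fin n → ℝ) → ℂ := fun x => e x * (gaussMat A x : ℂ)
  have hi : Integrable h := by
    refine (integrable_gaussMat hA).ofReal.bdd_mul (c := 1) hec.aestronglyMeasurable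
      (Filter.Eventually.of_forall he1)
  have h1 := hasSum_integral_unitCube hi
  have h2 := hasSum_integral_unitCube hi.norm
  have h3 := integral_tsum_of_summable_integral_norm (μ := volume.restrict (unitCube n))
    (F := fun (k : Fin n → ℤ) x => h (x + fun i => (k i : ℝ)))
    (fun k => (hi.comp_add_right _).integrableOn) h2.summable
  rw [h1.tsum_eq] at h3
  rw [gaussMat, ← integral_mFourier_mul_gaussian hA]
  refine Eq.trans ?_ h3.symm
  have hcube : {x : Fin n → ℝ | ∀ i, x i ∈ Set.Ioc ((0 : Fin n → ℝ) i) ((0 : Fin n → ℝ) i + 1)}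
    = unitCube n := rfl
  rw [hcube]
  refine integral_congr_ae (Filter.Eventually.of_forall fun x => ?_)
  simp only [periodicGauss_coe, h, hep, smul_eq_mul, tsum_mul_left]
  rw [Complex.ofReal_tsum]

lemma det_inv_transpose_ne_zero {n : ℕ} {A : Matrix (Fin n) (Fin n) ℝ} (hA : A.det ≠ 0) :
    A⁻¹.transpose.det ≠ 0 := by
  rw [Matrix.det_transpose]
  exact (Matrix.isUnit_nonsing_inv_det _ (isUnit_iff_ne_zero.mpr hA)).ne_zero

/-- Poisson summation for Gaussians. -/
theorem hasSum_poisson_gaussMat {n : ℕ} {A : Matrix (Fin n) (Fin n) ℝ} (hA : A.det ≠ 0)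
    (θ : Fin n → ℝ) :
    HasSum (fun m : Fin n → ℤ => (|A.det|⁻¹ * gaussMat A⁻¹.transpose (fun i => (m i : ℝ)) : ℂ) *
        UnitAddTorus.mFourier m (fun i => (θ i : UnitAddCircle)))
      ((∑' k : Fin n → ℤ, gaussMat A (θ + fun i => (k i : ℝ)) : ℝ) : ℂ) := by
  have hs : Summable (UnitAddTorus.mFourierCoeff (periodicGauss hA)) := by
    simp_rw [funext (mFourierCoeff_periodicGauss hA)]
    exact (Complex.ofRealCLM.summable (summable_gaussMat_int (det_inv_transpose_ne_zero hA))).mul_left _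
  have := UnitAddTorus.hasSum_mFourier_series_apply_of_summable hs
    (fun i => (θ i : UnitAddCircle))
  simpa only [periodicGauss_coe, mFourierCoeff_periodicGauss, smul_eq_mul] using this

/-- In the Poisson formula multiplied by |det A| the zero frequency contributes 1; all other terms
are bounded by their absolute values, in which θ no longer occurs. -/
theorem abs_det_mul_tsum_gaussMat_sub_one_le {n : ℕ} {A : Matrix (Fin n) (Fin n) ℝ}
    (hA : A.det ≠ 0) (θ : Fin n → ℝ) :
    |(|A.det| * ∑' k : Fin n → ℤ, gaussMat A (θ + fun i => (k i : ℝ))) - 1| ≤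
      ∑' m : {m : Fin n → ℤ // m ≠ 0}, gaussMat A⁻¹.transpose (fun i => (m.1 i : ℝ)) := by
  have hd : ((|A.det| : ℝ) : ℂ) ≠ 0 := by exact_mod_cast (abs_pos.mpr hA).ne'
  have h := (hasSum_poisson_gaussMat hA θ).mul_left ((|A.det| : ℝ) : ℂ)
  set G : (Fin n → ℤ) → ℂ := fun m => (gaussMat A⁻¹.transpose (fun i => (m i : ℝ)) : ℂ) *
        UnitAddTorus.mFourier m (fun i => (θ i : UnitAddCircle)) with hG
  have h' : HasSum G (((|A.det| : ℝ) : ℂ) * (∑' k : Fin n → ℤ, gaussMat A (θ + fun i => (k i : ℝ)) : ℝ) : ℂ) := by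
    refine h.congr_fun fun m => ?_
    rw [hG]
    simp only [Complex.ofReal_inv]
    field_simp
  have hnorm : ∀ m, ‖G m‖ ≤ gaussMat A⁻¹.transpose (fun i => (m i : ℝ)) := by
    intro m
    rw [hG]
    simp only [norm_mul]
    have h1 : ‖UnitAddTorus.mFourier m (fun i => (θ i : UnitAddCircle))‖ ≤ 1 :=
      ((UnitAddTorus.mFourier m).norm_coe_le_norm _).trans_eq UnitAddTorus.mFourier_norm
    rw [Complex.norm_real, Real.norm_of_nonneg (gaussMat_pos _ _).le]
    exact mul_le_of_le_one_right (gaussMat_pos _ _).le h1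
  have hs := summable_gaussMat_int (det_inv_transpose_ne_zero hA)
  have hs' := hs.subtype fun m => m ≠ 0
  have h0 : G 0 = 1 := by simp [hG, gaussMat, UnitAddTorus.mFourier_zero, Matrix.mulVec, dotProduct]
  have h2 : ∑' m : {m : Fin n → ℤ // m ≠ 0}, G m =
      (((|A.det| : ℝ) : ℂ) * (∑' k : Fin n → ℤ, gaussMat A (θ + fun i => (k i : ℝ)) : ℝ) : ℂ) - 1 := by
    have := h'.summable.tsum_subtype_add_tsum_subtype_compl {0}
    rw [tsum_singleton (0 : Fin n → ℤ) G, h0, h'.tsum_eq] at this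
    rw [← this]
    simp
    rfl
  have h3 := tsum_of_norm_bounded hs'.hasSum fun m : {m : Fin n → ℤ // m ≠ 0} => hnorm m
  rw [h2] at h3
  refine le_trans (le_of_eq ?_) h3
  rw [← Real.norm_eq_abs, ← Complex.norm_real]
  push_cast
  rfl

end LWERed

namespace LWERed

open Matrix

/-! ### Lattices in coordinates -/

/-- The lattice vector `B k`. -/
def latVec {n : ℕ} (B : Matrix (Fin n) (Fin n) ℝ) (k : Fin n → ℤ) : E n :=
  WithLp.toLp 2 (B *ᵥ fun i => (k i : ℝ))

lemma mem_lattice_iff {n : ℕ} (B : Matrix (Fin n) (Fin n) ℝ) (v : E n) :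
    v ∈ lattice B ↔ ∃ k, latVec B k = v := by
  rw [lattice, Submodule.mem_span_range_iff_exists_fun]
  refine exists_congr fun k => ?_
  have : ∑ i, k i • (WithLp.toLp 2 fun j => B j i : E n) = latVec B k := by
    ext j
    simp [latVec, mulVec, dotProduct, mul_comm]
  rw [this]

lemma inner_toLp {n : ℕ} (a b : Fin n → ℝ) :
    inner ℝ (WithLp.toLp 2 a : E n) (WithLp.toLp 2 b) = a ⬝ᵥ b := by
  simp [PiLp.inner_apply, dotProduct, mul_comm]

lemma norm_sq_eq_dot {n : ℕ} (v : E n) : ‖v‖ ^ 2 = v.ofLp ⬝ᵥ v.ofLp := by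
  rw [EuclideanSpace.real_norm_sq_eq]
  simp [dotProduct, pow_two]

lemma inner_eq_dot {n : ℕ} (v w : E n) : inner ℝ v w = v.ofLp ⬝ᵥ w.ofLp := inner_toLp _ _

lemma latVec_injective {n : ℕ} {B : Matrix (Fin n) (Fin n) ℝ} (hB : B.det ≠ 0) :
    Function.Injective (latVec B) := by
  intro k l h
  have h1 : B *ᵥ (fun i => (k i : ℝ)) = B *ᵥ fun i => (l i : ℝ) := congrArg WithLp.ofLp h
  have h2 := Matrix.mulVec_injective_iff_isUnit.mpr
    ((Matrix.isUnit_iff_isUnit_det B).mpr (isUnit_iff_ne_zero.mpr hB)) h1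
  funext i
  exact_mod_cast congrFun h2 i

/-- The lattice generated by an invertible matrix is `ℤⁿ`. -/
def latticeEquiv {n : ℕ} {B : Matrix (Fin n) (Fin n) ℝ} (hB : B.det ≠ 0) :
    (Fin n → ℤ) ≃ lattice B :=
  Equiv.ofBijective (fun k => ⟨latVec B k, (mem_lattice_iff B _).mpr ⟨k, rfl⟩⟩)
    ⟨fun _ _ h => latVec_injective hB (congrArg Subtype.val h),
      fun v => ((mem_lattice_iff B v).mp v.2).imp fun _ hk => Subtype.ext hk⟩

lemma mem_dualLattice_iff_inner {n : ℕ} (L : Submodule ℤ (E n)) (y : E n) :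
    y ∈ dualLattice L ↔ ∀ x ∈ L, ∃ m : ℤ, (m : ℝ) = inner ℝ y x := by
  rw [dualLattice, LinearMap.BilinForm.mem_dualSubmodule]
  refine forall₂_congr fun x _ => ?_
  rw [Submodule.mem_one]
  simp

lemma inv_mulVec_mulVec {n : ℕ} {B : Matrix (Fin n) (Fin n) ℝ} (hB : B.det ≠ 0) (v : Fin n → ℝ) :
    B⁻¹ *ᵥ (B *ᵥ v) = v := by
  rw [mulVec_mulVec, nonsing_inv_mul _ (isUnit_iff_ne_zero.mpr hB), one_mulVec]

lemma mulVec_inv_mulVec {n : ℕ} {B : Matrix (Fin n) (Fin n) ℝ} (hB : B.det ≠ 0) (v : Fin n → ℝ) :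
    B *ᵥ (B⁻¹ *ᵥ v) = v := by
  rw [mulVec_mulVec, mul_nonsing_inv _ (isUnit_iff_ne_zero.mpr hB), one_mulVec]

lemma inv_transpose_mulVec_dot {n : ℕ} {B : Matrix (Fin n) (Fin n) ℝ} (hB : B.det ≠ 0)
    (m k : Fin n → ℝ) : (B⁻¹ᵀ *ᵥ m) ⬝ᵥ (B *ᵥ k) = m ⬝ᵥ k := by
  rw [dotProduct_mulVec, vecMul_mulVec, transpose_transpose, nonsing_inv_mul _
    (isUnit_iff_ne_zero.mpr hB)]
  simp

lemma dot_inv_mulVec {n : ℕ} {B : Matrix (Fin n) (Fin n) ℝ} (hB : B.det ≠ 0)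
    (x v : Fin n → ℝ) : (Bᵀ *ᵥ x) ⬝ᵥ (B⁻¹ *ᵥ v) = x ⬝ᵥ v := by
  rw [dotProduct_mulVec, vecMul_mulVec, transpose_transpose, mul_nonsing_inv _
    (isUnit_iff_ne_zero.mpr hB)]
  simp

lemma mem_dualLattice_iff {n : ℕ} {B : Matrix (Fin n) (Fin n) ℝ} (hB : B.det ≠ 0) (y : E n) :
    y ∈ dualLattice (lattice B) ↔ ∃ m, latVec B⁻¹ᵀ m = y := by
  rw [mem_dualLattice_iff_inner]
  constructor
  · intro h
    have h1 : ∀ j : Fin n, ∃ m : ℤ, (m : ℝ) = (Bᵀ *ᵥ y.ofLp) j := by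
      intro j
      obtain ⟨m, hm⟩ := h (latVec B (Pi.single j 1)) ((mem_lattice_iff B _).mpr ⟨_, rfl⟩)
      refine ⟨m, hm.trans ?_⟩
      rw [inner_eq_dot, latVec, dotProduct_mulVec, vecMul_eq_sum, mulVec_eq_sum]
      have : (fun i => ((Pi.single j 1 : Fin n → ℤ) i : ℝ)) = Pi.single j 1 := by
        funext i
        by_cases hi : i = j
        · subst hi; simp
        · simp [Pi.single_eq_of_ne hi]
      simp only [this, dotProduct_single, mul_one]
      simp
    choose m hm using h1
    refine ⟨m, ?_⟩
    have h2 : (fun i => (m i : ℝ)) = Bᵀ *ᵥ y.ofLp := funext hm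
    rw [latVec, h2, transpose_nonsing_inv, inv_mulVec_mulVec (by rwa [det_transpose])]
  · rintro ⟨m, rfl⟩ x hx
    obtain ⟨k, rfl⟩ := (mem_lattice_iff B x).mp hx
    refine ⟨∑ i, m i * k i, ?_⟩
    rw [inner_eq_dot, latVec, latVec, inv_transpose_mulVec_dot hB]
    simp [dotProduct]

lemma latVec_zero {n : ℕ} (B : Matrix (Fin n) (Fin n) ℝ) : latVec B 0 = 0 := by
  ext i; simp [latVec, mulVec, dotProduct]

/-- The nonzero points of the dual lattice in coordinates. -/
def dualEquiv {n : ℕ} {B : Matrix (Fin n) (Fin n) ℝ} (hB : B.det ≠ 0) :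
    {m : Fin n → ℤ // m ≠ 0} ≃ {y : E n // y ∈ dualLattice (lattice B) ∧ y ≠ 0} :=
  Equiv.ofBijective (fun m => ⟨latVec B⁻¹ᵀ m, (mem_dualLattice_iff hB _).mpr ⟨_, rfl⟩, fun h =>
      m.2 (latVec_injective (det_inv_transpose_ne_zero hB) (h.trans (latVec_zero _).symm))⟩)
    ⟨fun _ _ h => Subtype.ext (latVec_injective (det_inv_transpose_ne_zero hB)
        (congrArg Subtype.val h)), by
      rintro ⟨y, hy, hy0⟩
      obtain ⟨m, rfl⟩ := (mem_dualLattice_iff hB y).mp hy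
      exact ⟨⟨m, fun h => hy0 (by rw [h, latVec_zero])⟩, rfl⟩⟩

lemma rho_latVec {n : ℕ} (B : Matrix (Fin n) (Fin n) ℝ) (s : ℝ) (k : Fin n → ℤ) :
    rho s (latVec B k) = gaussMat (s⁻¹ • B) (fun i => (k i : ℝ)) := by
  rw [rho, gaussMat, div_pow, norm_sq_eq_dot, latVec, smul_mulVec, smul_dotProduct, dotProduct_smul]
  simp only [smul_eq_mul]
  congr 2
  ring

/-- The Gaussian mass `ρ_{1/s}(L* \ {0})` in coordinates. -/
def dualMass {n : ℕ} (B : Matrix (Fin n) (Fin n) ℝ) (s : ℝ) : ℝ :=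
  ∑' m : {m : Fin n → ℤ // m ≠ 0}, gaussMat (s • B⁻¹ᵀ) (fun i => (m.1 i : ℝ))

lemma det_smul_ne_zero {n : ℕ} {B : Matrix (Fin n) (Fin n) ℝ} (hB : B.det ≠ 0) {s : ℝ}
    (hs : s ≠ 0) : (s • B).det ≠ 0 := by
  rw [det_smul]; exact mul_ne_zero (pow_ne_zero _ hs) hB

lemma summable_dualMass {n : ℕ} {B : Matrix (Fin n) (Fin n) ℝ} (hB : B.det ≠ 0) {s : ℝ}
    (hs : 0 < s) : Summable fun m : {m : Fin n → ℤ // m ≠ 0} =>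
      gaussMat (s • B⁻¹ᵀ) (fun i => (m.1 i : ℝ)) :=
  (summable_gaussMat_int (det_smul_ne_zero (det_inv_transpose_ne_zero hB) hs.ne')).subtype _

lemma tsum_rho_dual {n : ℕ} {B : Matrix (Fin n) (Fin n) ℝ} (hB : B.det ≠ 0) {s : ℝ}
    (hs : 0 < s) : ∑' y : {y : E n // y ∈ dualLattice (lattice B) ∧ y ≠ 0},
      ENNReal.ofReal (rho (1 / s) y.1) = ENNReal.ofReal (dualMass B s) := by
  rw [← (dualEquiv hB).tsum_eq, dualMass,
    ENNReal.ofReal_tsum_of_nonneg (fun _ => (gaussMat_pos _ _).le) (summable_dualMass hB hs)]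
  refine tsum_congr fun m => ?_
  change ENNReal.ofReal (rho (1 / s) (latVec B⁻¹ᵀ m)) = _
  rw [rho_latVec]
  simp

lemma gaussMat_smul_le {n : ℕ} {A : Matrix (Fin n) (Fin n) ℝ} {c s : ℝ} (hs : 1 ≤ s)
    {y : Fin n → ℝ} (hc : c ≤ (A *ᵥ y) ⬝ᵥ (A *ᵥ y)) :
    gaussMat (s • A) y ≤ Real.exp (-Real.pi * (s ^ 2 - 1) * c) * gaussMat A y := by
  rw [gaussMat, gaussMat, ← Real.exp_add, Real.exp_le_exp, smul_mulVec, smul_dotProduct,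
    dotProduct_smul]
  simp only [smul_eq_mul]
  have : 0 ≤ Real.pi * (s ^ 2 - 1) := mul_nonneg Real.pi_pos.le (by nlinarith)
  nlinarith [mul_le_mul_of_nonneg_left hc this]

/-- This makes the set in the definition of the smoothing parameter nonempty, without which its
infimum would be the default value 0. Nonzero integer vectors satisfy ‖B⁻ᵀm‖² ≥ c, so passing from
parameter 1 to s multiplies each term by at most exp(-π(s² - 1)c). -/
lemma exists_dualMass_le {n : ℕ} {B : Matrix (Fin n) (Fin n) ℝ} (hB : B.det ≠ 0) {ε : ℝ}
    (hε : 0 < ε) : ∃ s : ℝ, 0 < s ∧ dualMass B s ≤ ε := by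
  obtain ⟨c, hc, h⟩ := exists_pos_le_mulVec_dot (det_inv_transpose_ne_zero hB)
  set K := dualMass B 1
  have hK : 0 ≤ K := tsum_nonneg fun _ => (gaussMat_pos _ _).le
  -- Chosen so that π c (s - 1) = K/ε; then exp(π c (s² - 1)) ≥ K/ε.
  set s : ℝ := 1 + (K / ε) / (Real.pi * c) with hsdef
  have hpc : 0 < Real.pi * c := mul_pos Real.pi_pos hc
  have hs1 : 1 ≤ s := by
    rw [hsdef]
    have : 0 ≤ (K / ε) / (Real.pi * c) := by positivity
    linarith
  have hs0 : 0 < s := by linarith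
  refine ⟨s, hs0, ?_⟩
  have h1 : dualMass B s ≤ Real.exp (-Real.pi * (s ^ 2 - 1) * c) * K := by
    simp only [dualMass, K]
    rw [← tsum_mul_left]
    refine (summable_dualMass hB hs0).tsum_le_tsum (fun m => ?_) ((summable_dualMass hB one_pos).mul_left _)
    simp only [one_smul]
    refine gaussMat_smul_le hs1 (le_trans ?_ (h _))
    refine le_mul_of_one_le_right hc.le ?_
    obtain ⟨i, hi⟩ := Function.ne_iff.mp m.2
    have h2 : (1 : ℝ) ≤ (m.1 i : ℝ) * m.1 i := by
      have : 1 ≤ m.1 i * m.1 i := by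
        have := mul_self_pos.mpr hi; omega
      exact_mod_cast this
    exact h2.trans (Finset.single_le_sum (f := fun i => (m.1 i : ℝ) * m.1 i)
      (fun i _ => mul_self_nonneg _) (Finset.mem_univ i))
  have h2 : K / ε ≤ Real.pi * (s ^ 2 - 1) * c := by
    have : s - 1 ≤ s ^ 2 - 1 := by nlinarith
    calc K / ε = (s - 1) * (Real.pi * c) := by rw [hsdef]; field_simp; ring
      _ ≤ (s ^ 2 - 1) * (Real.pi * c) := mul_le_mul_of_nonneg_right this hpc.le
      _ = _ := by ring
  have h3 : K / ε ≤ Real.exp (Real.pi * (s ^ 2 - 1) * c) :=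
    h2.trans ((le_add_of_nonneg_right one_pos.le).trans (Real.add_one_le_exp _))
  refine h1.trans ?_
  rw [show -Real.pi * (s ^ 2 - 1) * c = -(Real.pi * (s ^ 2 - 1) * c) by ring, Real.exp_neg,
    inv_mul_le_iff₀ (Real.exp_pos _)]
  rwa [div_le_iff₀ hε] at h3

/-- The strict inequality on r gives room to replace the infimum by an actual s with dual mass at
most ε, so whether the infimum is attained is irrelevant. -/
lemma exists_lt_of_mul_smoothing_lt {n : ℕ} {B : Matrix (Fin n) (Fin n) ℝ} (hB : B.det ≠ 0) {ε : ℝ}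
    (hε : 0 < ε) {a r : ℝ} (ha : 0 < a) (h : a * smoothing (lattice B) ε < r) :
    ∃ s : ℝ, 0 < s ∧ a * s < r ∧ dualMass B s ≤ ε := by
  have h1 : smoothing (lattice B) ε < r / a := by rw [lt_div_iff₀ ha]; linarith
  unfold smoothing at h1
  obtain ⟨s0, hs0, hs0'⟩ := exists_dualMass_le hB hε
  have hne : {s : ℝ | 0 < s ∧ ∑' y : {y : E n // y ∈ dualLattice (lattice B) ∧ y ≠ 0},
      ENNReal.ofReal (rho (1 / s) y.1) ≤ ENNReal.ofReal ε}.Nonempty :=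
    ⟨s0, hs0, by rw [tsum_rho_dual hB hs0]; exact ENNReal.ofReal_le_ofReal hs0'⟩
  obtain ⟨s, ⟨hs, hs'⟩, hsr⟩ := exists_lt_of_csInf_lt hne h1
  rw [tsum_rho_dual hB hs, ENNReal.ofReal_le_ofReal_iff hε.le] at hs'
  exact ⟨s, hs, by rw [lt_div_iff₀ ha] at hsr; linarith, hs'⟩

lemma dualMass_anti {n : ℕ} {B : Matrix (Fin n) (Fin n) ℝ} (hB : B.det ≠ 0) {s : ℝ}
    (hs : 0 < s) {A : Matrix (Fin n) (Fin n) ℝ}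
    (h : ∀ m : Fin n → ℝ, s ^ 2 * ((B⁻¹ᵀ *ᵥ m) ⬝ᵥ (B⁻¹ᵀ *ᵥ m)) ≤ (A *ᵥ m) ⬝ᵥ (A *ᵥ m)) :
    ∑' m : {m : Fin n → ℤ // m ≠ 0}, gaussMat A (fun i => (m.1 i : ℝ)) ≤ dualMass B s := by
  have hle : ∀ m : {m : Fin n → ℤ // m ≠ 0}, gaussMat A (fun i => (m.1 i : ℝ)) ≤
      gaussMat (s • B⁻¹ᵀ) (fun i => (m.1 i : ℝ)) := by
    intro m
    rw [gaussMat, gaussMat, Real.exp_le_exp, smul_mulVec, smul_dotProduct, dotProduct_smul]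
    simp only [smul_eq_mul]
    nlinarith [mul_le_mul_of_nonneg_left (h fun i => (m.1 i : ℝ)) Real.pi_pos.le]
  exact (Summable.of_nonneg_of_le (fun _ => (gaussMat_pos _ _).le) hle
    (summable_dualMass hB hs)).tsum_le_tsum hle (summable_dualMass hB hs)

end LWERed

namespace LWERed

open Matrix

/-! ### Sums of a Gaussian over a coset, with a linear form of the summation variable -/

/-- The symmetric square root of `I / r² + z zᵀ / σ²`. -/
def rootForm {n : ℕ} (r σ : ℝ) (z : Fin n → ℝ) : Matrix (Fin n) (Fin n) ℝ :=
  r⁻¹ • (1 + ((r ^ 2 / σ ^ 2) / (1 + √(1 + (z ⬝ᵥ z) * (r ^ 2 / σ ^ 2)))) • vecMulVec z z)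

lemma rootForm_transpose {n : ℕ} (r σ : ℝ) (z : Fin n → ℝ) :
    (rootForm r σ z)ᵀ = rootForm r σ z := by
  rw [rootForm, transpose_smul, transpose_add, transpose_smul, transpose_one]
  congr 3
  ext i j
  simp [vecMulVec_apply, mul_comm]

lemma dot_self_nonneg {n : ℕ} (z : Fin n → ℝ) : 0 ≤ z ⬝ᵥ z :=
  Finset.sum_nonneg fun _ _ => mul_self_nonneg _

/-- The matrix is r⁻¹(1 + c zzᵀ), whose square is the required form exactly when c(2 + c‖z‖²) =
r²/σ²; the square root in its definition solves this quadratic equation. -/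
lemma rootForm_mulVec_dot {n : ℕ} {r σ : ℝ} (hr : 0 < r) (hσ : 0 < σ) (z x : Fin n → ℝ) :
    (rootForm r σ z *ᵥ x) ⬝ᵥ (rootForm r σ z *ᵥ x) = (x ⬝ᵥ x) / r ^ 2 + (z ⬝ᵥ x) ^ 2 / σ ^ 2 := by
  set w := √(1 + (z ⬝ᵥ z) * (r ^ 2 / σ ^ 2))
  have hZ := dot_self_nonneg z
  have hw : w ^ 2 = 1 + (z ⬝ᵥ z) * (r ^ 2 / σ ^ 2) := Real.sq_sqrt (by positivity)
  have hw0 : 0 ≤ w := Real.sqrt_nonneg _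
  set c := (r ^ 2 / σ ^ 2) / (1 + w) with hc
  have hx : rootForm r σ z *ᵥ x = r⁻¹ • (x + (c * (z ⬝ᵥ x)) • z) := by
    rw [rootForm, smul_mulVec, add_mulVec, one_mulVec, smul_mulVec, vecMulVec_mulVec]
    congr 2
    ext i
    simp [w, hc]
    ring
  rw [hx, smul_dotProduct, dotProduct_smul, add_dotProduct, dotProduct_add, dotProduct_add,
    smul_dotProduct, dotProduct_smul, smul_dotProduct, dotProduct_smul, dotProduct_comm x z]
  simp only [smul_eq_mul]
  have hcw : c * (2 + c * (z ⬝ᵥ z)) = r ^ 2 / σ ^ 2 := by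
    have h1 : c * (1 + w) = r ^ 2 / σ ^ 2 := by rw [hc]; field_simp
    have h2 : c * (z ⬝ᵥ z) = w - 1 := by
      have h3 : (c * (z ⬝ᵥ z)) * (1 + w) = (w - 1) * (1 + w) := by
        rw [mul_right_comm, h1]; linear_combination -hw
      exact mul_right_cancel₀ (by positivity) h3
    rw [h2, ← h1]; ring
  have : (z ⬝ᵥ x) ^ 2 / σ ^ 2 = r⁻¹ ^ 2 * (r ^ 2 / σ ^ 2) * (z ⬝ᵥ x) ^ 2 := by field_simp
  rw [this, ← hcw]
  field_simp
  ring

lemma dot_sq_le {n : ℕ} (z x : Fin n → ℝ) : (z ⬝ᵥ x) ^ 2 ≤ (z ⬝ᵥ z) * (x ⬝ᵥ x) := by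
  simpa only [dotProduct, ← pow_two] using Finset.sum_mul_sq_le_sq_mul_sq Finset.univ z x

lemma rootForm_mulVec_dot_le {n : ℕ} {r σ : ℝ} (hr : 0 < r) (hσ : 0 < σ) (z x : Fin n → ℝ) :
    (rootForm r σ z *ᵥ x) ⬝ᵥ (rootForm r σ z *ᵥ x) ≤
      (1 / r ^ 2 + (z ⬝ᵥ z) / σ ^ 2) * (x ⬝ᵥ x) := by
  rw [rootForm_mulVec_dot hr hσ, add_mul]
  refine add_le_add (le_of_eq (by ring)) ?_
  rw [div_mul_eq_mul_div]
  exact div_le_div_of_nonneg_right (dot_sq_le z x) (by positivity)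

lemma rootForm_det_ne_zero {n : ℕ} {r σ : ℝ} (hr : 0 < r) (hσ : 0 < σ) (z : Fin n → ℝ) :
    (rootForm r σ z).det ≠ 0 := by
  intro h
  obtain ⟨x, hx, hx0⟩ := exists_mulVec_eq_zero_iff.mpr h
  have h1 := rootForm_mulVec_dot hr hσ z x
  rw [hx0, zero_dotProduct] at h1
  have h2 : 0 < (x ⬝ᵥ x) / r ^ 2 := by
    refine div_pos (lt_of_le_of_ne (dot_self_nonneg x) fun h => hx ?_) (by positivity)
    exact dotProduct_self_eq_zero.mp h.symm
  have h3 : 0 ≤ (z ⬝ᵥ x) ^ 2 / σ ^ 2 := by positivity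
  linarith

/-- The sum over the coset `B (a + q ℤⁿ)` of `ρ_r(v) exp(-π ((t - ⟨z, v⟩) / σ)²)`. -/
def cosetSum {n : ℕ} (B : Matrix (Fin n) (Fin n) ℝ) (q : ℕ) (r σ : ℝ) (z a : Fin n → ℝ) (t : ℝ) : ℝ :=
  ∑' k : Fin n → ℤ, Real.exp (-Real.pi *
    ((B *ᵥ (a + fun i => (q : ℝ) * k i)) ⬝ᵥ (B *ᵥ (a + fun i => (q : ℝ) * k i)) / r ^ 2 +
      (t - z ⬝ᵥ (B *ᵥ (a + fun i => (q : ℝ) * k i))) ^ 2 / σ ^ 2))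

/-- Completing the square in v: with b = σ² + r²‖z‖², the exponent is t²/b plus the quadratic form
at v - (t r²/b) z. The residue a and the value t therefore enter the lattice sum only through its
shift. -/
lemma coset_term_eq {n : ℕ} {B : Matrix (Fin n) (Fin n) ℝ} (hB : B.det ≠ 0) {q : ℕ} (hq : 0 < q)
    {r σ : ℝ} (hr : 0 < r) (hσ : 0 < σ) (z a : Fin n → ℝ) (t : ℝ) (k : Fin n → ℤ) :
    Real.exp (-Real.pi *
    ((B *ᵥ (a + fun i => (q : ℝ) * k i)) ⬝ᵥ (B *ᵥ (a + fun i => (q : ℝ) * k i)) / r ^ 2 +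
      (t - z ⬝ᵥ (B *ᵥ (a + fun i => (q : ℝ) * k i))) ^ 2 / σ ^ 2)) =
    Real.exp (-Real.pi * (t ^ 2 / (σ ^ 2 + r ^ 2 * (z ⬝ᵥ z)))) *
      gaussMat ((q : ℝ) • (rootForm r σ z * B))
        ((q : ℝ)⁻¹ • (a - (t * r ^ 2 / (σ ^ 2 + r ^ 2 * (z ⬝ᵥ z))) • (B⁻¹ *ᵥ z)) +
          fun i => (k i : ℝ)) := by
  have hq' : (q : ℝ) ≠ 0 := by exact_mod_cast hq.ne'
  have hZ := dot_self_nonneg z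
  set b := σ ^ 2 + r ^ 2 * (z ⬝ᵥ z) with hb
  have hb0 : 0 < b := by positivity
  set c := t * r ^ 2 / b with hc
  set v := B *ᵥ (a + fun i => (q : ℝ) * k i) with hv
  have h1 : ((q : ℝ) • (rootForm r σ z * B)) *ᵥ ((q : ℝ)⁻¹ • (a - c • (B⁻¹ *ᵥ z)) +
      fun i => (k i : ℝ)) = rootForm r σ z *ᵥ (v - c • z) := by
    rw [smul_mulVec, ← mulVec_smul, smul_add, smul_smul, mul_inv_cancel₀ hq', one_smul,
      ← mulVec_mulVec]
    congr 1
    have : a - c • B⁻¹ *ᵥ z + (q : ℝ) • (fun i => (k i : ℝ)) =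
      (a + fun i => (q : ℝ) * k i) - c • (B⁻¹ *ᵥ z) := by
      ext i; simp; ring
    rw [this, mulVec_sub, mulVec_smul, mulVec_inv_mulVec hB]
  rw [gaussMat, h1, rootForm_mulVec_dot hr hσ, ← Real.exp_add, ← mul_add]
  congr 2
  rw [sub_dotProduct, dotProduct_sub, dotProduct_sub, dotProduct_sub, smul_dotProduct,
    smul_dotProduct, dotProduct_smul, dotProduct_smul, dotProduct_comm v z]
  simp only [smul_eq_mul]
  rw [hc]
  have hzz : z ⬝ᵥ z = (b - σ ^ 2) / r ^ 2 := by rw [hb]; field_simp; ring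
  rw [hzz]
  field_simp
  ring

/-- The normalization D is the determinant of the form's square root on qL. It is the same for all a
and t, which makes the residue and the blurred inner product almost independent. -/
lemma abs_mul_cosetSum_sub_one_le {n : ℕ} {B : Matrix (Fin n) (Fin n) ℝ} (hB : B.det ≠ 0) {q : ℕ}
    (hq : 0 < q) {r σ s : ℝ} (hr : 0 < r) (hσ : 0 < σ) (hs : 0 < s) (z : Fin n → ℝ)
    (hqs : (q * s) ^ 2 * (1 / r ^ 2 + (z ⬝ᵥ z) / σ ^ 2) ≤ 1) :
    ∃ D : ℝ, 0 < D ∧ ∀ a t, Summable (fun k : Fin n → ℤ => Real.exp (-Real.pi *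
      ((B *ᵥ (a + fun i => (q : ℝ) * k i)) ⬝ᵥ (B *ᵥ (a + fun i => (q : ℝ) * k i)) / r ^ 2 +
      (t - z ⬝ᵥ (B *ᵥ (a + fun i => (q : ℝ) * k i))) ^ 2 / σ ^ 2))) ∧
      |D * cosetSum B q r σ z a t - Real.exp (-Real.pi * (t ^ 2 / (σ ^ 2 + r ^ 2 * (z ⬝ᵥ z))))| ≤
        dualMass B s * Real.exp (-Real.pi * (t ^ 2 / (σ ^ 2 + r ^ 2 * (z ⬝ᵥ z)))) := by
  have hq' : (q : ℝ) ≠ 0 := by exact_mod_cast hq.ne'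
  set M := rootForm r σ z with hM
  set A := (q : ℝ) • (M * B) with hAdef
  have hA : A.det ≠ 0 := det_smul_ne_zero (by
    rw [det_mul]; exact mul_ne_zero (rootForm_det_ne_zero hr hσ z) hB) hq'
  refine ⟨|A.det|, abs_pos.mpr hA, fun a t => ?_⟩
  set θ := (q : ℝ)⁻¹ • (a - (t * r ^ 2 / (σ ^ 2 + r ^ 2 * (z ⬝ᵥ z))) • (B⁻¹ *ᵥ z))
  set e := Real.exp (-Real.pi * (t ^ 2 / (σ ^ 2 + r ^ 2 * (z ⬝ᵥ z)))) with he
  have hterm := fun k => coset_term_eq hB hq hr hσ z a t k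
  refine ⟨(Summable.congr ((summable_gaussMat hA θ).mul_left e) fun k => (hterm k).symm), ?_⟩
  have hsum : cosetSum B q r σ z a t = e * ∑' k : Fin n → ℤ, gaussMat A (θ + fun i => (k i : ℝ)) := by
    rw [cosetSum, ← tsum_mul_left]
    exact tsum_congr hterm
  have h1 := abs_det_mul_tsum_gaussMat_sub_one_le hA θ
  have h2 : ∑' m : {m : Fin n → ℤ // m ≠ 0}, gaussMat A⁻¹ᵀ (fun i => (m.1 i : ℝ)) ≤ dualMass B s := by
    refine dualMass_anti hB hs fun m => ?_
    set y := A⁻¹ᵀ *ᵥ m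
    -- As A = q M B with M symmetric, the dual vectors of A are those of B transformed by (q M)⁻¹.
    -- The hypothesis on q s says that q M contracts by at least 1/s, so they are at least s times
    -- as long.
    have hm : B⁻¹ᵀ *ᵥ m = (q : ℝ) • (M *ᵥ y) := by
      have h3 : m = Aᵀ *ᵥ y := by
        simp only [y]
        rw [transpose_nonsing_inv, mulVec_inv_mulVec (by rwa [det_transpose])]
      rw [h3, hAdef, transpose_smul, transpose_mul, hM, rootForm_transpose, smul_mulVec,
        mulVec_smul, ← mulVec_mulVec, transpose_nonsing_inv, inv_mulVec_mulVec (by rwa [det_transpose])]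
    rw [hm, smul_dotProduct, dotProduct_smul]
    simp only [smul_eq_mul]
    set u := M *ᵥ y with hu
    set l := 1 / r ^ 2 + (z ⬝ᵥ z) / σ ^ 2
    have hl : 0 ≤ l := by have := dot_self_nonneg z; positivity
    have h4 : u ⬝ᵥ u = y ⬝ᵥ (M *ᵥ u) := by
      rw [dotProduct_mulVec, ← mulVec_transpose, hM, rootForm_transpose, hu, dotProduct_comm]
    have h5 : (u ⬝ᵥ u) ^ 2 ≤ (y ⬝ᵥ y) * (l * (u ⬝ᵥ u)) := by
      calc (u ⬝ᵥ u) ^ 2 = (y ⬝ᵥ (M *ᵥ u)) ^ 2 := by rw [h4]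
        _ ≤ (y ⬝ᵥ y) * ((M *ᵥ u) ⬝ᵥ (M *ᵥ u)) := dot_sq_le _ _
        _ ≤ _ := mul_le_mul_of_nonneg_left (rootForm_mulVec_dot_le hr hσ z u) (dot_self_nonneg y)
    have h6 : u ⬝ᵥ u ≤ l * (y ⬝ᵥ y) := by
      rcases (dot_self_nonneg u).eq_or_lt with h | h
      · rw [← h]; exact mul_nonneg hl (dot_self_nonneg y)
      · refine le_of_mul_le_mul_right ?_ h
        linarith [h5]
    calc s ^ 2 * (q * (q * (u ⬝ᵥ u))) = (q * s) ^ 2 * (u ⬝ᵥ u) := by ring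
      _ ≤ (q * s) ^ 2 * (l * (y ⬝ᵥ y)) := mul_le_mul_of_nonneg_left h6 (sq_nonneg _)
      _ = ((q * s) ^ 2 * l) * (y ⬝ᵥ y) := by ring
      _ ≤ 1 * (y ⬝ᵥ y) := mul_le_mul_of_nonneg_right hqs (dot_self_nonneg y)
      _ = _ := one_mul _
  rw [hsum, show |A.det| * (e * ∑' k : Fin n → ℤ, gaussMat A (θ + fun i => (k i : ℝ))) - e =
    e * (|A.det| * (∑' k : Fin n → ℤ, gaussMat A (θ + fun i => (k i : ℝ))) - 1) by ring, abs_mul,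
    abs_of_pos (Real.exp_pos _), mul_comm]
  exact mul_le_mul_of_nonneg_right (h1.trans h2) (Real.exp_pos _).le

end LWERed

namespace LWERed

open Matrix

/-! ### The discrete Gaussian and the one-dimensional normal distribution -/

/-- The coefficients of a lattice vector modulo `q`. -/
def coordMod {n : ℕ} (B : Matrix (Fin n) (Fin n) ℝ) (q : ℕ) (v : E n) : Fin n → ZMod q :=
  fun j => ((⌊(B⁻¹ *ᵥ v.ofLp) j⌋ : ℤ) : ZMod q)

lemma coordMod_latVec {n : ℕ} {B : Matrix (Fin n) (Fin n) ℝ} (hB : B.det ≠ 0) (q : ℕ)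
    (k : Fin n → ℤ) : coordMod B q (latVec B k) = fun j => (k j : ZMod q) := by
  funext j
  simp [coordMod, latVec, inv_mulVec_mulVec hB]

lemma measurable_mulVec_ofLp {n : ℕ} (B : Matrix (Fin n) (Fin n) ℝ) (j : Fin n) :
    Measurable fun v : E n => (B *ᵥ v.ofLp) j := by
  simp only [mulVec, dotProduct]
  fun_prop

lemma measurable_coordMod {n : ℕ} (B : Matrix (Fin n) (Fin n) ℝ) (q : ℕ) :
    Measurable (coordMod B q) := by
  refine measurable_pi_lambda _ fun j => ?_
  exact (measurable_from_top (f := fun z : ℤ => (z : ZMod q))).comp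
    (Int.measurable_floor.comp (measurable_mulVec_ofLp _ j))

lemma tsum_rho_ne_zero {n : ℕ} (L : Submodule ℤ (E n)) (r : ℝ) :
    ∑' x : L, ENNReal.ofReal (rho r x.1) ≠ 0 := by
  intro h
  have := ENNReal.tsum_eq_zero.mp h 0
  rw [ENNReal.ofReal_eq_zero] at this
  exact absurd (Real.exp_pos _) (not_lt.mpr this)

lemma tsum_rho_ne_top {n : ℕ} {B : Matrix (Fin n) (Fin n) ℝ} (hB : B.det ≠ 0) {r : ℝ} (hr : 0 < r) :
    ∑' x : lattice B, ENNReal.ofReal (rho r x.1) ≠ ⊤ := by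
  rw [← (latticeEquiv hB).tsum_eq]
  change ∑' k, ENNReal.ofReal (rho r (latVec B k)) ≠ ⊤
  simp_rw [rho_latVec]
  exact (summable_gaussMat_int (det_smul_ne_zero hB (inv_pos.mpr hr).ne')).tsum_ofReal_ne_top

lemma lintegral_discreteGaussian {n : ℕ} {B : Matrix (Fin n) (Fin n) ℝ} (hB : B.det ≠ 0) (r : ℝ)
    (f : E n → ENNReal) : ∫⁻ v, f v ∂discreteGaussian (lattice B) r =
      (∑' x : lattice B, ENNReal.ofReal (rho r x.1))⁻¹ *
        ∑' k, ENNReal.ofReal (rho r (latVec B k)) * f (latVec B k) := by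
  rw [discreteGaussian, lintegral_smul_measure, lintegral_sum_measure, smul_eq_mul]
  congr 1
  rw [← (latticeEquiv hB).tsum_eq]
  refine tsum_congr fun k => ?_
  rw [lintegral_smul_measure, lintegral_dirac]
  rfl

lemma isProbabilityMeasure_discreteGaussian {n : ℕ} {B : Matrix (Fin n) (Fin n) ℝ}
    (hB : B.det ≠ 0) {r : ℝ} (hr : 0 < r) :
    IsProbabilityMeasure (discreteGaussian (lattice B) r) := by
  constructor
  rw [← lintegral_one, lintegral_discreteGaussian hB]
  simp only [mul_one]
  rw [← (latticeEquiv hB).tsum_eq]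
  have h := tsum_rho_ne_top hB hr
  have h0 := tsum_rho_ne_zero (lattice B) r
  rw [← (latticeEquiv hB).tsum_eq] at h h0
  exact ENNReal.inv_mul_cancel h0 h

lemma ae_mem_discreteGaussian {n : ℕ} (L : Submodule ℤ (E n)) [Countable L] (r : ℝ) :
    ∀ᵐ v ∂discreteGaussian L r, v ∈ L := by
  rw [discreteGaussian]
  refine Measure.ae_smul_measure ?_ _
  rw [Measure.ae_sum_iff]
  intro x
  refine Measure.ae_smul_measure ?_ _
  rw [ae_dirac_eq]
  exact x.2

lemma nu_map_affine (σ h : ℝ) :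
    (nu 1).map (fun g => h + σ * g) = gaussianReal h (Real.toNNReal (σ ^ 2 / (2 * Real.pi))) := by
  have : (fun g : ℝ => h + σ * g) = (fun t => h + t) ∘ fun g => σ * g := rfl
  rw [this, ← Measure.map_map (by fun_prop) (by fun_prop), nu, gaussianReal_map_const_mul,
    gaussianReal_map_const_add]
  congr 1
  · simp
  · ext
    have := Real.pi_pos
    rw [NNReal.coe_mul, Real.coe_toNNReal _ (by positivity), Real.coe_toNNReal _ (by positivity)]
    simp only [NNReal.coe_mk]
    ring

lemma nu_map_mul (σ : ℝ) : (nu 1).map (fun g => σ * g) = nu σ := by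
  simpa [nu] using nu_map_affine σ 0

lemma gaussianReal_apply_eq {σ : ℝ} (hσ : 0 < σ) (h : ℝ) (S : Set ℝ) :
    gaussianReal h (Real.toNNReal (σ ^ 2 / (2 * Real.pi))) S =
      ∫⁻ t in S, ENNReal.ofReal (σ⁻¹ * Real.exp (-Real.pi * ((t - h) ^ 2 / σ ^ 2))) := by
  have hp := Real.pi_pos
  have hv : 0 ≤ σ ^ 2 / (2 * Real.pi) := by positivity
  have hv0 : Real.toNNReal (σ ^ 2 / (2 * Real.pi)) ≠ 0 := by
    rw [Ne, Real.toNNReal_eq_zero, not_le]; positivity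
  rw [gaussianReal_apply _ hv0]
  refine lintegral_congr fun t => ?_
  rw [gaussianPDF, gaussianPDFReal, Real.coe_toNNReal _ hv]
  congr 2
  · rw [show 2 * Real.pi * (σ ^ 2 / (2 * Real.pi)) = σ ^ 2 by field_simp, Real.sqrt_sq hσ.le]
  · congr 1; field_simp

lemma nu_apply {β : ℝ} (hβ : 0 < β) (S : Set ℝ) :
    nu β S = ∫⁻ t in S, ENNReal.ofReal (β⁻¹ * Real.exp (-Real.pi * (t ^ 2 / β ^ 2))) := by
  rw [nu, gaussianReal_apply_eq hβ]
  simp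

instance (β : ℝ) : IsProbabilityMeasure (nu β) := by unfold nu; infer_instance

/-- The densities satisfy this pointwise because the narrower exponential is the smaller one; only
the normalizing factors cost α/β. It allows the oracle to be fed noise that is slightly too small.
-/
lemma nu_le_smul_nu {β α : ℝ} (hβ : 0 < β) (h : β ≤ α) :
    nu β ≤ ENNReal.ofReal (α / β) • nu α := by
  have hα : 0 < α := hβ.trans_le h
  refine Measure.le_iff.mpr fun S hS => ?_
  rw [Measure.smul_apply, nu_apply hβ, nu_apply hα, smul_eq_mul,
    ← lintegral_const_mul' _ _ ENNReal.ofReal_ne_top]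
  refine lintegral_mono fun t => ?_
  rw [← ENNReal.ofReal_mul (by positivity)]
  refine ENNReal.ofReal_le_ofReal ?_
  rw [← mul_assoc, show α / β * α⁻¹ = β⁻¹ by field_simp]
  refine mul_le_mul_of_nonneg_left (Real.exp_le_exp.mpr ?_) (inv_nonneg.mpr hβ.le)
  have : t ^ 2 / α ^ 2 ≤ t ^ 2 / β ^ 2 := by gcongr
  nlinarith [Real.pi_pos]

/-! ### Residues -/

/-- Integer vectors as residues modulo `q` plus `q` times integer vectors. -/
def residueEquiv (n q : ℕ) [NeZero q] : (Fin n → ZMod q) × (Fin n → ℤ) ≃ (Fin n → ℤ) where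
  toFun b := fun i => (b.1 i).val + q * b.2 i
  invFun k := (fun i => (k i : ZMod q), fun i => k i / q)
  left_inv := by
    rintro ⟨b, k⟩
    have h1 : ∀ i, ((b i).val : ℤ) < q := fun i => by exact_mod_cast ZMod.val_lt (b i)
    have h2 : (q : ℤ) ≠ 0 := by exact_mod_cast NeZero.ne q
    refine Prod.ext (funext fun i => ?_) (funext fun i => ?_)
    · simp
    · simp only
      rw [Int.add_mul_ediv_left _ _ h2, Int.ediv_eq_zero_of_lt (by positivity) (h1 i), zero_add]
  right_inv := by
    intro k
    funext i
    simp only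
    rw [ZMod.val_intCast]
    exact Int.emod_add_mul_ediv _ _

lemma uniformOn_prod_apply {n q : ℕ} [NeZero q] (ν : Measure ℝ) [IsProbabilityMeasure ν]
    {S : Set ((Fin n → ZMod q) × ℝ)} (hS : MeasurableSet S) :
    ((uniformOn (Set.univ : Set (Fin n → ZMod q))).prod ν) S =
      ((q : ENNReal) ^ n)⁻¹ * ∑ b, ν (Prod.mk b ⁻¹' S) := by
  have h : uniformOn (Set.univ : Set (Fin n → ZMod q)) = ((q : ENNReal) ^ n)⁻¹ • Measure.count := by
    refine Measure.ext fun s hs => ?_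
    rw [uniformOn, cond_apply MeasurableSet.univ, Set.univ_inter, Measure.smul_apply, smul_eq_mul,
      Measure.count_univ]
    simp [ZMod.card]
  rw [Measure.prod_apply hS, h, lintegral_smul_measure, lintegral_count, tsum_fintype, smul_eq_mul]

/-- Comparison of two probability measures that are proportional up to factors `1 ± ε`. -/
lemma measure_le_of_proportional {X : Type*} [MeasurableSpace X] {μ ν : Measure X}
    [IsProbabilityMeasure μ] [IsProbabilityMeasure ν] {κ : ENNReal} {ε : ℝ} (hε1 : ε < 1)
    (h1 : ∀ S, MeasurableSet S → μ S ≤ κ * ENNReal.ofReal (1 + ε) * ν S)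
    (h2 : ∀ S, MeasurableSet S → κ * ENNReal.ofReal (1 - ε) * ν S ≤ μ S) :
    μ ≤ ENNReal.ofReal ((1 + ε) / (1 - ε)) • ν ∧ ν ≤ ENNReal.ofReal ((1 + ε) / (1 - ε)) • μ := by
  -- On the whole space the hypotheses give κ(1 - ε) ≤ 1 ≤ κ(1 + ε), which eliminates the unknown
  -- constant κ.
  have hu1 := h1 _ MeasurableSet.univ
  have hu2 := h2 _ MeasurableSet.univ
  simp only [measure_univ, mul_one] at hu1 hu2
  have hpos : 0 < 1 - ε := by linarith
  have hp0 : ENNReal.ofReal (1 - ε) ≠ 0 := by simpa using hpos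
  have hC : ENNReal.ofReal ((1 + ε) / (1 - ε)) = ENNReal.ofReal (1 + ε) / ENNReal.ofReal (1 - ε) :=
    ENNReal.ofReal_div_of_pos hpos
  constructor <;> refine Measure.le_iff.mpr fun S hS => ?_ <;>
    rw [Measure.smul_apply, smul_eq_mul, hC]
  · refine (h1 S hS).trans ?_
    gcongr
    rw [mul_comm, ENNReal.div_eq_inv_mul, mul_comm]
    gcongr
    rw [ENNReal.le_inv_iff_mul_le]
    exact hu2
  · calc ν S = 1 * ν S := (one_mul _).symm
      _ ≤ κ * ENNReal.ofReal (1 + ε) * ν S := by gcongr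
      _ = ENNReal.ofReal (1 + ε) / ENNReal.ofReal (1 - ε) * (κ * ENNReal.ofReal (1 - ε) * ν S) := by
        rw [ENNReal.div_eq_inv_mul]
        calc _ = ((ENNReal.ofReal (1 - ε))⁻¹ * ENNReal.ofReal (1 - ε)) *
              (κ * ENNReal.ofReal (1 + ε) * ν S) := by
              rw [ENNReal.inv_mul_cancel hp0 ENNReal.ofReal_ne_top, one_mul]
          _ = _ := by ring
      _ ≤ _ := by gcongr; exact h2 S hS

lemma latVec_residueEquiv {n : ℕ} (B : Matrix (Fin n) (Fin n) ℝ) (q : ℕ) [NeZero q]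
    (b : Fin n → ZMod q) (k : Fin n → ℤ) :
    (latVec B (residueEquiv n q (b, k))).ofLp =
      B *ᵥ ((fun i => ((b i).val : ℝ)) + fun i => (q : ℝ) * k i) := by
  simp only [latVec, residueEquiv, Equiv.coe_fn_mk]
  congr 1
  funext i
  simp

lemma coordMod_residueEquiv {n : ℕ} {B : Matrix (Fin n) (Fin n) ℝ} (hB : B.det ≠ 0) (q : ℕ)
    [NeZero q] (b : Fin n → ZMod q) (k : Fin n → ℤ) :
    coordMod B q (latVec B (residueEquiv n q (b, k))) = b := by
  rw [coordMod_latVec hB]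
  funext j
  simp [residueEquiv]

/-- The residue of a lattice vector, and its inner product with `z` blurred by a normal variable. -/
def jointMap {n : ℕ} (B : Matrix (Fin n) (Fin n) ℝ) (q : ℕ) (z : Fin n → ℝ) (σ : ℝ)
    (a : E n × ℝ) : (Fin n → ZMod q) × ℝ := (coordMod B q a.1, z ⬝ᵥ a.1.ofLp + σ * a.2)

lemma measurable_dot_ofLp {n : ℕ} (z : Fin n → ℝ) : Measurable fun v : E n => z ⬝ᵥ v.ofLp := by
  simp only [dotProduct]
  fun_prop

lemma measurable_jointMap {n : ℕ} (B : Matrix (Fin n) (Fin n) ℝ) (q : ℕ) (z : Fin n → ℝ) (σ : ℝ) :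
    Measurable (jointMap B q z σ) := by
  refine ((measurable_coordMod B q).comp measurable_fst).prodMk ?_
  exact ((measurable_dot_ofLp z).comp measurable_fst).add (measurable_snd.const_mul σ)

/-- Given v, the blurred inner product is normal with mean ⟨z,v⟩. Splitting L into residue classes
and exchanging sum and integral collects these densities into coset sums. -/
lemma jointLaw_apply {n : ℕ} {B : Matrix (Fin n) (Fin n) ℝ} (hB : B.det ≠ 0) {q : ℕ} [NeZero q]
    {r σ : ℝ} (hσ : 0 < σ) (z : Fin n → ℝ)
    (hsum : ∀ a t, Summable (fun k : Fin n → ℤ => Real.exp (-Real.pi *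
      ((B *ᵥ (a + fun i => (q : ℝ) * k i)) ⬝ᵥ (B *ᵥ (a + fun i => (q : ℝ) * k i)) / r ^ 2 +
      (t - z ⬝ᵥ (B *ᵥ (a + fun i => (q : ℝ) * k i))) ^ 2 / σ ^ 2))))
    {S : Set ((Fin n → ZMod q) × ℝ)} (hS : MeasurableSet S) :
    (((discreteGaussian (lattice B) r).prod (nu 1)).map (jointMap B q z σ)) S =
      (∑' x : lattice B, ENNReal.ofReal (rho r x.1))⁻¹ * ∑ b, ∫⁻ t in Prod.mk b ⁻¹' S,
        ENNReal.ofReal (σ⁻¹ * cosetSum B q r σ z (fun i => ((b i).val : ℝ)) t) := by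
  have hm := measurable_jointMap B q z σ
  rw [Measure.map_apply hm hS, Measure.prod_apply (hm hS), lintegral_discreteGaussian hB]
  congr 1
  rw [← (residueEquiv n q).tsum_eq, ENNReal.tsum_prod', tsum_fintype]
  refine Finset.sum_congr rfl fun b _ => ?_
  have hSb : MeasurableSet (Prod.mk b ⁻¹' S) := measurable_prodMk_left hS
  have h1 : ∀ k, ENNReal.ofReal (rho r (latVec B (residueEquiv n q (b, k)))) *
      (nu 1) (Prod.mk (latVec B (residueEquiv n q (b, k))) ⁻¹' (jointMap B q z σ ⁻¹' S)) =
      ∫⁻ t in Prod.mk b ⁻¹' S, ENNReal.ofReal (σ⁻¹ * Real.exp (-Real.pi *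
      ((B *ᵥ ((fun i => ((b i).val : ℝ)) + fun i => (q : ℝ) * k i)) ⬝ᵥ
        (B *ᵥ ((fun i => ((b i).val : ℝ)) + fun i => (q : ℝ) * k i)) / r ^ 2 +
      (t - z ⬝ᵥ (B *ᵥ ((fun i => ((b i).val : ℝ)) + fun i => (q : ℝ) * k i))) ^ 2 / σ ^ 2))) := by
    intro k
    set v := latVec B (residueEquiv n q (b, k)) with hv
    have hv' := latVec_residueEquiv B q b k
    rw [← hv'] 
    have h2 : Prod.mk v ⁻¹' (jointMap B q z σ ⁻¹' S) =
        (fun g => z ⬝ᵥ v.ofLp + σ * g) ⁻¹' (Prod.mk b ⁻¹' S) := by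
      ext g
      simp only [Set.mem_preimage, jointMap]
      rw [hv, coordMod_residueEquiv hB]
    rw [h2, ← Measure.map_apply (by fun_prop) hSb, nu_map_affine, gaussianReal_apply_eq hσ,
      ← lintegral_const_mul' _ _ ENNReal.ofReal_ne_top]
    refine lintegral_congr fun t => ?_
    rw [rho, ← ENNReal.ofReal_mul (Real.exp_pos _).le, div_pow, norm_sq_eq_dot, mul_left_comm,
      ← Real.exp_add, ← mul_add]
  simp_rw [h1]
  rw [← lintegral_tsum fun k => by
    refine Measurable.aemeasurable ?_
    fun_prop]
  refine lintegral_congr fun t => ?_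
  rw [cosetSum, ← tsum_mul_left, ENNReal.ofReal_tsum_of_nonneg
    (fun k => mul_nonneg (inv_nonneg.mpr hσ.le) (Real.exp_pos _).le) ((hsum _ _).mul_left _)]

/-- The residue of a discrete Gaussian vector `v` and a blurred inner product `⟨z, v⟩` are, up to a
factor close to `1`, distributed as independent uniform and normal variables. -/
theorem jointLaw_le {n : ℕ} {B : Matrix (Fin n) (Fin n) ℝ} (hB : B.det ≠ 0) {q : ℕ} [NeZero q]
    {r σ s ε : ℝ} (hr : 0 < r) (hσ : 0 < σ) (hs : 0 < s) (hε1 : ε < 1) (hsε : dualMass B s ≤ ε)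
    {z : Fin n → ℝ} (hqs : (q * s) ^ 2 * (1 / r ^ 2 + (z ⬝ᵥ z) / σ ^ 2) ≤ 1) :
    ((discreteGaussian (lattice B) r).prod (nu 1)).map (jointMap B q z σ) ≤
        ENNReal.ofReal ((1 + ε) / (1 - ε)) • (uniformOn (Set.univ : Set (Fin n → ZMod q))).prod
          (nu √(σ ^ 2 + r ^ 2 * (z ⬝ᵥ z))) ∧
      (uniformOn (Set.univ : Set (Fin n → ZMod q))).prod (nu √(σ ^ 2 + r ^ 2 * (z ⬝ᵥ z))) ≤
        ENNReal.ofReal ((1 + ε) / (1 - ε)) •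
          ((discreteGaussian (lattice B) r).prod (nu 1)).map (jointMap B q z σ) := by
  have hZ := dot_self_nonneg z
  have hb : 0 < σ ^ 2 + r ^ 2 * (z ⬝ᵥ z) := by positivity
  set β := √(σ ^ 2 + r ^ 2 * (z ⬝ᵥ z)) with hβdef
  have hβ : 0 < β := Real.sqrt_pos.mpr hb
  have hβ2 : β ^ 2 = σ ^ 2 + r ^ 2 * (z ⬝ᵥ z) := Real.sq_sqrt hb.le
  obtain ⟨D, hD, hDs⟩ := abs_mul_cosetSum_sub_one_le hB (NeZero.pos q) hr hσ hs z hqs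
  have := isProbabilityMeasure_discreteGaussian hB hr
  have : IsProbabilityMeasure (((discreteGaussian (lattice B) r).prod (nu 1)).map
    (jointMap B q z σ)) := Measure.isProbabilityMeasure_map (measurable_jointMap B q z σ).aemeasurable
  have : IsProbabilityMeasure (uniformOn (Set.univ : Set (Fin n → ZMod q))) :=
    isProbabilityMeasure_uniformOn Set.finite_univ Set.univ_nonempty
  set m := (∑' x : lattice B, ENNReal.ofReal (rho r x.1))⁻¹
  have hν : ∀ S, MeasurableSet S →
      ((uniformOn (Set.univ : Set (Fin n → ZMod q))).prod (nu β)) S = ((q : ENNReal) ^ n)⁻¹ *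
      (ENNReal.ofReal β⁻¹ * ∑ b, ∫⁻ t in Prod.mk b ⁻¹' S,
        ENNReal.ofReal (Real.exp (-Real.pi * (t ^ 2 / β ^ 2)))) := by
    intro S hS
    rw [uniformOn_prod_apply _ hS]
    congr 1
    rw [Finset.mul_sum]
    refine Finset.sum_congr rfl fun b _ => ?_
    rw [nu_apply hβ, ← lintegral_const_mul' _ _ ENNReal.ofReal_ne_top]
    refine lintegral_congr fun t => ?_
    rw [ENNReal.ofReal_mul (inv_nonneg.mpr hβ.le)]
  have hqn : ((q : ENNReal) ^ n) ≠ 0 := pow_ne_zero _ (by exact_mod_cast NeZero.ne q)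
  have hqn' : ((q : ENNReal) ^ n) ≠ ⊤ := ENNReal.pow_ne_top (ENNReal.natCast_ne_top q)
  have hcancel : ∀ X : ENNReal, (q : ENNReal) ^ n * ENNReal.ofReal β *
      (((q : ENNReal) ^ n)⁻¹ * (ENNReal.ofReal β⁻¹ * X)) = X := by
    intro X
    calc _ = ((q : ENNReal) ^ n * ((q : ENNReal) ^ n)⁻¹) *
          (ENNReal.ofReal β * ENNReal.ofReal β⁻¹) * X := by ring
      _ = X := by
        rw [ENNReal.mul_inv_cancel hqn hqn', ← ENNReal.ofReal_mul hβ.le, mul_inv_cancel₀ hβ.ne']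
        simp
  have hbound : ∀ a t, (1 - ε) * Real.exp (-Real.pi * (t ^ 2 / β ^ 2)) ≤ D * cosetSum B q r σ z a t ∧
      D * cosetSum B q r σ z a t ≤ (1 + ε) * Real.exp (-Real.pi * (t ^ 2 / β ^ 2)) := by
    intro a t
    have h1 := abs_le.mp (hDs a t).2
    rw [← hβ2] at h1
    have h2 := mul_le_mul_of_nonneg_right hsε (Real.exp_pos (-Real.pi * (t ^ 2 / β ^ 2))).le
    constructor <;> linarith [h1.1, h1.2]
  have hσD : 0 < σ⁻¹ / D := by positivity
  have hε0 : 0 ≤ ε := (tsum_nonneg fun _ => (gaussMat_pos _ _).le).trans hsε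
  have hsplit : ∀ (u : ℝ) (S : Set ((Fin n → ZMod q) × ℝ)), m * ∑ b, ∫⁻ t in Prod.mk b ⁻¹' S, ENNReal.ofReal (σ⁻¹ / D) *
        ENNReal.ofReal u * ENNReal.ofReal (Real.exp (-Real.pi * (t ^ 2 / β ^ 2))) =
      m * ENNReal.ofReal (σ⁻¹ / D) * ((q : ENNReal) ^ n * ENNReal.ofReal β) * ENNReal.ofReal u *
      (((q : ENNReal) ^ n)⁻¹ * (ENNReal.ofReal β⁻¹ * ∑ b, ∫⁻ t in Prod.mk b ⁻¹' S,
        ENNReal.ofReal (Real.exp (-Real.pi * (t ^ 2 / β ^ 2))))) := by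
    intro u S
    set X := ∑ b : Fin n → ZMod q, ∫⁻ t in Prod.mk b ⁻¹' S,
        ENNReal.ofReal (Real.exp (-Real.pi * (t ^ 2 / β ^ 2))) with hX
    calc _ = m * (ENNReal.ofReal (σ⁻¹ / D) * ENNReal.ofReal u * X) := by
          congr 1
          rw [hX, Finset.mul_sum]
          refine Finset.sum_congr rfl fun b _ => ?_
          rw [lintegral_const_mul' _ _ (ENNReal.mul_ne_top ENNReal.ofReal_ne_top ENNReal.ofReal_ne_top)]
      _ = m * (ENNReal.ofReal (σ⁻¹ / D) * ENNReal.ofReal u * ((q : ENNReal) ^ n * ENNReal.ofReal β *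
          (((q : ENNReal) ^ n)⁻¹ * (ENNReal.ofReal β⁻¹ * X)))) := by rw [hcancel]
      _ = _ := by ring
  have hscale : ∀ b t, σ⁻¹ * cosetSum B q r σ z b t = σ⁻¹ / D * (D * cosetSum B q r σ z b t) := by
    intro b t
    field_simp
  -- κ gathers the normalizing constants of both laws and the determinant D; its value is never
  -- needed.
  refine measure_le_of_proportional (ε := ε)
    (κ := m * ENNReal.ofReal (σ⁻¹ / D) * ((q : ENNReal) ^ n * ENNReal.ofReal β)) hε1 ?_ ?_ <;>
    intro S hS <;> rw [hν S hS, jointLaw_apply hB hσ z (fun a t => (hDs a t).1) hS, ← hsplit] <;>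
    gcongr with b _ t <;> rw [← ENNReal.ofReal_mul hσD.le, ← ENNReal.ofReal_mul] <;>
    try positivity
  · refine ENNReal.ofReal_le_ofReal ?_
    rw [mul_assoc, hscale]
    exact mul_le_mul_of_nonneg_left (hbound _ t).2 hσD.le
  · refine ENNReal.ofReal_le_ofReal ?_
    rw [mul_assoc, hscale]
    exact mul_le_mul_of_nonneg_left (hbound _ t).1 hσD.le

end LWERed

namespace LWERed

/-! ### A semantics without time and without stale registers -/

/-- The memory of real arrays and the counters of random samples and oracle calls. -/
structure Core where
  arr : ℕ → ℕ → ℕ → ℝ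
  coins : ℕ
  calls : ℕ

/-- Forget the registers and the time. -/
def State.core (σ : State) : Core := ⟨σ.arr, σ.coins, σ.calls⟩

/-- Evaluation in a register environment. -/
def NExp.ev (env : ℕ → ℕ) : NExp → ℕ
  | .lit k => k
  | .var x => env x
  | .add a b => a.ev env + b.ev env
  | .sub a b => a.ev env - b.ev env
  | .mul a b => a.ev env * b.ev env

/-- Evaluation in a register environment and a memory. -/
def RExp.ev (env : ℕ → ℕ) (M : ℕ → ℕ → ℕ → ℝ) : RExp → ℝ
  | .lit q => (q : ℝ)
  | .ofNat e => (e.ev env : ℝ)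
  | .get a i j => M a (i.ev env) (j.ev env)
  | .add a b => a.ev env M + b.ev env M
  | .sub a b => a.ev env M - b.ev env M
  | .mul a b => a.ev env M * b.ev env M
  | .div a b => a.ev env M / b.ev env M
  | .sqrt a => Real.sqrt (a.ev env M)
  | .floor a => (⌊a.ev env M⌋ : ℝ)

open Classical in
/-- Overwrite the entries of array `a` in the region `D` with the values of `f`. -/
def Core.fill (s : Core) (a : ℕ) (D : ℕ → ℕ → Prop) (f : ℕ → ℕ → ℝ) : Core :=
  { s with arr := fun a' i j => if a' = a ∧ D i j then f i j else s.arr a' i j }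

/-- The effect of an oracle call. -/
def Core.oracleCall {p N : ℕ → ℕ} {Ω : Type*} [MeasurableSpace Ω] (s : Core) (W : Oracle p N Ω)
    (n : ℕ) (w : Ω) (a o : ℕ) : Core :=
  { s with
    arr := fun a' i' j' =>
      if h : a' = o ∧ i' = 0 ∧ j' < n then
        ((W.out n (fun i => decode n (p n) (s.arr a i)) w ⟨j', h.2.2⟩).val : ℝ)
      else s.arr a' i' j'
    calls := s.calls + 1 }

section den

variable {p N : ℕ → ℕ} {Ω : Type*} [MeasurableSpace Ω]

/-- The effect of a program on the memory, in a register environment. -/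
def Prog.den (W : Oracle p N Ω) (n : ℕ) (g : ℕ → ℝ) (w : ℕ → Ω) : Prog → (ℕ → ℕ) → Core → Core
  | .skip, _, s => s
  | .setN _ _, _, s => s
  | .setR a i j e, env, s =>
      s.fill a (fun i' j' => i' = i.ev env ∧ j' = j.ev env) fun _ _ => e.ev env s.arr
  | .gauss a i j, env, s =>
      { s.fill a (fun i' j' => i' = i.ev env ∧ j' = j.ev env) (fun _ _ => g s.coins) with
        coins := s.coins + 1 }
  | .call a o, _, s => s.oracleCall W n (w s.calls) a o
  | .seq c d, env, s => d.den W n g w env (c.den W n g w env s)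
  | .ifLe e f c d, env, s =>
      if e.ev env s.arr ≤ f.ev env s.arr then c.den W n g w env s else d.den W n g w env s
  | .loop x e c, env, s =>
      (List.range (e.ev env)).foldl (fun τ i => c.den W n g w (Function.update env x i) τ) s

/-- All registers of the expression are in `X`. -/
def NExp.In (X : Finset ℕ) : NExp → Prop
  | .lit _ => True
  | .var x => x ∈ X
  | .add a b => a.In X ∧ b.In X
  | .sub a b => a.In X ∧ b.In X
  | .mul a b => a.In X ∧ b.In X

/-- All registers of the expression are in `X`. -/
def RExp.In (X : Finset ℕ) : RExp → Prop
  | .lit _ => True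
  | .ofNat e => e.In X
  | .get _ i j => i.In X ∧ j.In X
  | .add a b => a.In X ∧ b.In X
  | .sub a b => a.In X ∧ b.In X
  | .mul a b => a.In X ∧ b.In X
  | .div a b => a.In X ∧ b.In X
  | .sqrt a => a.In X
  | .floor a => a.In X

/-- The program reads only registers in `X` and counters of enclosing loops, and changes no register
except by loops, with counters not in `X`. -/
def Prog.Scoped : Finset ℕ → Prog → Prop
  | _, .skip => True
  | _, .setN _ _ => False
  | X, .setR _ i j e => i.In X ∧ j.In X ∧ e.In X
  | X, .gauss _ i j => i.In X ∧ j.In X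
  | _, .call _ _ => True
  | X, .seq c d => c.Scoped X ∧ d.Scoped X
  | X, .ifLe e f c d => e.In X ∧ f.In X ∧ c.Scoped X ∧ d.Scoped X
  | X, .loop x e c => e.In X ∧ x ∉ X ∧ c.Scoped (insert x X)

lemma NExp.eval_eq_ev {X : Finset ℕ} {σ : State} {env : ℕ → ℕ} (h : ∀ x ∈ X, σ.nat x = env x) :
    ∀ e : NExp, e.In X → e.eval σ = e.ev env
  | .lit _, _ => rfl
  | .var x, hx => h x hx
  | .add a b, hx => by simp only [NExp.eval, NExp.ev, eval_eq_ev h a hx.1, eval_eq_ev h b hx.2]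
  | .sub a b, hx => by simp only [NExp.eval, NExp.ev, eval_eq_ev h a hx.1, eval_eq_ev h b hx.2]
  | .mul a b, hx => by simp only [NExp.eval, NExp.ev, eval_eq_ev h a hx.1, eval_eq_ev h b hx.2]

lemma RExp.eval_eq_ev {X : Finset ℕ} {σ : State} {env : ℕ → ℕ} (h : ∀ x ∈ X, σ.nat x = env x) :
    ∀ e : RExp, e.In X → e.eval σ = e.ev env σ.arr
  | .lit _, _ => rfl
  | .ofNat e, hx => by simp only [RExp.eval, RExp.ev, e.eval_eq_ev h hx]
  | .get a i j, hx => by simp only [RExp.eval, RExp.ev, i.eval_eq_ev h hx.1, j.eval_eq_ev h hx.2]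
  | .add a b, hx => by simp only [RExp.eval, RExp.ev, eval_eq_ev h a hx.1, eval_eq_ev h b hx.2]
  | .sub a b, hx => by simp only [RExp.eval, RExp.ev, eval_eq_ev h a hx.1, eval_eq_ev h b hx.2]
  | .mul a b, hx => by simp only [RExp.eval, RExp.ev, eval_eq_ev h a hx.1, eval_eq_ev h b hx.2]
  | .div a b, hx => by simp only [RExp.eval, RExp.ev, eval_eq_ev h a hx.1, eval_eq_ev h b hx.2]
  | .sqrt a, hx => by simp only [RExp.eval, RExp.ev, eval_eq_ev h a hx]
  | .floor a, hx => by simp only [RExp.eval, RExp.ev, eval_eq_ev h a hx]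

lemma writeR_core (σ : State) (a i j : ℕ) (v : ℝ) :
    (σ.writeR a i j v).core = σ.core.fill a (fun i' j' => i' = i ∧ j' = j) fun _ _ => v := by
  simp only [State.core, State.writeR, Core.fill]
  congr
  funext a' i' j'
  by_cases h : a' = a ∧ i' = i ∧ j' = j <;> simp [h]

/-- Loop counters lie outside X, so code after a loop never reads the value left in its counter, and
passing an environment downwards agrees with overwriting registers. The instruction `setN`, which
`Prog.den` ignores, is excluded by `Prog.Scoped`. -/
theorem Prog.exec_core_eq_den (W : Oracle p N Ω) (n : ℕ) (g : ℕ → ℝ) (w : ℕ → Ω) :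
    ∀ (c : Prog) (X : Finset ℕ), c.Scoped X → ∀ (σ : State) (env : ℕ → ℕ),
      (∀ x ∈ X, σ.nat x = env x) → (∀ x ∈ X, (c.exec W n g w σ).nat x = env x) ∧
        (c.exec W n g w σ).core = c.den W n g w env σ.core
  | .skip, X, _, σ, env, h => ⟨h, rfl⟩
  | .setR a i j e, X, hc, σ, env, h => by
      refine ⟨h, ?_⟩
      simp only [Prog.exec, Prog.den, i.eval_eq_ev h hc.1, j.eval_eq_ev h hc.2.1,
        e.eval_eq_ev h hc.2.2]
      exact writeR_core _ _ _ _ _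
  | .gauss a i j, X, hc, σ, env, h => by
      refine ⟨h, ?_⟩
      simp only [Prog.exec, Prog.den, i.eval_eq_ev h hc.1, j.eval_eq_ev h hc.2]
      exact congrArg (fun s : Core => (⟨s.arr, σ.coins + 1, σ.calls⟩ : Core))
        (writeR_core σ a (i.ev env) (j.ev env) (g σ.coins))
  | .call a o, X, _, σ, env, h => ⟨h, rfl⟩
  | .seq c d, X, hc, σ, env, h => by
      obtain ⟨h1, h2⟩ := exec_core_eq_den W n g w c X hc.1 σ env h
      obtain ⟨h3, h4⟩ := exec_core_eq_den W n g w d X hc.2 _ env h1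
      exact ⟨h3, by rw [Prog.exec, h4, h2, Prog.den]⟩
  | .ifLe e f c d, X, hc, σ, env, h => by
      simp only [Prog.exec, Prog.den, e.eval_eq_ev h hc.1, f.eval_eq_ev h hc.2.1]
      change (∀ x ∈ X, (if e.ev env σ.core.arr ≤ f.ev env σ.core.arr then _ else _ : State).nat x = _) ∧
        (if e.ev env σ.core.arr ≤ f.ev env σ.core.arr then _ else _ : State).core = _
      split_ifs
      · exact exec_core_eq_den W n g w c X hc.2.2.1 (σ.tick _) env h
      · exact exec_core_eq_den W n g w d X hc.2.2.2 (σ.tick _) env h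
  | .loop x e c, X, hc, σ, env, h => by
      simp only [Prog.exec, Prog.den, e.eval_eq_ev h hc.1]
      have key : ∀ (l : List ℕ) (τ : State), (∀ y ∈ X, τ.nat y = env y) →
          (∀ y ∈ X, (l.foldl (fun τ i => c.exec W n g w ((τ.writeN x i).tick 1)) τ).nat y = env y) ∧
          (l.foldl (fun τ i => c.exec W n g w ((τ.writeN x i).tick 1)) τ).core =
            l.foldl (fun s i => c.den W n g w (Function.update env x i) s) τ.core := by
        intro l
        induction l with
        | nil => exact fun τ hτ => ⟨hτ, rfl⟩
        | cons i l ih =>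
          intro τ hτ
          have h1 : ∀ y ∈ insert x X, ((τ.writeN x i).tick 1).nat y = Function.update env x i y := by
            intro y hy
            rcases Finset.mem_insert.mp hy with rfl | hy
            · simp [State.writeN, State.tick]
            · have : y ≠ x := fun hyx => hc.2.1 (hyx ▸ hy)
              simp [State.writeN, State.tick, Function.update_of_ne this, hτ y hy]
          obtain ⟨h2, h3⟩ := exec_core_eq_den W n g w c _ hc.2.2 _ _ h1
          have h4 : ∀ y ∈ X, (c.exec W n g w ((τ.writeN x i).tick 1)).nat y = env y := by
            intro y hy
            rw [h2 y (Finset.mem_insert_of_mem hy), Function.update_of_ne fun hyx : y = x => hc.2.1 (hyx ▸ hy)]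
          have h5 := ih _ h4
          rw [h3] at h5
          exact h5
      exact key _ (σ.tick _) h

/-! ### Frames -/

/-- The arrays that a program may change. -/
def Prog.writes : Prog → Finset ℕ
  | .skip => ∅
  | .setN _ _ => ∅
  | .setR a _ _ _ => {a}
  | .gauss a _ _ => {a}
  | .call _ o => {o}
  | .seq c d => c.writes ∪ d.writes
  | .ifLe _ _ c d => c.writes ∪ d.writes
  | .loop _ _ c => c.writes

/-- The program is deterministic: it uses neither random samples nor the oracle. -/
def Prog.Pure : Prog → Prop
  | .gauss _ _ _ => False
  | .call _ _ => False
  | .seq c d => c.Pure ∧ d.Pure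
  | .ifLe _ _ c d => c.Pure ∧ d.Pure
  | .loop _ _ c => c.Pure
  | _ => True

variable (W : Oracle p N Ω) (n : ℕ) (g : ℕ → ℝ) (w : ℕ → Ω)

lemma foldl_range_induct {α : Type*} (f : α → ℕ → α) (Inv : ℕ → α → Prop) {s : α} (h0 : Inv 0 s)
    (m : ℕ) (hs : ∀ k < m, ∀ s', Inv k s' → Inv (k + 1) (f s' k)) :
    Inv m ((List.range m).foldl f s) := by
  induction m with
  | zero => exact h0
  | succ m ih =>
    rw [List.range_succ, List.foldl_append]
    exact hs m (Nat.lt_succ_self m) _ (ih fun k hk => hs k (hk.trans (Nat.lt_succ_self m)))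

lemma Prog.den_loop_induct {x : ℕ} {e : NExp} {c : Prog} {env : ℕ → ℕ} {m : ℕ} (he : e.ev env = m)
    (Inv : ℕ → Core → Prop) {s : Core} (h0 : Inv 0 s)
    (hs : ∀ k < m, ∀ s', Inv k s' → Inv (k + 1) (c.den W n g w (Function.update env x k) s')) :
    Inv m ((Prog.loop x e c).den W n g w env s) := by
  rw [Prog.den, he]
  exact foldl_range_induct _ Inv h0 m hs

lemma Core.fill_arr_of_ne {s : Core} {a a' : ℕ} (h : a' ≠ a) (D : ℕ → ℕ → Prop) (f : ℕ → ℕ → ℝ) :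
    (s.fill a D f).arr a' = s.arr a' := by
  funext i j
  simp [Core.fill, h]

lemma Prog.den_frame {a : ℕ} : ∀ (c : Prog) (_ : a ∉ c.writes) (env : ℕ → ℕ) (s : Core),
    (c.den W n g w env s).arr a = s.arr a
  | .skip, _, _, _ => rfl
  | .setN _ _, _, _, _ => rfl
  | .setR _ _ _ _, h, _, _ => Core.fill_arr_of_ne (by simpa [writes] using h) _ _
  | .gauss _ _ _, h, _, s => Core.fill_arr_of_ne (s := s) (by simpa [writes] using h) _ _
  | .call _ o, h, _, _ => by
      have h' : a ≠ o := by simpa [writes] using h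
      funext i j
      simp [Prog.den, Core.oracleCall, h']
  | .seq c d, h, env, s => by
      simp only [writes, Finset.mem_union, not_or] at h
      rw [Prog.den, den_frame d h.2, den_frame c h.1]
  | .ifLe _ _ c d, h, env, s => by
      simp only [writes, Finset.mem_union, not_or] at h
      rw [Prog.den]
      split_ifs
      · exact den_frame c h.1 _ _
      · exact den_frame d h.2 _ _
  | .loop x e c, h, env, s =>
      Prog.den_loop_induct W n g w rfl (fun _ s' => s'.arr a = s.arr a) rfl fun k _ s' hs' => by
        rw [den_frame c h, hs']

lemma Prog.den_counters : ∀ (c : Prog) (_ : c.Pure) (env : ℕ → ℕ) (s : Core),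
    (c.den W n g w env s).coins = s.coins ∧ (c.den W n g w env s).calls = s.calls
  | .skip, _, _, _ => ⟨rfl, rfl⟩
  | .setN _ _, _, _, _ => ⟨rfl, rfl⟩
  | .setR _ _ _ _, _, _, _ => ⟨rfl, rfl⟩
  | .seq c d, h, env, s => by
      have h1 := den_counters c h.1 env s
      have h2 := den_counters d h.2 env (c.den W n g w env s)
      exact ⟨h2.1.trans h1.1, h2.2.trans h1.2⟩
  | .ifLe _ _ c d, h, env, s => by
      rw [Prog.den]
      split_ifs
      · exact den_counters c h.1 _ _
      · exact den_counters d h.2 _ _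
  | .loop x e c, h, env, s =>
      Prog.den_loop_induct W n g w rfl (fun _ s' => s'.coins = s.coins ∧ s'.calls = s.calls)
        ⟨rfl, rfl⟩ fun k _ s' hs' => by
          have h1 := den_counters c h (Function.update env x k) s'
          exact ⟨h1.1.trans hs'.1, h1.2.trans hs'.2⟩

/-! ### Loops that fill a region of an array -/

lemma Core.fill_arr (s : Core) (a : ℕ) (D : ℕ → ℕ → Prop) (f : ℕ → ℕ → ℝ) {i j : ℕ} (h : D i j) :
    (s.fill a D f).arr a i j = f i j := by
  simp [Core.fill, h]

lemma Core.fill_arr_of_not (s : Core) (a : ℕ) (D : ℕ → ℕ → Prop) (f : ℕ → ℕ → ℝ) {i j : ℕ}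
    (h : ¬ D i j) : (s.fill a D f).arr a i j = s.arr a i j := by
  simp [Core.fill, h]

lemma Core.fill_fill (s : Core) (a : ℕ) (D D' : ℕ → ℕ → Prop) (f : ℕ → ℕ → ℝ) :
    (s.fill a D f).fill a D' f = s.fill a (fun i j => D i j ∨ D' i j) f := by
  simp only [Core.fill]
  congr 1
  funext a' i j
  by_cases h1 : a' = a <;> by_cases h2 : D i j <;> by_cases h3 : D' i j <;> simp [h1, h2, h3]

lemma Core.fill_false (s : Core) (a : ℕ) (f : ℕ → ℕ → ℝ) : s.fill a (fun _ _ => False) f = s := by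
  simp [Core.fill]

lemma Core.fill_congr (s : Core) (a : ℕ) {D D' : ℕ → ℕ → Prop} {f f' : ℕ → ℕ → ℝ}
    (hD : ∀ i j, D i j ↔ D' i j) (hf : ∀ i j, D i j → f i j = f' i j) :
    s.fill a D f = s.fill a D' f' := by
  simp only [Core.fill]
  congr 1
  funext a' i j
  by_cases h : D i j
  · simp [h, (hD i j).mp h, hf i j h]
  · simp [h, (hD i j).not.mp h]

variable {W n g w} {env : ℕ → ℕ} {s : Core}

lemma Prog.den_setR {a : ℕ} {i j : NExp} {e : RExp} {I J : ℕ} (f : ℕ → ℕ → ℝ) (hi : i.ev env = I)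
    (hj : j.ev env = J) (he : e.ev env s.arr = f I J) :
    (Prog.setR a i j e).den W n g w env s = s.fill a (fun i j => i = I ∧ j = J) f := by
  rw [Prog.den, hi, hj, he]
  exact Core.fill_congr _ _ (fun _ _ => Iff.rfl) fun i j h => by rw [h.1, h.2]

/-- Reduces a loop to its body: iteration k has to be checked only on a memory where the regions of
the earlier iterations already hold their final values. -/
lemma Prog.den_loop_fill {x a m : ℕ} {e : NExp} {c : Prog} (D : ℕ → ℕ → ℕ → Prop)
    (f : ℕ → ℕ → ℝ) (he : e.ev env = m)
    (hc : ∀ k < m, c.den W n g w (Function.update env x k)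
        (s.fill a (fun i j => ∃ k' < k, D k' i j) f) =
      (s.fill a (fun i j => ∃ k' < k, D k' i j) f).fill a (D k) f) :
    (Prog.loop x e c).den W n g w env s = s.fill a (fun i j => ∃ k < m, D k i j) f := by
  refine Prog.den_loop_induct W n g w he (fun k s' => s' = s.fill a (fun i j => ∃ k' < k, D k' i j) f)
    ?_ fun k hk s' hs' => ?_
  · simp [Core.fill_false]
  · rw [hs', hc k hk, Core.fill_fill]
    refine Core.fill_congr _ _ (fun i j => ?_) fun _ _ _ => rfl
    constructor
    · rintro (⟨k', hk', h⟩ | h)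
      · exact ⟨k', hk'.trans (Nat.lt_succ_self k), h⟩
      · exact ⟨k, Nat.lt_succ_self k, h⟩
    · rintro ⟨k', hk', h⟩
      rcases Nat.lt_succ_iff_lt_or_eq.mp hk' with h' | rfl
      · exact Or.inl ⟨k', h', h⟩
      · exact Or.inr h

/-- A loop over the entries of a row. -/
lemma Prog.den_loop_row {x a m : ℕ} {e : NExp} {c : Prog} (I : ℕ) (f : ℕ → ℕ → ℝ)
    (he : e.ev env = m)
    (hc : ∀ k < m, c.den W n g w (Function.update env x k)
        (s.fill a (fun i j => i = I ∧ j < k) f) =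
      (s.fill a (fun i j => i = I ∧ j < k) f).fill a (fun i j => i = I ∧ j = k) f) :
    (Prog.loop x e c).den W n g w env s = s.fill a (fun i j => i = I ∧ j < m) f := by
  have hD : ∀ k : ℕ, (fun i j : ℕ => ∃ k' < k, i = I ∧ j = k') = fun i j => i = I ∧ j < k := by
    intro k
    funext i j
    exact propext ⟨fun ⟨k', h, h1, h2⟩ => ⟨h1, h2 ▸ h⟩, fun ⟨h1, h2⟩ => ⟨j, h2, h1, rfl⟩⟩
  rw [Prog.den_loop_fill (D := fun k i j => i = I ∧ j = k) f he (by simpa only [hD] using hc), hD]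

/-- A loop over the rows of an array. -/
lemma Prog.den_loop_rows {x a m : ℕ} {e : NExp} {c : Prog} (P : ℕ → Prop) (f : ℕ → ℕ → ℝ)
    (he : e.ev env = m)
    (hc : ∀ k < m, c.den W n g w (Function.update env x k)
        (s.fill a (fun i j => i < k ∧ P j) f) =
      (s.fill a (fun i j => i < k ∧ P j) f).fill a (fun i j => i = k ∧ P j) f) :
    (Prog.loop x e c).den W n g w env s = s.fill a (fun i j => i < m ∧ P j) f := by
  have hD : ∀ k : ℕ, (fun i j : ℕ => ∃ k' < k, i = k' ∧ P j) = fun i j => i < k ∧ P j := by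
    intro k
    funext i j
    exact propext ⟨fun ⟨k', h, h1, h2⟩ => ⟨h1 ▸ h, h2⟩, fun ⟨h1, h2⟩ => ⟨i, h1, rfl, h2⟩⟩
  rw [Prog.den_loop_fill (D := fun k i j => i = k ∧ P j) f he (by simpa only [hD] using hc), hD]

/-- `a[i, j] := ∑ x < b, e`. -/
def Prog.sumTo (a : ℕ) (i j : NExp) (x : ℕ) (b : NExp) (e : RExp) : Prog :=
  .seq (.setR a i j (.lit 0)) (.loop x b (.setR a i j (.add (.get a i j) e)))

/-- The hypothesis `he` quantifies over the content v of the accumulator cell: the summand must not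
depend on it. -/
lemma Prog.den_sumTo {a x m : ℕ} {i j b : NExp} {e : RExp} {I J : ℕ} (f : ℕ → ℕ → ℝ) (t : ℕ → ℝ)
    (hi : i.ev env = I) (hj : j.ev env = J) (hi' : ∀ k, i.ev (Function.update env x k) = I)
    (hj' : ∀ k, j.ev (Function.update env x k) = J) (hb : b.ev env = m)
    (he : ∀ k < m, ∀ v : ℝ, e.ev (Function.update env x k)
      (s.fill a (fun i j => i = I ∧ j = J) fun _ _ => v).arr = t k)
    (hf : f I J = ∑ k ∈ Finset.range m, t k) :
    (Prog.sumTo a i j x b e).den W n g w env s = s.fill a (fun i j => i = I ∧ j = J) f := by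
  have h1 : (Prog.sumTo a i j x b e).den W n g w env s =
      s.fill a (fun i j => i = I ∧ j = J) fun _ _ => ∑ k ∈ Finset.range m, t k := by
    rw [Prog.sumTo, Prog.den, Prog.den_setR (fun _ _ => 0) hi hj (by simp [RExp.ev])]
    refine Prog.den_loop_induct W n g w hb (fun k s' =>
      s' = s.fill a (fun i j => i = I ∧ j = J) fun _ _ => ∑ k ∈ Finset.range k, t k) (by simp) ?_
    rintro k hk s' rfl
    rw [Prog.den_setR (fun _ _ => ∑ k ∈ Finset.range (k + 1), t k) (hi' k) (hj' k)]
    · simp only [Core.fill]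
      congr 1
      funext a' i j
      by_cases h : a' = a ∧ i = I ∧ j = J <;> simp [h]
    · rw [RExp.ev, he k hk, RExp.ev, hi', hj', Core.fill_arr _ _ _ _ ⟨rfl, rfl⟩,
        Finset.sum_range_succ]
  rw [h1]
  exact Core.fill_congr _ _ (fun _ _ => Iff.rfl) fun i j h => by rw [h.1, h.2, hf]

end den

end LWERed

namespace LWERed

/-! ### Polynomial bounds -/

/-- `f` is bounded by a polynomial. -/
def PolyBdd (f : ℕ → ℕ) : Prop := ∃ K : ℕ, ∀ s, f s ≤ K * (s + 1) ^ K

lemma PolyBdd.of_pow {f : ℕ → ℕ} {a b : ℕ} (hf : ∀ s, f s ≤ a * (s + 1) ^ b) : PolyBdd f :=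
  ⟨a + b, fun s => (hf s).trans (Nat.mul_le_mul (Nat.le_add_right a b)
    (Nat.pow_le_pow_right (Nat.succ_pos s) (Nat.le_add_left b a)))⟩

lemma PolyBdd.const (k : ℕ) : PolyBdd fun _ => k := .of_pow (a := k) (b := 0) (by simp)

lemma PolyBdd.id : PolyBdd fun s => s := .of_pow (a := 1) (b := 1) fun s => by simp

lemma PolyBdd.mul {f h : ℕ → ℕ} (hf : PolyBdd f) (hh : PolyBdd h) : PolyBdd fun s => f s * h s := by
  obtain ⟨K, hK⟩ := hf
  obtain ⟨L, hL⟩ := hh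
  refine .of_pow (a := K * L) (b := K + L) fun s => (Nat.mul_le_mul (hK s) (hL s)).trans_eq ?_
  rw [pow_add]; ring

lemma PolyBdd.add {f h : ℕ → ℕ} (hf : PolyBdd f) (hh : PolyBdd h) : PolyBdd fun s => f s + h s := by
  obtain ⟨K, hK⟩ := hf
  obtain ⟨L, hL⟩ := hh
  refine .of_pow (a := K + L) (b := K + L) fun s => ?_
  have h1 : (s + 1) ^ K ≤ (s + 1) ^ (K + L) := Nat.pow_le_pow_right (Nat.succ_pos s) (by omega)
  have h2 : (s + 1) ^ L ≤ (s + 1) ^ (K + L) := Nat.pow_le_pow_right (Nat.succ_pos s) (by omega)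
  calc f s + h s ≤ K * (s + 1) ^ K + L * (s + 1) ^ L := Nat.add_le_add (hK s) (hL s)
    _ ≤ K * (s + 1) ^ (K + L) + L * (s + 1) ^ (K + L) :=
      Nat.add_le_add (Nat.mul_le_mul_left _ h1) (Nat.mul_le_mul_left _ h2)
    _ = _ := by ring

lemma PolyBdd.pow {f : ℕ → ℕ} (hf : PolyBdd f) (k : ℕ) : PolyBdd fun s => f s ^ k := by
  induction k with
  | zero => simpa using PolyBdd.const 1
  | succ k ih => simpa only [pow_succ] using ih.mul hf

/-! ### Running times -/

/-- An upper bound for an expression in register `0`, monotone in the register. -/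
def NExp.bound (s : ℕ) : NExp → ℕ
  | .lit k => k
  | .var _ => s
  | .add a b => a.bound s + b.bound s
  | .sub a _ => a.bound s
  | .mul a b => a.bound s * b.bound s

lemma NExp.eval_le_bound {σ : State} {s : ℕ} (h : σ.nat 0 ≤ s) :
    ∀ e : NExp, e.In {0} → e.eval σ ≤ e.bound s
  | .lit _, _ => le_rfl
  | .var x, hx => by rw [Finset.mem_singleton.mp hx]; exact h
  | .add a b, hx => Nat.add_le_add (eval_le_bound h a hx.1) (eval_le_bound h b hx.2)
  | .sub a b, hx => (Nat.sub_le _ _).trans (eval_le_bound h a hx.1)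
  | .mul a b, hx => Nat.mul_le_mul (eval_le_bound h a hx.1) (eval_le_bound h b hx.2)

lemma NExp.polyBdd_bound : ∀ e : NExp, PolyBdd fun s => e.bound s
  | .lit k => .const k
  | .var _ => .id
  | .add a b => a.polyBdd_bound.add b.polyBdd_bound
  | .sub a _ => a.polyBdd_bound
  | .mul a b => a.polyBdd_bound.mul b.polyBdd_bound

/-- The expression does not round. -/
def RExp.FloorFree : RExp → Prop
  | .add a b => a.FloorFree ∧ b.FloorFree
  | .sub a b => a.FloorFree ∧ b.FloorFree
  | .mul a b => a.FloorFree ∧ b.FloorFree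
  | .div a b => a.FloorFree ∧ b.FloorFree
  | .sqrt a => a.FloorFree
  | .floor _ => False
  | _ => True

lemma RExp.cost_eq (σ τ : State) : ∀ e : RExp, e.FloorFree → e.cost σ = e.cost τ
  | .lit _, _ => rfl
  | .ofNat _, _ => rfl
  | .get _ _ _, _ => rfl
  | .add a b, h => by simp only [cost, cost_eq σ τ a h.1, cost_eq σ τ b h.2]
  | .sub a b, h => by simp only [cost, cost_eq σ τ a h.1, cost_eq σ τ b h.2]
  | .mul a b, h => by simp only [cost, cost_eq σ τ a h.1, cost_eq σ τ b h.2]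
  | .div a b, h => by simp only [cost, cost_eq σ τ a h.1, cost_eq σ τ b h.2]
  | .sqrt a, h => by simp only [cost, cost_eq σ τ a h]

lemma RExp.exists_cost_eq {e : RExp} (h : e.FloorFree) : ∃ k, ∀ σ, e.cost σ = k :=
  ⟨e.cost ⟨fun _ => 0, fun _ _ _ => 0, 0, 0, 0⟩, fun σ => e.cost_eq σ _ h⟩

lemma bits_mono {s t : ℝ} (h : |s| ≤ |t|) : bits s ≤ bits t :=
  Nat.size_le_size (Nat.ceil_mono h)

/-- The guard compares squares, since the machine has no absolute value; this turns a passed guard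
into a bound on the cost of rounding. -/
lemma bits_le_of_sq_le {t H : ℝ} (h : t * t ≤ H) : bits t ≤ bits H + 1 := by
  rcases le_total |t| 1 with h1 | h1
  · have h2 : bits t ≤ bits 1 := bits_mono (by simpa using h1)
    have h3 : bits 1 = 1 := by simp [bits]
    omega
  · have : |t| ≤ |H| := by
      calc |t| ≤ |t| * |t| := le_mul_of_one_le_left (abs_nonneg t) h1
        _ = t * t := abs_mul_abs_self t
        _ ≤ H := h
        _ ≤ |H| := le_abs_self H
    exact (bits_mono this).trans (Nat.le_succ _)

section time

variable {p N : ℕ → ℕ} {Ω : Type*} [MeasurableSpace Ω]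

/-- With the dimension in register `0`, and, if `b` holds, the number `H` in entry `(0, 0)` of array
`10`, the program runs in time polynomial in the dimension and the length of `H`, and preserves
these data. -/
def Prog.PolyTimed (W : Oracle p N Ω) (b : Prop) (c : Prog) : Prop :=
  ∃ f : ℕ → ℕ, PolyBdd f ∧ ∀ (n : ℕ) (g : ℕ → ℝ) (w : ℕ → Ω) (H : ℝ) (σ : State), σ.nat 0 = n →
    (b → σ.arr 10 0 0 = H) → (c.exec W n g w σ).nat 0 = n ∧
      (b → (c.exec W n g w σ).arr 10 0 0 = H) ∧ (c.exec W n g w σ).time ≤ σ.time + f (n + bits H)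

variable {W : Oracle p N Ω} {b : Prop}

lemma writeR_arr_of_ne {σ : State} {a a' i j : ℕ} {v : ℝ} (h : a' ≠ a) :
    (σ.writeR a i j v).arr a' = σ.arr a' := by
  funext i' j'
  simp [State.writeR, h]

lemma Prog.polyTimed_skip : (Prog.skip).PolyTimed W b :=
  ⟨fun _ => 1, .const 1, fun _ _ _ _ _ h hb => ⟨h, hb, le_rfl⟩⟩

lemma Prog.polyTimed_setR {a : ℕ} {i j : NExp} {e : RExp} (ha : b → a ≠ 10) (he : e.FloorFree) :
    (Prog.setR a i j e).PolyTimed W b := by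
  obtain ⟨k, hk⟩ := RExp.exists_cost_eq he
  refine ⟨fun _ => i.cost + j.cost + k + 1, .const _, fun n g w H σ h hb => ⟨h, fun hb' => ?_, ?_⟩⟩
  · rw [← hb hb']
    exact congrFun (congrFun (writeR_arr_of_ne (ha hb').symm) 0) 0
  · simp only [Prog.exec, State.tick, hk]
    exact le_rfl

lemma Prog.polyTimed_gauss {a : ℕ} {i j : NExp} (ha : b → a ≠ 10) :
    (Prog.gauss a i j).PolyTimed W b := by
  refine ⟨fun _ => i.cost + j.cost + 1, .const _, fun n g w H σ h hb => ⟨h, fun hb' => ?_, le_rfl⟩⟩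
  rw [← hb hb']
  exact congrFun (congrFun (writeR_arr_of_ne (σ := σ) (ha hb').symm) 0) 0

lemma Prog.polyTimed_call (hN : PolyBdd N) {a o : ℕ} (ho : b → o ≠ 10) :
    (Prog.call a o).PolyTimed W b := by
  obtain ⟨K, hK⟩ := hN
  refine ⟨fun s => K * (s + 1) ^ K * (s + 1) + s + 1, (((PolyBdd.of_pow (fun s => le_rfl)).mul
    (PolyBdd.id.add (.const 1))).add .id).add (.const 1), fun n g w H σ h hb => ⟨h, fun hb' => ?_, ?_⟩⟩
  · rw [← hb hb']
    have := ho hb'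
    simp [Prog.exec, State.tick, State.oracleCall, this.symm]
  · change σ.time + (N n * (n + 1) + n + 1) ≤ _
    have h1 : n + 1 ≤ n + bits H + 1 := by omega
    have h2 : N n ≤ K * (n + bits H + 1) ^ K :=
      (hK n).trans (Nat.mul_le_mul_left _ (Nat.pow_le_pow_left h1 K))
    have := Nat.mul_le_mul h2 h1
    beta_reduce
    omega

lemma Prog.PolyTimed.seq {c d : Prog} (hc : c.PolyTimed W b) (hd : d.PolyTimed W b) :
    (Prog.seq c d).PolyTimed W b := by
  obtain ⟨f, hf, hc⟩ := hc
  obtain ⟨f', hf', hd⟩ := hd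
  refine ⟨fun s => f s + f' s, hf.add hf', fun n g w H σ h hb => ?_⟩
  obtain ⟨h1, h2, h3⟩ := hc n g w H σ h hb
  obtain ⟨h4, h5, h6⟩ := hd n g w H _ h1 h2
  exact ⟨h4, h5, h6.trans (by beta_reduce; omega)⟩

lemma Prog.PolyTimed.ifLe {c d : Prog} {e e' : RExp} (hc : c.PolyTimed W b) (hd : d.PolyTimed W b)
    (he : e.FloorFree) (he' : e'.FloorFree) : (Prog.ifLe e e' c d).PolyTimed W b := by
  obtain ⟨f, hf, hc⟩ := hc
  obtain ⟨f', hf', hd⟩ := hd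
  obtain ⟨k, hk⟩ := RExp.exists_cost_eq he
  obtain ⟨k', hk'⟩ := RExp.exists_cost_eq he'
  refine ⟨fun s => (k + k' + 1) + (f s + f' s), (PolyBdd.const _).add (hf.add hf'),
    fun n g w H σ h hb => ?_⟩
  simp only [Prog.exec, hk, hk']
  split_ifs
  · obtain ⟨h1, h2, h3⟩ := hc n g w H (σ.tick (k + k' + 1)) h hb
    exact ⟨h1, h2, h3.trans (by simp only [State.tick]; omega)⟩
  · obtain ⟨h1, h2, h3⟩ := hd n g w H (σ.tick (k + k' + 1)) h hb
    exact ⟨h1, h2, h3.trans (by simp only [State.tick]; omega)⟩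

/-- The number of iterations may depend only on register 0, which the loop does not overwrite as x ≠
0; so it is bounded by a polynomial in n, independently of the real data. -/
lemma Prog.PolyTimed.loop {c : Prog} {x : ℕ} {e : NExp} (hc : c.PolyTimed W b) (hx : x ≠ 0)
    (he : e.In {0}) : (Prog.loop x e c).PolyTimed W b := by
  obtain ⟨f, hf, hc⟩ := hc
  refine ⟨fun s => (e.cost + 1) + e.bound s * (f s + 1), (PolyBdd.const _).add
    (e.polyBdd_bound.mul (hf.add (.const 1))), fun n g w H σ h hb => ?_⟩
  rw [Prog.exec]
  have h1 : e.eval σ ≤ e.bound (n + bits H) := e.eval_le_bound (by omega) he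
  have h2 := foldl_range_induct (fun τ i => c.exec W n g w ((τ.writeN x i).tick 1))
    (fun k τ => τ.nat 0 = n ∧ (b → τ.arr 10 0 0 = H) ∧
      τ.time ≤ σ.time + (e.cost + 1) + k * (f (n + bits H) + 1)) (s := σ.tick (e.cost + 1))
    ⟨h, hb, by simp [State.tick]⟩ (e.eval σ) (by
      rintro k - τ ⟨ha1, ha2, ha3⟩
      obtain ⟨h3, h4, h5⟩ := hc n g w H ((τ.writeN x k).tick 1)
        (by simpa [State.tick, State.writeN, Function.update_of_ne hx.symm] using ha1) ha2
      refine ⟨h3, h4, h5.trans ?_⟩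
      have : ((τ.writeN x k).tick 1).time = τ.time + 1 := rfl
      rw [this, add_mul]
      omega)
  refine ⟨h2.1, h2.2.1, h2.2.2.trans ?_⟩
  have := Nat.mul_le_mul_right (f (n + bits H) + 1) h1
  beta_reduce
  omega

/-- `a[i, j] := ⌊e⌋` if `e²` is at most the number in entry `(0, 0)` of array `10`, and `0`
otherwise. -/
def Prog.guardedFloor (a : ℕ) (i j : NExp) (e : RExp) : Prog :=
  .ifLe (.mul e e) (.get 10 (.lit 0) (.lit 0)) (.setR a i j (.floor e)) (.setR a i j (.lit 0))

lemma Prog.polyTimed_guardedFloor {a : ℕ} {i j : NExp} {e : RExp} (hb0 : b) (ha : a ≠ 10)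
    (he : e.FloorFree) : (Prog.guardedFloor a i j e).PolyTimed W b := by
  obtain ⟨k, hk⟩ := RExp.exists_cost_eq he
  refine ⟨fun s => (k + k + 1 + 3 + 1) + (i.cost + j.cost + k + s + 5), (PolyBdd.const _).add
    ((PolyBdd.const _).add .id |>.add (.const 5)), fun n g w H σ h hb => ?_⟩
  have hH := hb hb0
  simp only [Prog.guardedFloor, Prog.exec, RExp.eval, NExp.eval, hH, RExp.cost, NExp.cost, hk]
  split_ifs with hle
  · refine ⟨h, fun _ => ?_, ?_⟩
    · rw [← hH]
      exact congrFun (congrFun (writeR_arr_of_ne (σ := State.tick σ _) ha.symm) 0) 0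
    · have h1 := bits_le_of_sq_le hle
      have h2 : bits (e.eval (σ.tick (k + k + 1 + (1 + 1 + 1) + 1))) = bits (e.eval σ) := by
        have : ∀ (e : NExp) t, e.eval (σ.tick t) = e.eval σ := fun e t => by
          induction e <;> simp_all [NExp.eval, State.tick]
        have : ∀ (e : RExp) t, e.eval (σ.tick t) = e.eval σ := fun e t => by
          induction e <;> simp_all [RExp.eval]
          simp [State.tick]
        rw [this]
      simp only [State.tick, State.writeR] at h2 ⊢
      omega
  · refine ⟨h, fun _ => ?_, ?_⟩
    · rw [← hH]
      exact congrFun (congrFun (writeR_arr_of_ne (σ := State.tick σ _) ha.symm) 0) 0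
    · simp only [State.tick, State.writeR]
      omega

lemma Prog.polyTimed_sumTo {a x : ℕ} {i j e : NExp} {f : RExp} (ha : b → a ≠ 10) (hx : x ≠ 0)
    (he : e.In {0}) (hf : f.FloorFree) : (Prog.sumTo a i j x e f).PolyTimed W b := by
  refine (polyTimed_setR ha ?_).seq ((polyTimed_setR ha ?_).loop hx he)
  · exact trivial
  · exact ⟨trivial, hf⟩

end time

end LWERed

namespace LWERed

open Matrix

/-! ### Solving linear systems by successive projections -/

/-- P is the orthogonal projection onto the complement of the rows treated so far. Subtracting the
projection onto the line of P v adds v to the killed vectors. -/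
lemma projection_step {n : ℕ} {P : Matrix (Fin n) (Fin n) ℝ} (hs : Pᵀ = P) (hi : P * P = P)
    (v : Fin n → ℝ) {U : ℝ} (hU : (P *ᵥ v) ⬝ᵥ (P *ᵥ v) = U) (hU0 : U ≠ 0)
    {P' : Matrix (Fin n) (Fin n) ℝ} (hP' : P' = P - U⁻¹ • vecMulVec (P *ᵥ v) (P *ᵥ v)) :
    P'ᵀ = P' ∧ P' * P' = P' ∧ P' *ᵥ v = 0 ∧ ∀ x, P *ᵥ x = 0 → P' *ᵥ x = 0 := by
  set u := P *ᵥ v with hu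
  have hPu : P *ᵥ u = u := by rw [hu, mulVec_mulVec, hi]
  have huP : u ᵥ* P = u := by rw [← mulVec_transpose, hs, hPu]
  have hux : ∀ x, u ⬝ᵥ x = v ⬝ᵥ (P *ᵥ x) := by
    intro x
    rw [dotProduct_mulVec, ← mulVec_transpose, hs]
  have huv : u ⬝ᵥ v = U := by rw [hux, ← hu, ← hU, hux, hPu]
  refine ⟨?_, ?_, ?_, ?_⟩
  · rw [hP', transpose_sub, hs, transpose_smul, transpose_vecMulVec]
  · have h1 : P * vecMulVec u u = vecMulVec u u := by rw [mul_vecMulVec, hPu]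
    have h2 : vecMulVec u u * P = vecMulVec u u := by rw [vecMulVec_mul, huP]
    have h3 : vecMulVec u u * vecMulVec u u = U • vecMulVec u u := by
      rw [vecMulVec_mul_vecMulVec, hU]
      ext i j
      simp [vecMulVec_apply]
      try ring
    rw [hP', Matrix.mul_sub, Matrix.sub_mul, Matrix.sub_mul, hi, Matrix.mul_smul, Matrix.smul_mul,
      h1, Matrix.smul_mul, Matrix.mul_smul, h2, h3, smul_smul U⁻¹ U, inv_mul_cancel₀ hU0, one_smul,
      sub_self, sub_zero]
  · rw [hP', sub_mulVec, smul_mulVec, vecMulVec_mulVec, huv, ← hu]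
    ext i
    simp [hU0]
  · intro x hx
    rw [hP', sub_mulVec, hx, smul_mulVec, vecMulVec_mulVec, hux, hx, dotProduct_zero]
    ext i
    simp

/-- The invariant Z - Y = P Z says that Y already is the component of the solution along the rows
treated. The update needs Z only through v Z, the known right-hand side. -/
lemma solution_step {n q : ℕ} {P : Matrix (Fin n) (Fin n) ℝ} (hs : Pᵀ = P) (v : Fin n → ℝ) {U : ℝ}
    {Z Y Y' : Matrix (Fin n) (Fin q) ℝ} (hY : Z - Y = P * Z)
    {P' : Matrix (Fin n) (Fin n) ℝ} (hP' : P' = P - U⁻¹ • vecMulVec (P *ᵥ v) (P *ᵥ v))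
    (hY' : Y' = Y + U⁻¹ • vecMulVec (P *ᵥ v) (v ᵥ* Z - v ᵥ* Y)) : Z - Y' = P' * Z := by
  have h1 : v ᵥ* Z - v ᵥ* Y = (P *ᵥ v) ᵥ* Z := by
    rw [← vecMul_sub, hY, ← vecMul_vecMul, ← hs, vecMul_transpose, hs]
  rw [hY', h1, hP', Matrix.sub_mul, Matrix.smul_mul, vecMulVec_mul, ← hY]
  abel

lemma eq_zero_of_kills_spanning {n : ℕ} {ι : Type*} {P : Matrix (Fin n) (Fin n) ℝ}
    {V : ι → Fin n → ℝ} (hV : ∀ z, (∀ l, V l ⬝ᵥ z = 0) → z = 0) (hP : ∀ l, P *ᵥ V l = 0) : P = 0 := by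
  ext i j
  have h : P i = 0 := hV _ fun l => by
    have h1 := congrFun (hP l) i
    rw [dotProduct_comm]
    exact h1
  rw [h]
  rfl

section program

/-- Register `x`. -/
abbrev reg (x : ℕ) : NExp := .var x

/-- The number `k`. -/
abbrev num (k : ℕ) : NExp := .lit k

/-- The projection step for row `l` (register `1`) of the system. -/
def solveStep (vA rA yA : ℕ) (qE : NExp) : Prog :=
  .seq (.loop 2 (reg 0) (.sumTo 21 (num 0) (reg 2) 3 (reg 0)
    (.mul (.get 20 (reg 2) (reg 3)) (.get vA (reg 1) (reg 3)))))
  (.seq (.sumTo 22 (num 0) (num 0) 2 (reg 0) (.mul (.get 21 (num 0) (reg 2)) (.get 21 (num 0) (reg 2))))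
  (.ifLe (.get 22 (num 0) (num 0)) (.lit 0) .skip
  (.seq (.loop 2 qE (.sumTo 23 (num 0) (reg 2) 3 (reg 0)
    (.mul (.get vA (reg 1) (reg 3)) (.get yA (reg 3) (reg 2)))))
  (.seq (.loop 2 (reg 0) (.loop 3 qE (.setR yA (reg 2) (reg 3) (.add (.get yA (reg 2) (reg 3))
    (.mul (.get 21 (num 0) (reg 2)) (.div (.sub (.get rA (reg 1) (reg 3)) (.get 23 (num 0) (reg 3)))
      (.get 22 (num 0) (num 0))))))))
  (.loop 2 (reg 0) (.loop 3 (reg 0) (.setR 20 (reg 2) (reg 3) (.sub (.get 20 (reg 2) (reg 3))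
    (.div (.mul (.get 21 (num 0) (reg 2)) (.get 21 (num 0) (reg 3))) (.get 22 (num 0) (num 0)))))))))))

/-- Set the `n × n` array `a` to the identity matrix. -/
def setId (a : ℕ) : Prog :=
  .loop 2 (reg 0) (.loop 3 (reg 0) (.setR a (reg 2) (reg 3)
    (.ofNat (.sub (num 1) (.add (.sub (reg 2) (reg 3)) (.sub (reg 3) (reg 2)))))))

/-- Solve `V Y = R` for the `n × q` array `Y`, where the rows of the `m × n` array `V` span `ℝⁿ`. -/
def solve (vA rA yA : ℕ) (mE qE : NExp) : Prog :=
  .seq (setId 20) (.seq (.loop 2 (reg 0) (.loop 3 qE (.setR yA (reg 2) (reg 3) (.lit 0))))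
    (.loop 1 mE (solveStep vA rA yA qE)))

variable {p N : ℕ → ℕ} {Ω : Type*} [MeasurableSpace Ω] {W : Oracle p N Ω} {n : ℕ} {g : ℕ → ℝ}
  {w : ℕ → Ω} {env : ℕ → ℕ} {s : Core}

lemma Core.fill_single_arr (s : Core) (a I J : ℕ) (f : ℕ → ℕ → ℝ) :
    (s.fill a (fun i j => i = I ∧ j = J) f).arr a I J = f I J :=
  Core.fill_arr _ _ _ _ ⟨rfl, rfl⟩

/-- The subtraction of registers is truncated, so (i - j) + (j - i) is |i - j|, and 1 - |i - j| is 1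
on the diagonal and 0 elsewhere. -/
lemma den_setId (a : ℕ) (h0 : env 0 = n) :
    (setId a).den W n g w env s =
      s.fill a (fun i j => i < n ∧ j < n) fun i j => if i = j then 1 else 0 := by
  refine Prog.den_loop_rows (fun j => j < n) _ h0 fun i hi => ?_
  refine Prog.den_loop_row i _ (by simp [NExp.ev, h0]) fun j hj => ?_
  refine Prog.den_setR _ (by simp [NExp.ev]) (by simp [NExp.ev]) ?_
  simp only [RExp.ev, NExp.ev, Function.update_self, Function.update_of_ne (show (2 : ℕ) ≠ 3 by decide)]
  split_ifs with h
  · subst h; simp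
  · norm_cast; omega

/-- U is the squared length of the projected row, so U ≤ 0 means that the row depends on earlier
ones; it is then skipped, and no division by zero occurs. -/
lemma den_solveStep {vA rA yA : ℕ} {qE : NExp} {q k : ℕ}
    (hv : vA ≠ 20 ∧ vA ≠ 21 ∧ vA ≠ 22 ∧ vA ≠ 23 ∧ vA ≠ yA)
    (hr : rA ≠ 20 ∧ rA ≠ 21 ∧ rA ≠ 22 ∧ rA ≠ 23 ∧ rA ≠ yA)
    (hy : yA ≠ 20 ∧ yA ≠ 21 ∧ yA ≠ 22 ∧ yA ≠ 23)
    (h0 : env 0 = n) (h1 : env 1 = k) (hq : ∀ e : ℕ → ℕ, e 0 = n → qE.ev e = q)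
    {u : ℕ → ℝ} (hu : u = fun a => ∑ b ∈ Finset.range n, s.arr 20 a b * s.arr vA k b)
    {U : ℝ} (hU : U = ∑ a ∈ Finset.range n, u a * u a) :
    ∃ s', (solveStep vA rA yA qE).den W n g w env s = s' ∧
      (U ≤ 0 → s'.arr 20 = s.arr 20 ∧ s'.arr yA = s.arr yA) ∧
      (0 < U → (∀ a b, a < n → b < n → s'.arr 20 a b = s.arr 20 a b - u a * u b / U) ∧
        (∀ a b, a < n → b < q → s'.arr yA a b = s.arr yA a b + u a *
          ((s.arr rA k b - ∑ a ∈ Finset.range n, s.arr vA k a * s.arr yA a b) / U))) := by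
  obtain ⟨hv0, hv1, hv2, hv3, hvy⟩ := hv
  obtain ⟨hr0, hr1, hr2, hr3, hry⟩ := hr
  obtain ⟨hy0, hy1, hy2, hy3⟩ := hy
  refine ⟨_, rfl, ?_⟩
  have e1 : ∀ s : Core, ∀ u : ℕ → ℝ, u = (fun a => ∑ b ∈ Finset.range n, s.arr 20 a b * s.arr vA k b) →
      (Prog.loop 2 (reg 0) (.sumTo 21 (num 0) (reg 2) 3 (reg 0)
        (.mul (.get 20 (reg 2) (reg 3)) (.get vA (reg 1) (reg 3))))).den W n g w env s =
      s.fill 21 (fun i j => i = 0 ∧ j < n) fun _ j => u j := by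
    intro s u hu
    refine Prog.den_loop_row 0 _ h0 fun j hj => ?_
    refine Prog.den_sumTo (m := n) _ (fun b => s.arr 20 j b * s.arr vA k b) (by simp [NExp.ev])
      (by simp [NExp.ev]) (by simp [NExp.ev]) (by simp [NExp.ev]) (by simp [NExp.ev, h0])
      (fun b hb v => ?_) (by rw [hu])
    simp [RExp.ev, NExp.ev, Core.fill, hv1, h1]
  have e2 : ∀ s : Core, ∀ U : ℝ, U = ∑ a ∈ Finset.range n, s.arr 21 0 a * s.arr 21 0 a → 
      (Prog.sumTo 22 (num 0) (num 0) 2 (reg 0) (.mul (.get 21 (num 0) (reg 2))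
        (.get 21 (num 0) (reg 2)))).den W n g w env s =
      s.fill 22 (fun i j => i = 0 ∧ j = 0) fun _ _ => U := by
    intro s U hU
    refine Prog.den_sumTo (m := n) _ (fun b => s.arr 21 0 b * s.arr 21 0 b) (by simp [NExp.ev])
      (by simp [NExp.ev]) (by simp [NExp.ev]) (by simp [NExp.ev]) (by simp [NExp.ev, h0])
      (fun b hb v => ?_) hU
    simp [RExp.ev, NExp.ev, Core.fill]
  have e3 : ∀ s : Core, 
      (Prog.loop 2 qE (.sumTo 23 (num 0) (reg 2) 3 (reg 0)
        (.mul (.get vA (reg 1) (reg 3)) (.get yA (reg 3) (reg 2))))).den W n g w env s =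
      s.fill 23 (fun i j => i = 0 ∧ j < q) fun _ j =>
        ∑ a ∈ Finset.range n, s.arr vA k a * s.arr yA a j := by
    intro s
    refine Prog.den_loop_row 0 _ (hq env h0) fun j hj => ?_
    refine Prog.den_sumTo (m := n) _ (fun b => s.arr vA k b * s.arr yA b j) (by simp [NExp.ev])
      (by simp [NExp.ev]) (by simp [NExp.ev]) (by simp [NExp.ev]) (by simp [NExp.ev, h0])
      (fun b hb v => ?_) rfl
    simp [RExp.ev, NExp.ev, Core.fill, hv3, hy3, h1]
  have e4 : ∀ s : Core,
      (Prog.loop 2 (reg 0) (.loop 3 qE (.setR yA (reg 2) (reg 3) (.add (.get yA (reg 2) (reg 3))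
        (.mul (.get 21 (num 0) (reg 2)) (.div (.sub (.get rA (reg 1) (reg 3)) (.get 23 (num 0) (reg 3)))
        (.get 22 (num 0) (num 0)))))))).den W n g w env s =
      s.fill yA (fun i j => i < n ∧ j < q) fun a b => s.arr yA a b + s.arr 21 0 a *
        ((s.arr rA k b - s.arr 23 0 b) / s.arr 22 0 0) := by
    intro s
    refine Prog.den_loop_rows (fun j => j < q) _ h0 fun i hi => ?_
    refine Prog.den_loop_row i _ (hq _ (by simp [h0])) fun j hj => ?_
    refine Prog.den_setR _ (by simp [NExp.ev]) (by simp [NExp.ev]) ?_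
    simp [RExp.ev, NExp.ev, Core.fill, hy1.symm, hy2.symm, hy3.symm, hry, h1]
  have e5 : ∀ s : Core,
      (Prog.loop 2 (reg 0) (.loop 3 (reg 0) (.setR 20 (reg 2) (reg 3) (.sub (.get 20 (reg 2) (reg 3))
        (.div (.mul (.get 21 (num 0) (reg 2)) (.get 21 (num 0) (reg 3))) (.get 22 (num 0) (num 0))))))).den
          W n g w env s =
      s.fill 20 (fun i j => i < n ∧ j < n) fun a b => s.arr 20 a b -
        s.arr 21 0 a * s.arr 21 0 b / s.arr 22 0 0 := by
    intro s
    refine Prog.den_loop_rows (fun j => j < n) _ h0 fun i hi => ?_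
    refine Prog.den_loop_row i _ (by simp [NExp.ev, h0]) fun j hj => ?_
    refine Prog.den_setR _ (by simp [NExp.ev]) (by simp [NExp.ev]) ?_
    simp [RExp.ev, NExp.ev, Core.fill]
  have hs1 := e1 s u hu
  have hs2 := e2 (s.fill 21 (fun i j => i = 0 ∧ j < n) fun _ j => u j) U (by
    rw [hU]
    refine Finset.sum_congr rfl fun a ha => ?_
    rw [Core.fill_arr _ _ _ _ ⟨rfl, Finset.mem_range.mp ha⟩])
  rw [solveStep, Prog.den, hs1, Prog.den, hs2, Prog.den]
  simp only [RExp.ev, NExp.ev, Core.fill_single_arr, Rat.cast_zero]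
  constructor
  · intro h
    rw [if_pos h, Prog.den, Core.fill_arr_of_ne (by decide), Core.fill_arr_of_ne (by decide),
      Core.fill_arr_of_ne hy2, Core.fill_arr_of_ne hy1]
    exact ⟨rfl, rfl⟩
  · intro h
    rw [if_neg (not_le.mpr h), Prog.den, e3, Prog.den, e4, e5]
    constructor
    · intro a b ha hb
      simp [Core.fill, ha, hb, hy0.symm, hy1.symm, hy2.symm]
    · intro a b ha hb
      simp [Core.fill, ha, hb, hy0, hy1, hy2, hy3, hr1, hr2, hr3, hv1, hv2]

end program

end LWERed

/-! ### Correctness of the linear solver, inversion of the basis, the LWE sample program -/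

namespace LWERed

open Matrix

variable {p N : ℕ → ℕ} {Ω : Type*} [MeasurableSpace Ω] {W : Oracle p N Ω} {n : ℕ} {g : ℕ → ℝ}
  {w : ℕ → Ω} {env : ℕ → ℕ} {s : Core}

/-- The system may be overdetermined: consistency is assumed through the solution Z, and redundant
rows are skipped. In the end P kills a spanning set, hence P = 0 and the invariant reads Y = Z. -/
lemma den_solve_arr {vA rA yA : ℕ} {mE qE : NExp} {m q : ℕ}
    (hv : vA ≠ 20 ∧ vA ≠ 21 ∧ vA ≠ 22 ∧ vA ≠ 23 ∧ vA ≠ yA)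
    (hr : rA ≠ 20 ∧ rA ≠ 21 ∧ rA ≠ 22 ∧ rA ≠ 23 ∧ rA ≠ yA)
    (hy : yA ≠ 20 ∧ yA ≠ 21 ∧ yA ≠ 22 ∧ yA ≠ 23)
    (h0 : env 0 = n) (hm : mE.ev env = m) (hq : ∀ e : ℕ → ℕ, e 0 = n → qE.ev e = q)
    (Z : Matrix (Fin n) (Fin q) ℝ) (V : Fin m → Fin n → ℝ) (hV : ∀ (l : Fin m) (a : Fin n), s.arr vA l a = V l a)
    (hR : ∀ (l : Fin m) (b : Fin q), s.arr rA l b = (V l ᵥ* Z) b) (hspan : ∀ z, (∀ l, V l ⬝ᵥ z = 0) → z = 0)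
    (a : Fin n) (b : Fin q) :
    ((solve vA rA yA mE qE).den W n g w env s).arr yA a b = Z a b := by
  have hframe : ∀ c ∈ ({vA, rA} : Finset ℕ), c ∉ (solveStep vA rA yA qE).writes := by
    intro c hc
    simp only [Finset.mem_insert, Finset.mem_singleton] at hc
    rcases hc with rfl | rfl <;>
      simp [solveStep, Prog.writes, Prog.sumTo, hv.1, hv.2, hr.1, hr.2]
  have e1 : (Prog.loop 2 (reg 0) (.loop 3 qE (.setR yA (reg 2) (reg 3) (.lit 0)))).den W n g w env
      (s.fill 20 (fun i j => i < n ∧ j < n) fun i j => if i = j then 1 else 0) =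
      (s.fill 20 (fun i j => i < n ∧ j < n) fun i j => if i = j then 1 else 0).fill yA
        (fun i j => i < n ∧ j < q) fun _ _ => 0 := by
    refine Prog.den_loop_rows (fun j => j < q) _ h0 fun i hi => ?_
    refine Prog.den_loop_row i _ (hq _ (by simp [h0])) fun j hj => ?_
    exact Prog.den_setR _ (by simp [NExp.ev]) (by simp [NExp.ev]) (by simp [RExp.ev])
  rw [solve, Prog.den, den_setId _ h0, Prog.den, e1]
  set s1 := (s.fill 20 (fun i j => i < n ∧ j < n) fun i j => if i = j then 1 else 0).fill yA
        (fun i j => i < n ∧ j < q) fun _ _ => 0 with hs1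
  have h1v : s1.arr vA = s.arr vA := by
    rw [hs1, Core.fill_arr_of_ne hv.2.2.2.2, Core.fill_arr_of_ne hv.1]
  have h1r : s1.arr rA = s.arr rA := by
    rw [hs1, Core.fill_arr_of_ne hr.2.2.2.2, Core.fill_arr_of_ne hr.1]
  have key := Prog.den_loop_induct W n g w (x := 1) (c := solveStep vA rA yA qE) (env := env) hm
    (fun k s' => s'.arr vA = s.arr vA ∧ s'.arr rA = s.arr rA ∧ ∃ P : Matrix (Fin n) (Fin n) ℝ,
      (∀ a b : Fin n, s'.arr 20 a b = P a b) ∧ Pᵀ = P ∧ P * P = P ∧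
      (∀ l : Fin m, l.1 < k → P *ᵥ V l = 0) ∧ Z - Matrix.of (fun (a : Fin n) (b : Fin q) => s'.arr yA a b) = P * Z)
    (s := s1) ?_ ?_
  · obtain ⟨-, -, P, -, hPs, -, hPk, hPZ⟩ := key
    have hP0 : P = 0 := eq_zero_of_kills_spanning hspan fun l => hPk l l.2
    rw [hP0, Matrix.zero_mul, sub_eq_zero] at hPZ
    exact (congrFun (congrFun hPZ a) b).symm
  · refine ⟨h1v, h1r, 1, fun a b => ?_, transpose_one, Matrix.one_mul _, fun l hl => absurd hl (Nat.not_lt_zero _), ?_⟩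
    · rw [hs1, Core.fill_arr_of_ne hy.1.symm, Core.fill_arr _ _ _ _ ⟨a.2, b.2⟩, Matrix.one_apply]
      simp [Fin.ext_iff]
    · rw [Matrix.one_mul, sub_eq_self]
      ext a b
      rw [Matrix.of_apply, hs1, Core.fill_arr _ _ _ _ ⟨a.2, b.2⟩]
      rfl
  · rintro k hk s' ⟨hv', hr', P, hP, hPs, hPi, hPk, hPZ⟩
    obtain ⟨s'', hs'', hle, hlt⟩ := den_solveStep (W := W) (g := g) (w := w) (s := s')
      (env := Function.update env 1 k) (k := k) hv hr hy (by simp [h0]) (by simp) hq rfl rfl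
    rw [hs'']
    have hfr : ∀ c ∈ ({vA, rA} : Finset ℕ), s''.arr c = s'.arr c := fun c hc => by
      rw [← hs'']; exact Prog.den_frame W n g w _ (hframe c hc) _ _
    refine ⟨by rw [hfr vA (by simp), hv'], by rw [hfr rA (by simp), hr'], ?_⟩
    set v := V ⟨k, hk⟩ with hvdef
    have hvk : ∀ b : Fin n, s'.arr vA k b = v b := fun b => by rw [hv']; exact hV ⟨k, hk⟩ b
    have hu : ∀ a : Fin n, ∑ b ∈ Finset.range n, s'.arr 20 a b * s'.arr vA k b = (P *ᵥ v) a := by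
      intro a
      rw [Finset.sum_range]
      simp only [hP, hvk]
      rfl
    have hU : ∑ a ∈ Finset.range n, (∑ b ∈ Finset.range n, s'.arr 20 a b * s'.arr vA k b) *
        (∑ b ∈ Finset.range n, s'.arr 20 a b * s'.arr vA k b) = (P *ᵥ v) ⬝ᵥ (P *ᵥ v) := by
      rw [Finset.sum_range]
      simp only [hu]
      rfl
    rw [hU] at hle hlt
    -- If U = 0 then P v = 0 already, so the old projection also kills the new row.
    rcases (dot_self_nonneg (P *ᵥ v)).eq_or_lt with hU0 | hU0
    · obtain ⟨h20, hyA⟩ := hle hU0.symm.le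
      refine ⟨P, by simpa only [h20] using hP, hPs, hPi, fun l hl => ?_, by simpa only [hyA] using hPZ⟩
      rcases Nat.lt_succ_iff_lt_or_eq.mp hl with hl | hl
      · exact hPk l hl
      · have : l = ⟨k, hk⟩ := Fin.ext hl
        rw [this]
        exact dotProduct_self_eq_zero.mp hU0.symm
    · obtain ⟨h20, hyA⟩ := hlt hU0
      set U := (P *ᵥ v) ⬝ᵥ (P *ᵥ v) with hUdef
      obtain ⟨h1, h2, h3, h4⟩ := projection_step hPs hPi v rfl hU0.ne' rfl
      refine ⟨P - U⁻¹ • vecMulVec (P *ᵥ v) (P *ᵥ v), fun a b => ?_, h1, h2, fun l hl => ?_, ?_⟩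
      · rw [h20 a b a.2 b.2, hP, hu, hu]
        simp [vecMulVec_apply]
        ring
      · rcases Nat.lt_succ_iff_lt_or_eq.mp hl with hl | hl
        · exact h4 _ (hPk l hl)
        · have : l = ⟨k, hk⟩ := Fin.ext hl
          rw [this]
          exact h3
      · refine solution_step hPs v hPZ rfl ?_
        ext a b
        have hR' : s'.arr rA k b = (v ᵥ* Z) b := by rw [hr']; exact hR ⟨k, hk⟩ b
        have hS : ∑ a ∈ Finset.range n, s'.arr vA k a * s'.arr yA a b =
            (v ᵥ* Matrix.of (fun (a : Fin n) (b : Fin q) => s'.arr yA a b)) b := by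
          rw [Finset.sum_range]
          simp only [hvk]
          rfl
        simp only [Matrix.of_apply, Matrix.add_apply, Matrix.smul_apply, vecMulVec_apply,
          Pi.sub_apply, smul_eq_mul]
        rw [hyA a b a.2 b.2, hu, hR', hS]
        ring

/-- Store the inverse of the matrix in array `0` in array `5`. -/
def invertBasis : Prog := .seq (setId 6) (solve 0 6 5 (reg 0) (reg 0))

lemma den_invertBasis {B : Matrix (Fin n) (Fin n) ℝ} (hB : B.det ≠ 0) (h0 : env 0 = n)
    (hs : ∀ i j : Fin n, s.arr 0 i j = B i j) (i j : Fin n) :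
    (invertBasis.den W n g w env s).arr 5 i j = B⁻¹ i j := by
  rw [invertBasis, Prog.den, den_setId 6 h0]
  refine den_solve_arr (m := n) (q := n) (mE := reg 0) (qE := reg 0) (by decide) (by decide) (by decide) h0 h0 (fun e he => he)
    B⁻¹ (fun l => B l) (fun l a => ?_) (fun l b => ?_) (fun z hz => ?_) i j
  · rw [Core.fill_arr_of_ne (by decide), hs]
  · rw [Core.fill_arr _ _ _ _ ⟨l.2, b.2⟩]
    have : (B l ᵥ* B⁻¹) b = (B * B⁻¹) l b := rfl
    rw [this, mul_nonsing_inv _ (isUnit_iff_ne_zero.mpr hB), Matrix.one_apply]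
    simp [Fin.ext_iff]
  · have : B *ᵥ z = 0 := funext hz
    rw [← inv_mulVec_mulVec hB z, this, mulVec_zero]

/-- `o[i, a] := ∑ b < n, C[a, b] v[i, b]`, with `C` in array `5`. -/
def applyInv (o v : ℕ) (i : NExp) : Prog :=
  .loop 2 (reg 0) (.sumTo o i (reg 2) 3 (reg 0) (.mul (.get 5 (reg 2) (reg 3)) (.get v i (reg 3))))

lemma den_applyInv {o v : ℕ} {i : NExp} {I : ℕ} (h0 : env 0 = n)
    (hi : ∀ e : ℕ → ℕ, (∀ x, x ≠ 2 → x ≠ 3 → e x = env x) → i.ev e = I) (ho : o ≠ 5) (hv : v ≠ o) :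
    (applyInv o v i).den W n g w env s = s.fill o (fun i j => i = I ∧ j < n) fun _ j =>
      ∑ b ∈ Finset.range n, s.arr 5 j b * s.arr v I b := by
  refine Prog.den_loop_row I _ h0 fun j hj => ?_
  have hi2 : ∀ b, i.ev (Function.update (Function.update env 2 j) 3 b) = I := fun b =>
    hi _ fun x h2 h3 => by rw [Function.update_of_ne h3, Function.update_of_ne h2]
  refine Prog.den_sumTo (m := n) _ (fun b => s.arr 5 j b * s.arr v I b)
    (hi _ fun x h2 h3 => by rw [Function.update_of_ne h2]) (by simp [NExp.ev]) hi2
    (by simp [NExp.ev]) (by simp [NExp.ev, h0]) (fun b hb t => ?_) rfl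
  simp [RExp.ev, NExp.ev, Core.fill, hi2, ho.symm, hv]

/-- Turn the target point and a lattice vector into an LWE sample. -/
def sampleProg : Prog :=
  .seq invertBasis (.seq (applyInv 4 3 (num 0)) (.seq
    (.sumTo 7 (num 0) (num 0) 2 (reg 0) (.mul (.get 2 (num 0) (reg 2)) (.get 3 (num 0) (reg 2))))
    (.seq (.gauss 8 (num 0) (num 0)) (.setR 4 (num 0) (reg 0)
      (.add (.div (.get 7 (num 0) (num 0)) (.get 1 (num 0) (num 0)))
        (.mul (.mul (.get 1 (num 0) (num 1)) (.sqrt (.lit (1 / 2)))) (.get 8 (num 0) (num 0))))))))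

/-- The blur has width α/√2, which is also the largest possible width r‖z‖ of the inner product with
the error. Hence the total width never exceeds α, while the blur stays wide enough for the
comparison of laws. -/
lemma sampleProg_spec {m : ℕ} (hm : 0 < m) {B : Matrix (Fin n) (Fin n) ℝ} (hB : B.det ≠ 0) (p' : ℕ) (α r : ℝ)
    (x : E n) (v : Fin m → E n) :
    (∀ j : Fin n, (sampleProg.exec W n g w (initState B p' α r x v)).output j =
        (B⁻¹ *ᵥ (v ⟨0, hm⟩).ofLp) j) ∧
      (sampleProg.exec W n g w (initState B p' α r x v)).output n =
        (x.ofLp ⬝ᵥ (v ⟨0, hm⟩).ofLp) / p' + α * √(1 / 2) * g 0 := by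
  set σ := initState B p' α r x v with hσ
  set env : ℕ → ℕ := fun k => if k = 0 then n else 0 with henv
  have hsc : sampleProg.Scoped {0} := by
    simp [sampleProg, invertBasis, setId, solve, solveStep, applyInv, Prog.sumTo, Prog.Scoped,
      NExp.In, RExp.In]
  have h0 : env 0 = n := by simp [henv]
  have hcore := (Prog.exec_core_eq_den W n g w sampleProg {0} hsc σ env (by simp [hσ, henv, initState])).2
  have hout : (sampleProg.exec W n g w σ).output = (sampleProg.den W n g w env σ.core).arr 4 0 := by
    rw [← hcore]; rfl
  rw [hout]
  set s1 := invertBasis.den W n g w env σ.core with hs1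
  have hfr : ∀ a ∈ ({1, 2, 3} : Finset ℕ), s1.arr a = σ.arr a := by
    intro a ha
    rw [hs1, Prog.den_frame W n g w invertBasis]
    · rfl
    · fin_cases ha <;> decide
  have hcoins : s1.coins = 0 := (Prog.den_counters W n g w invertBasis
    (by simp [invertBasis, setId, solve, solveStep, Prog.sumTo, Prog.Pure]) env σ.core).1
  have hinv : ∀ i j : Fin n, s1.arr 5 i j = B⁻¹ i j :=
    den_invertBasis hB h0 (by simp [State.core, hσ, initState])
  have e7 : ∀ s : Core, (Prog.sumTo 7 (num 0) (num 0) 2 (reg 0)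
      (.mul (.get 2 (num 0) (reg 2)) (.get 3 (num 0) (reg 2)))).den W n g w env s =
      s.fill 7 (fun i j => i = 0 ∧ j = 0) fun _ _ =>
        ∑ b ∈ Finset.range n, s.arr 2 0 b * s.arr 3 0 b := fun s =>
    Prog.den_sumTo (m := n) _ (fun b => s.arr 2 0 b * s.arr 3 0 b) rfl rfl (fun _ => rfl)
      (fun _ => rfl) h0 (fun b hb t => by simp [RExp.ev, NExp.ev, Core.fill]) rfl
  have hden : sampleProg.den W n g w env σ.core =
    (⟨((((s1.fill 4 (fun i j => i = 0 ∧ j < n) fun _ j =>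
      ∑ b ∈ Finset.range n, s1.arr 5 j b * s1.arr 3 0 b).fill 7 (fun i j => i = 0 ∧ j = 0)
      fun _ _ => ∑ b ∈ Finset.range n, s1.arr 2 0 b * s1.arr 3 0 b).fill 8
        (fun i j => i = 0 ∧ j = 0) fun _ _ => g 0).fill 4 (fun i j => i = 0 ∧ j = n) fun _ _ =>
          (∑ b ∈ Finset.range n, s1.arr 2 0 b * s1.arr 3 0 b) / s1.arr 1 0 0 +
            s1.arr 1 0 1 * √(1 / 2) * g 0).arr, 1, s1.calls⟩ : Core) := by
    rw [sampleProg, Prog.den, ← hs1, Prog.den, den_applyInv h0 (fun e _ => rfl) (by decide) (by decide),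
      Prog.den, e7,
      Prog.den, Prog.den, Prog.den]
    simp only [NExp.ev, RExp.ev, h0]
    simp [Core.fill, hcoins]
  rw [hden]
  have hm0 : (0 : ℕ) < m := hm
  constructor
  · intro j
    simp only
    rw [Core.fill_arr_of_not _ _ _ _ (fun h => j.2.ne h.2), Core.fill_arr_of_ne (by decide),
      Core.fill_arr_of_ne (by decide), Core.fill_arr _ _ _ _ ⟨rfl, j.2⟩, Finset.sum_range]
    simp only [hinv, hfr 3 (by decide)]
    refine Finset.sum_congr rfl fun b _ => ?_
    simp [hσ, initState, hm]
  · simp only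
    rw [Core.fill_arr _ _ _ _ ⟨rfl, rfl⟩, hfr 1 (by decide), hfr 2 (by decide), hfr 3 (by decide),
      Finset.sum_range]
    have h1 : σ.arr 1 0 0 = p' := by simp [hσ, initState]
    have h2 : σ.arr 1 0 1 = α := by simp [hσ, initState]
    rw [h1, h2]
    congr 2
    refine Finset.sum_congr rfl fun b _ => ?_
    simp [hσ, initState, hm]

end LWERed

namespace LWERed

open Matrix

/-! ### Marginals of product measures -/

lemma measurePreserving_pi_comp {ι κ X : Type*} [Fintype ι] [Fintype κ] [MeasurableSpace X]
    (μ : Measure X) [IsProbabilityMeasure μ] {f : κ → ι} (hf : f.Injective) :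
    MeasurePreserving (fun (x : ι → X) k => x (f k)) (Measure.pi fun _ => μ)
      (Measure.pi fun _ => μ) := by
  have h1 : iIndepFun (fun (i : ι) (x : ι → X) => x i) (Measure.pi fun _ => μ) :=
    iIndepFun_pi (X := fun _ x => x) fun _ => aemeasurable_id
  have h2 := h1.precomp hf
  rw [iIndepFun_iff_map_fun_eq_pi_map fun k => (measurable_pi_apply (f k)).aemeasurable] at h2
  refine ⟨by fun_prop, h2.trans ?_⟩
  congr 1
  funext k
  exact (measurePreserving_eval (fun _ : ι => μ) (f k)).map_eq

lemma measurePreserving_infinitePi_comp {κ X : Type*} [Fintype κ] [MeasurableSpace X]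
    (μ : Measure X) [IsProbabilityMeasure μ] {f : κ → ℕ} (hf : f.Injective) :
    MeasurePreserving (fun (x : ℕ → X) k => x (f k)) (Measure.infinitePi fun _ => μ)
      (Measure.pi fun _ => μ) := by
  have h1 : iIndepFun (fun (i : ℕ) (x : ℕ → X) => x i) (Measure.infinitePi fun _ => μ) :=
    iIndepFun_infinitePi (X := fun _ x => x) fun _ => measurable_id
  have h2 := h1.precomp hf
  rw [iIndepFun_iff_map_fun_eq_pi_map fun k => (measurable_pi_apply (f k)).aemeasurable] at h2
  refine ⟨by fun_prop, h2.trans ?_⟩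
  congr 1
  funext k
  exact Measure.infinitePi_map_eval (fun _ => μ) (f k)

/-- Isolates what one oracle call sees: lattice samples paired with the first m Gaussian samples,
and one independent piece of oracle randomness. -/
lemma measurePreserving_runLaw {n : ℕ} {Ω : Type*} [MeasurableSpace Ω] (P : Measure Ω)
    [IsProbabilityMeasure P] (L : Submodule ℤ (E n)) (r : ℝ)
    [IsProbabilityMeasure (discreteGaussian L r)] (m j : ℕ) :
    MeasurePreserving (fun q : (Fin m → E n) × (ℕ → ℝ) × (ℕ → Ω) =>
        ((fun l : Fin m => (q.1 l, q.2.1 l)), q.2.2 j)) (runLaw L r m P)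
      ((Measure.pi fun _ : Fin m => (discreteGaussian L r).prod (nu 1)).prod P) := by
  have h1 : MeasurePreserving (fun q : (ℕ → ℝ) × (ℕ → Ω) => ((fun l : Fin m => q.1 l), q.2 j))
      ((Measure.infinitePi fun _ : ℕ => nu 1).prod (Measure.infinitePi fun _ : ℕ => P))
      ((Measure.pi fun _ : Fin m => nu 1).prod P) :=
    (measurePreserving_infinitePi_comp (nu 1) Fin.val_injective).prod
      (measurePreserving_eval_infinitePi (fun _ : ℕ => P) j)
  have h2 := (MeasurePreserving.id (Measure.pi fun _ : Fin m => discreteGaussian L r)).prod h1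
  have h3 := (measurePreserving_prodAssoc (Measure.pi fun _ : Fin m => discreteGaussian L r)
    (Measure.pi fun _ : Fin m => nu 1) P).symm
  have h4 := (measurePreserving_arrowProdEquivProdArrow (E n) ℝ (Fin m)
    (fun _ => discreteGaussian L r) (fun _ => nu 1)).symm
  exact (h4.prod (MeasurePreserving.id P)).comp (h3.comp h2)

/-! ### LWE samples from lattice vectors -/

/-- The LWE sample with secret `s` built from `a` and the noise `t`. -/
def lweMap {n p : ℕ} (s : Fin n → ZMod p) (q : (Fin n → ZMod p) × ℝ) : Sample n p :=
  (q.1, ((((∑ i, q.1 i * s i : ZMod p).val : ℝ) / (p : ℝ) : ℝ) : UnitAddCircle) +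
    ((q.2 : ℝ) : UnitAddCircle))

lemma measurable_lweMap {n p : ℕ} [NeZero p] (s : Fin n → ZMod p) : Measurable (lweMap s) := by
  refine measurable_fst.prodMk (Measurable.fun_add ?_ ?_)
  · exact (Measurable.of_discrete (f := fun a : Fin n → ZMod p =>
      ((((∑ i, a i * s i : ZMod p).val : ℝ) / (p : ℝ) : ℝ) : UnitAddCircle))).comp measurable_fst
  · exact (AddCircle.measurable_mk' (a := (1 : ℝ))).comp measurable_snd

instance isProbabilityMeasure_uniformOn_univ {n p : ℕ} [NeZero p] :
    IsProbabilityMeasure (uniformOn (Set.univ : Set (Fin n → ZMod p))) :=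
  isProbabilityMeasure_uniformOn Set.finite_univ Set.univ_nonempty

lemma lweDist_Psi {n p : ℕ} [NeZero p] (s : Fin n → ZMod p) (β : ℝ) :
    lweDist s (Psi β) = ((uniformOn (Set.univ : Set (Fin n → ZMod p))).prod (nu β)).map (lweMap s) := by
  have hmk : Measurable fun t : ℝ => (t : UnitAddCircle) := AddCircle.measurable_mk'
  have h := Measure.map_prod_map (uniformOn (Set.univ : Set (Fin n → ZMod p))) (nu β)
    measurable_id hmk
  rw [Measure.map_id] at h
  rw [lweDist, Psi, h, Measure.map_map _ (measurable_id.prodMap hmk)]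
  · rfl
  · refine measurable_fst.prodMk (Measurable.fun_add ?_ measurable_snd)
    exact (Measurable.of_discrete (f := fun a : Fin n → ZMod p =>
      ((((∑ i, a i * s i : ZMod p).val : ℝ) / (p : ℝ) : ℝ) : UnitAddCircle))).comp measurable_fst

lemma coe_val_div {p : ℕ} [NeZero p] (M : ℤ) :
    ((((M : ZMod p).val : ℝ) / (p : ℝ) : ℝ) : UnitAddCircle) = (((M : ℝ) / p : ℝ) : UnitAddCircle) := by
  have hp : (p : ℝ) ≠ 0 := by exact_mod_cast NeZero.ne p
  have h1 : (((M : ZMod p).val : ℤ) : ℝ) = ((M % p : ℤ) : ℝ) := by rw [ZMod.val_intCast]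
  have h2 : ((M : ℝ)) = ((M % p : ℤ) : ℝ) + p * ((M / p : ℤ) : ℝ) := by
    exact_mod_cast (Int.emod_add_mul_ediv M p).symm
  rw [Int.cast_natCast] at h1
  rw [h1, h2, add_div, mul_div_cancel_left₀ _ hp, AddCircle.coe_add]
  have h3 : ((((M / p : ℤ) : ℝ)) : UnitAddCircle) = 0 :=
    (AddCircle.coe_eq_zero_iff (1 : ℝ)).mpr ⟨M / p, by simp⟩
  rw [h3, add_zero]

/-- The coordinates of a lattice vector, and its blurred inner product with a target point, are an
LWE sample whose noise comes from the error of the target point. -/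
lemma decode_eq_lweMap {n p : ℕ} [NeZero p] {B : Matrix (Fin n) (Fin n) ℝ} (hB : B.det ≠ 0)
    (c k : Fin n → ℤ) (u : Fin n → ℝ) (σ t : ℝ) {row : ℕ → ℝ}
    (h1 : ∀ j : Fin n, row j = c j) (h2 : row n = (u ⬝ᵥ fun j => (c j : ℝ)) / p + σ * t) :
    decode n p row = lweMap (fun i => (k i : ZMod p))
      (jointMap B p ((p : ℝ)⁻¹ • (B⁻¹ᵀ *ᵥ (u - fun j => (k j : ℝ)))) σ (latVec B c, t)) := by
  refine Prod.ext ?_ ?_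
  · simp only [decode, lweMap, jointMap, h1, Int.floor_intCast, coordMod_latVec hB]
  · simp only [decode, lweMap, jointMap, coordMod_latVec hB]
    have h3 : (∑ i, (c i : ZMod p) * (k i : ZMod p)) = ((∑ i, c i * k i : ℤ) : ZMod p) := by
      push_cast; rfl
    -- ⟨u,c⟩/p splits into ⟨k,c⟩/p, which modulo 1 depends only on residues modulo p, and ⟨u -
    -- k,c⟩/p, which is the inner product of the lattice vector with z.
    rw [h3, coe_val_div, ← AddCircle.coe_add, h2, latVec, smul_dotProduct,
      inv_transpose_mulVec_dot hB, sub_dotProduct]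
    congr 1
    have h4 : ((∑ i, c i * k i : ℤ) : ℝ) = (fun j => (k j : ℝ)) ⬝ᵥ fun j => (c j : ℝ) := by
      push_cast
      exact Finset.sum_congr rfl fun i _ => mul_comm _ _
    rw [h4, smul_eq_mul]
    ring

lemma countable_lattice {n : ℕ} {B : Matrix (Fin n) (Fin n) ℝ} (hB : B.det ≠ 0) :
    Countable (lattice B) := (latticeEquiv hB).symm.injective.countable

lemma pos_of_mul_smoothing_lt {n : ℕ} {L : Submodule ℤ (E n)} {ε a r : ℝ} (ha : 0 ≤ a)
    (h : a * smoothing L ε < r) : 0 < r :=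
  (mul_nonneg ha (Real.sInf_nonneg fun _ hs => hs.1.le)).trans_lt h

/-- The comparison of laws above the smoothing parameter. -/
theorem jointLaw_le_of_smoothing {n : ℕ} {B : Matrix (Fin n) (Fin n) ℝ} (hB : B.det ≠ 0) {p q : ℕ}
    [NeZero q] (hqp : q ≤ p) {r σ ε : ℝ} (hε : 0 < ε) (hε1 : ε < 1)
    (h : √2 * p * smoothing (lattice B) ε < r) (hσ : 0 < σ) {z : Fin n → ℝ}
    (hz : r ^ 2 * (z ⬝ᵥ z) ≤ σ ^ 2) :
    ((discreteGaussian (lattice B) r).prod (nu 1)).map (jointMap B q z σ) ≤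
        ENNReal.ofReal ((1 + ε) / (1 - ε)) • (uniformOn (Set.univ : Set (Fin n → ZMod q))).prod
          (nu √(σ ^ 2 + r ^ 2 * (z ⬝ᵥ z))) ∧
      (uniformOn (Set.univ : Set (Fin n → ZMod q))).prod (nu √(σ ^ 2 + r ^ 2 * (z ⬝ᵥ z))) ≤
        ENNReal.ofReal ((1 + ε) / (1 - ε)) •
          ((discreteGaussian (lattice B) r).prod (nu 1)).map (jointMap B q z σ) := by
  have hp : (0 : ℝ) < p := by exact_mod_cast (NeZero.pos q).trans_le hqp
  have hr : 0 < r := pos_of_mul_smoothing_lt (by positivity) h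
  obtain ⟨s, hs, hsr, hsε⟩ := exists_lt_of_mul_smoothing_lt hB hε (by positivity) h
  refine jointLaw_le hB hr hσ hs hε1 hsε ?_
  -- The largest eigenvalue of the form is now at most 2/r²; this 2 is what the factor √2 in the
  -- hypothesis on r pays for. Any modulus q ≤ p is admitted so that q = 2 can be used for the
  -- spanning argument.
  have h1 : (z ⬝ᵥ z) / σ ^ 2 ≤ 1 / r ^ 2 := by
    rw [div_le_div_iff₀ (by positivity) (by positivity)]
    linarith
  have h2 : (q * s : ℝ) ^ 2 ≤ (p * s) ^ 2 := by
    have : (q : ℝ) ≤ p := by exact_mod_cast hqp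
    gcongr
  have h3 : 2 * (p * s) ^ 2 ≤ r ^ 2 := by
    have : (√2 * p * s) ^ 2 ≤ r ^ 2 := by gcongr
    calc 2 * (p * s) ^ 2 = (√2 * p * s) ^ 2 := by
          rw [mul_assoc, mul_pow (√2), Real.sq_sqrt (by norm_num)]
      _ ≤ _ := this
  calc (q * s : ℝ) ^ 2 * (1 / r ^ 2 + (z ⬝ᵥ z) / σ ^ 2)
      ≤ (p * s) ^ 2 * (1 / r ^ 2 + 1 / r ^ 2) := by
        have := dot_self_nonneg z
        gcongr
    _ = (2 * (p * s) ^ 2) / r ^ 2 := by ring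
    _ ≤ 1 := (div_le_one (by positivity)).mpr h3

/-- From μ ≤ Cν the difference is at most (C - 1)ν(S) ≤ C - 1; the other sign is symmetric. -/
lemma abs_real_sub_le_of_le_smul {X : Type*} [MeasurableSpace X] {μ ν : Measure X}
    [IsProbabilityMeasure μ] [IsProbabilityMeasure ν] {C : ℝ} (hC : 1 ≤ C)
    (h1 : μ ≤ ENNReal.ofReal C • ν) (h2 : ν ≤ ENNReal.ofReal C • μ) (S : Set X) :
    |μ.real S - ν.real S| ≤ C - 1 := by
  have key : ∀ {μ ν : Measure X} [IsProbabilityMeasure μ] [IsProbabilityMeasure ν],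
      μ ≤ ENNReal.ofReal C • ν → μ.real S - ν.real S ≤ C - 1 := by
    intro μ ν _ _ h
    have h3 : μ.real S ≤ C * ν.real S := by
      have := ENNReal.toReal_mono (ENNReal.mul_ne_top ENNReal.ofReal_ne_top (measure_ne_top ν S)) (h S)
      rwa [ENNReal.toReal_mul, ENNReal.toReal_ofReal (by linarith)]
        at this
    have h4 : ν.real S ≤ 1 := measureReal_le_one
    nlinarith
  exact abs_sub_le_iff.mpr ⟨key h1, key h2⟩

lemma IsClosest.dist_eq {n : ℕ} {L : Submodule ℤ (E n)} {x y : E n} (h : IsClosest L x y) :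
    dist x y = Metric.infDist x (L : Set (E n)) :=
  le_antisymm ((Metric.le_infDist ⟨y, h.1⟩).mpr fun z hz => h.2 z hz)
    (Metric.infDist_le_dist_of_mem h.1)

end LWERed

/-! ### The sample program: running time and distance from the LWE distribution -/

namespace LWERed

open Matrix

section time

variable {p N : ℕ → ℕ} {Ω : Type*} [MeasurableSpace Ω] {W : Oracle p N Ω} {b : Prop}

lemma Prog.polyTimed_setId {a : ℕ} (ha : b → a ≠ 10) : (setId a).PolyTimed W b :=
  (((Prog.polyTimed_setR ha (by simp [RExp.FloorFree])).loop (by decide) (by simp [NExp.In])).loop (by decide)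
    (by simp [NExp.In]))

lemma Prog.polyTimed_solve {vA rA yA : ℕ} {mE qE : NExp} (hm : mE.In {0}) (hq : qE.In {0})
    (hy : b → yA ≠ 10) : (solve vA rA yA mE qE).PolyTimed W b := by
  have h0 : (reg 0).In {0} := by simp [NExp.In]
  refine (polyTimed_setId fun _ => by decide).seq ((((polyTimed_setR hy (by simp [RExp.FloorFree])).loop (by decide)
    hq).loop (by decide) h0).seq (PolyTimed.loop ?_ (by decide) hm))
  refine ((polyTimed_sumTo (fun _ => by decide) (by decide) h0 ?_).loop (by decide) h0).seq
    ((polyTimed_sumTo (fun _ => by decide) (by decide) h0 ?_).seq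
    (PolyTimed.ifLe polyTimed_skip (PolyTimed.seq ?_ (PolyTimed.seq ?_ ?_)) trivial trivial))
  · simp [RExp.FloorFree]
  · simp [RExp.FloorFree]
  · exact (polyTimed_sumTo (fun _ => by decide) (by decide) h0 (by simp [RExp.FloorFree])).loop
      (by decide) hq
  · exact ((polyTimed_setR hy (by simp [RExp.FloorFree])).loop (by decide) hq).loop (by decide) h0
  · exact ((polyTimed_setR (fun _ => by decide) (by simp [RExp.FloorFree])).loop (by decide)
      h0).loop (by decide) h0

lemma Prog.polyTimed_invertBasis : (invertBasis).PolyTimed W b :=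
  (polyTimed_setId fun _ => by decide).seq
    (polyTimed_solve (by simp [NExp.In]) (by simp [NExp.In]) fun _ => by decide)

lemma Prog.polyTimed_applyInv {o v : ℕ} {i : NExp} (ho : b → o ≠ 10) :
    (applyInv o v i).PolyTimed W b := by
  have h0 : (reg 0).In {0} := by simp [NExp.In]
  exact (polyTimed_sumTo ho (by decide) h0 (by simp [RExp.FloorFree])).loop (by decide) h0

lemma Prog.PolyTimed.polyTime {c : Prog} (hc : c.PolyTimed W False) (α : ℕ → ℝ) (m : ℕ → ℕ) :
    c.PolyTime W α m := by
  obtain ⟨f, ⟨K, hK⟩, hf⟩ := hc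
  refine ⟨K, fun n B _ r _ x v g w => ?_⟩
  obtain ⟨-, -, h⟩ := hf n g w 0 (initState B (p n) (α n) r x v) rfl (fun h => h.elim)
  refine h.trans ?_
  have h1 : n + bits 0 + 1 ≤ inputSize B (p n) (α n) r x v + 1 := by
    have : bits 0 = 0 := by simp [bits]
    rw [this, inputSize]
    omega
  have h2 : (initState B (p n) (α n) r x v).time = 0 := rfl
  rw [h2, zero_add]
  exact (hK _).trans (Nat.mul_le_mul_left K (Nat.pow_le_pow_left h1 K))

lemma Prog.polyTimed_sampleProg : sampleProg.PolyTimed W False := by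
  have h0 : (reg 0).In {0} := by simp [NExp.In]
  exact polyTimed_invertBasis.seq ((polyTimed_applyInv False.elim).seq
    ((polyTimed_sumTo False.elim (by decide) h0 (by simp [RExp.FloorFree])).seq
    ((polyTimed_gauss False.elim).seq (polyTimed_setR False.elim (by simp [RExp.FloorFree])))))

lemma oracleFree_sampleProg : sampleProg.OracleFree := by
  simp [sampleProg, invertBasis, applyInv, solve, setId, solveStep, Prog.sumTo, Prog.OracleFree]

end time

/-- The distribution of the LWE sample computed from a target point and a lattice vector. -/
theorem sampleProg_close {p N : ℕ → ℕ} {Ω : Type*} [MeasurableSpace Ω] (W : Oracle p N Ω)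
    (P : Measure Ω) [IsProbabilityMeasure P] {n : ℕ} (hp : 2 ≤ p n) {ε α r : ℝ} (hε : 0 < ε)
    (hα : 0 < α) {B : Matrix (Fin n) (Fin n) ℝ} (hB : B.det ≠ 0)
    (hr : √2 * p n * smoothing (lattice B) ε < r) {x : E n}
    (hx : Metric.infDist x (dualLattice (lattice B) : Set (E n)) ≤ α * p n / (√2 * r))
    {k : Fin n → ℤ} (hk : IsClosest (dualLattice (lattice B)) x (latVec B⁻¹ᵀ k)) :
    ∃ β : ℝ, 0 < β ∧ β ≤ α ∧ ∀ S : Set (Sample n (p n)), MeasurableSet S →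
      |(runLaw (lattice B) r 1 P).real {q | decode n (p n) (sampleProg.exec W n q.2.1 q.2.2
          (initState B (p n) α r x q.1)).output ∈ S}
        - (lweDist (fun i => (k i : ZMod (p n))) (Psi β)).real S| ≤ 3 * ε := by
  have : NeZero (p n) := ⟨by omega⟩
  have hr0 : 0 < r := pos_of_mul_smoothing_lt (by positivity) hr
  have hp0 : (0 : ℝ) < p n := by exact_mod_cast NeZero.pos (p n)
  have := isProbabilityMeasure_discreteGaussian hB hr0
  have hrun : IsProbabilityMeasure (runLaw (lattice B) r 1 P) := by
    unfold runLaw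
    infer_instance
  have hlwe : ∀ β, IsProbabilityMeasure (lweDist (fun i => (k i : ZMod (p n))) (Psi β)) := by
    intro β
    rw [lweDist_Psi]
    exact Measure.isProbabilityMeasure_map (measurable_lweMap _).aemeasurable
  -- For ε ≥ 1/3 the claimed distance 3ε is at least 1 and any β will do. This covers the finitely
  -- many dimensions in which ε(n) need not be small.
  rcases le_or_gt (1 / 3) ε with hε3 | hε3
  · refine ⟨α, hα, le_rfl, fun S _ => ?_⟩
    have h1 : (runLaw (lattice B) r 1 P).real {q | decode n (p n) (sampleProg.exec W n q.2.1 q.2.2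
      (initState B (p n) α r x q.1)).output ∈ S} ≤ 1 := measureReal_le_one
    have h2 : (lweDist (fun i => (k i : ZMod (p n))) (Psi α)).real S ≤ 1 := by
      have := hlwe α
      exact measureReal_le_one
    rw [abs_le]
    constructor <;> linarith [measureReal_nonneg (μ := lweDist (fun i => (k i : ZMod (p n))) (Psi α))
      (s := S), measureReal_nonneg (μ := runLaw (lattice B) r 1 P) (s := {q | decode n (p n)
        (sampleProg.exec W n q.2.1 q.2.2 (initState B (p n) α r x q.1)).output ∈ S})]
  set u : Fin n → ℝ := Bᵀ *ᵥ x.ofLp with hu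
  set z : Fin n → ℝ := (p n : ℝ)⁻¹ • (B⁻¹ᵀ *ᵥ (u - fun j => (k j : ℝ))) with hz
  set σ : ℝ := α * √(1 / 2) with hσ
  have hσ0 : 0 < σ := by positivity
  have hσ2 : σ ^ 2 = α ^ 2 / 2 := by
    rw [hσ, mul_pow, Real.sq_sqrt (by norm_num)]
    ring
  have hzx : z = (p n : ℝ)⁻¹ • (x - latVec B⁻¹ᵀ k).ofLp := by
    rw [hz, mulVec_sub, hu, mulVec_mulVec, ← transpose_mul, mul_nonsing_inv _
      (isUnit_iff_ne_zero.mpr hB), transpose_one, one_mulVec]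
    rfl
  have hzz : r ^ 2 * (z ⬝ᵥ z) ≤ σ ^ 2 := by
    have h1 : ‖x - latVec B⁻¹ᵀ k‖ ≤ α * p n / (√2 * r) := by
      rw [← dist_eq_norm, hk.dist_eq]
      exact hx
    have h2 : z ⬝ᵥ z = ((p n : ℝ)⁻¹) ^ 2 * ‖x - latVec B⁻¹ᵀ k‖ ^ 2 := by
      rw [norm_sq_eq_dot, hzx, smul_dotProduct, dotProduct_smul, smul_eq_mul, smul_eq_mul]
      ring
    calc r ^ 2 * (z ⬝ᵥ z) ≤ r ^ 2 * (((p n : ℝ)⁻¹) ^ 2 * (α * p n / (√2 * r)) ^ 2) := by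
          rw [h2]; gcongr
      _ = σ ^ 2 := by
          rw [hσ2, div_pow, mul_pow √2, Real.sq_sqrt (by norm_num)]
          field_simp
  set β := √(σ ^ 2 + r ^ 2 * (z ⬝ᵥ z)) with hβ
  have hzz0 := dot_self_nonneg z
  refine ⟨β, Real.sqrt_pos.mpr (by positivity), ?_, fun S hS => ?_⟩
  -- β² is at most α²/2 from the blur plus α²/2 from the inner product.
  · rw [hβ, Real.sqrt_le_left hα.le]
    linarith
  obtain ⟨hle1, hle2⟩ := jointLaw_le_of_smoothing hB le_rfl hε (by linarith) hr hσ0 hzz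
  have hjm := measurable_jointMap B (p n) z σ
  have hpj : IsProbabilityMeasure (((discreteGaussian (lattice B) r).prod (nu 1)).map
    (jointMap B (p n) z σ)) := Measure.isProbabilityMeasure_map hjm.aemeasurable
  set lm := lweMap (n := n) (p := p n) fun i => (k i : ZMod (p n)) with hlm
  have hlmm : Measurable lm := measurable_lweMap _
  have hC : 1 ≤ (1 + ε) / (1 - ε) := by
    rw [le_div_iff₀ (by linarith)]
    linarith
  have hdist := abs_real_sub_le_of_le_smul hC hle1 hle2 (lm ⁻¹' S)
  -- The left side is 2ε/(1 - ε), which is at most 3ε because ε < 1/3.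
  have h1 : (1 + ε) / (1 - ε) - 1 ≤ 3 * ε := by
    rw [sub_le_iff_le_add, div_le_iff₀ (by linarith)]
    nlinarith
  refine le_trans (le_of_eq ?_) (hdist.trans h1)
  congr 2
  · have hcount := countable_lattice hB
    have hmp : MeasurePreserving (fun q : (Fin 1 → E n) × (ℕ → ℝ) × (ℕ → Ω) => (q.1 0, q.2.1 0))
        (runLaw (lattice B) r 1 P) ((discreteGaussian (lattice B) r).prod (nu 1)) :=
      (measurePreserving_eval (fun _ : Fin 1 => (discreteGaussian (lattice B) r).prod (nu 1)) 0).comp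
        (measurePreserving_fst.comp (measurePreserving_runLaw P (lattice B) r 1 0))
    rw [map_measureReal_apply hjm (hlmm hS), ← hmp.measureReal_preimage
      (hjm (hlmm hS)).nullMeasurableSet]
    have hae : ∀ᵐ q ∂(runLaw (lattice B) r 1 P), q.1 0 ∈ lattice B := by
      have h := (measurePreserving_fst.comp hmp).quasiMeasurePreserving.ae
        (ae_mem_discreteGaussian (lattice B) r)
      exact h
    refine measureReal_congr ?_
    filter_upwards [hae] with q hq
    obtain ⟨c, hc⟩ := (mem_lattice_iff B _).mp hq
    obtain ⟨hs1, hs2⟩ := sampleProg_spec (W := W) (g := q.2.1) (w := q.2.2) one_pos hB (p n) α r x q.1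
    have hco : B⁻¹ *ᵥ (q.1 0).ofLp = fun j => (c j : ℝ) := by
      rw [← hc]
      exact inv_mulVec_mulVec hB _
    have hd := decode_eq_lweMap (p := p n) hB c k u σ (q.2.1 0) (row := (sampleProg.exec W n q.2.1 q.2.2
      (initState B (p n) α r x q.1)).output) (fun j => by rw [hs1 j]; exact congrFun hco j) (by
        rw [hs2]
        congr 2
        rw [← hco, hu]
        exact (dot_inv_mulVec hB _ _).symm)
    rw [hc] at hd
    change (_ ∈ S) = (_ ∈ S)
    rw [hd]
  · rw [lweDist_Psi, map_measureReal_apply hlmm hS]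

end LWERed

namespace LWERed

open Matrix

/-! ### The program for the closest vector problem -/

section program

/-- Add the squares of the entries of the array `a` to entry `(0, 0)` of array `10`. -/
def addSquares (a : ℕ) (mE qE : NExp) : Prog :=
  .loop 2 mE (.loop 3 qE (.setR 10 (num 0) (num 0) (.add (.get 10 (num 0) (num 0))
    (.mul (.get a (reg 2) (reg 3)) (.get a (reg 2) (reg 3))))))

/-- Invert the basis; compute the coordinates of the target point (array `7`) and of the samples
(array `8`), the noise (array `9`), and a bound on the numbers that will be rounded. -/
def cvpSetup (mE : NExp) : Prog :=
  .seq invertBasis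
  (.seq (.loop 2 (reg 0) (.sumTo 7 (num 0) (reg 2) 3 (reg 0)
    (.mul (.get 0 (reg 3) (reg 2)) (.get 2 (num 0) (reg 3)))))
  (.seq (.loop 4 mE (applyInv 8 3 (reg 4)))
  (.seq (.loop 4 mE (.gauss 9 (num 0) (reg 4)))
  (.seq (.setR 10 (num 0) (num 0) (.ofNat (.add (num 1) (reg 0))))
  (.seq (addSquares 0 (reg 0) (reg 0)) (.seq (addSquares 5 (reg 0) (reg 0))
  (.seq (addSquares 7 (num 1) (reg 0)) (.seq (addSquares 8 mE (reg 0))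
  (.setR 10 (num 0) (num 0) (.mul (.lit 4) (.mul (.get 10 (num 0) (num 0))
    (.get 10 (num 0) (num 0)))))))))))))

/-- Initialize the current target (array `11`), the current power of the modulus (array `12`), and
the residue found so far (array `13`). -/
def cvpInit : Prog :=
  .seq (.loop 2 (reg 0) (.setR 11 (num 0) (reg 2) (.get 7 (num 0) (reg 2))))
  (.seq (.setR 12 (num 0) (num 0) (.lit 1)) (.loop 2 (reg 0) (.setR 13 (num 0) (reg 2) (.lit 0))))

/-- Build LWE samples in array `14`, call the oracle, and divide the target by the modulus. -/
def cvpRound (mE : NExp) : Prog :=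
  .seq (.loop 1 mE (.loop 2 (reg 0) (.setR 14 (reg 1) (reg 2) (.get 8 (reg 1) (reg 2)))))
  (.seq (.loop 1 mE (.seq (.sumTo 14 (reg 1) (reg 0) 2 (reg 0)
      (.mul (.get 11 (num 0) (reg 2)) (.get 8 (reg 1) (reg 2))))
    (.setR 14 (reg 1) (reg 0) (.add (.div (.get 14 (reg 1) (reg 0)) (.get 1 (num 0) (num 0)))
      (.mul (.sqrt (.sub (.mul (.get 1 (num 0) (num 1)) (.get 1 (num 0) (num 1)))
        (.div (.mul (.ofNat (.add (reg 4) (num 1)))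
          (.mul (.get 1 (num 0) (num 1)) (.get 1 (num 0) (num 1))))
          (.mul (.ofNat (.mul (num 2) mE)) (.mul (.get 12 (num 0) (num 0)) (.get 12 (num 0) (num 0)))))))
        (.get 9 (num 0) (reg 1)))))))
  (.seq (.call 14 15)
  (.seq (.loop 2 (reg 0) (.setR 13 (num 0) (reg 2) (.add (.get 13 (num 0) (reg 2))
    (.mul (.get 12 (num 0) (num 0)) (.get 15 (num 0) (reg 2))))))
  (.seq (.loop 2 (reg 0) (.setR 11 (num 0) (reg 2) (.div (.sub (.get 11 (num 0) (reg 2))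
    (.get 15 (num 0) (reg 2))) (.get 1 (num 0) (num 0)))))
  (.setR 12 (num 0) (num 0) (.mul (.get 12 (num 0) (num 0)) (.get 1 (num 0) (num 0))))))))

/-- Round the inner products of the current target with the samples, recover a candidate for the
closest dual lattice point (array `19`), and output it if it is close enough. -/
def cvpFinish (mE : NExp) : Prog :=
  .seq (.loop 1 mE (.seq (.sumTo 16 (reg 1) (num 0) 2 (reg 0)
      (.mul (.get 11 (num 0) (reg 2)) (.get 8 (reg 1) (reg 2))))
    (.guardedFloor 16 (reg 1) (num 0) (.add (.get 16 (reg 1) (num 0)) (.lit (1 / 2))))))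
  (.seq (solve 8 16 17 mE (num 1))
  (.seq (.loop 2 (reg 0) (.guardedFloor 18 (num 0) (reg 2) (.add (.add (.get 13 (num 0) (reg 2))
    (.mul (.get 12 (num 0) (num 0)) (.get 17 (reg 2) (num 0)))) (.lit (1 / 2)))))
  (.seq (.loop 2 (reg 0) (.sumTo 19 (num 0) (reg 2) 3 (reg 0)
    (.mul (.get 5 (reg 3) (reg 2)) (.get 18 (num 0) (reg 3)))))
  (.seq (.sumTo 24 (num 0) (num 0) 2 (reg 0)
    (.mul (.sub (.get 2 (num 0) (reg 2)) (.get 19 (num 0) (reg 2)))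
      (.sub (.get 2 (num 0) (reg 2)) (.get 19 (num 0) (reg 2)))))
  (.ifLe (.mul (.get 24 (num 0) (num 0))
      (.mul (.lit 2) (.mul (.get 1 (num 0) (num 2)) (.get 1 (num 0) (num 2)))))
    (.mul (.mul (.get 1 (num 0) (num 1)) (.get 1 (num 0) (num 1)))
      (.mul (.get 1 (num 0) (num 0)) (.get 1 (num 0) (num 0))))
    (.loop 2 (reg 0) (.setR 4 (num 0) (reg 2) (.get 19 (num 0) (reg 2)))) .skip)))))

/-- One attempt to find the closest point, with a guess of its distance given by register `4`. -/
def cvpTrial (mE : NExp) : Prog :=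
  .seq cvpInit (.seq (.loop 5 (reg 0) (cvpRound mE)) (cvpFinish mE))

/-- Solve the closest vector problem on the dual lattice. -/
def cvpProg (mE : NExp) : Prog := .seq (cvpSetup mE) (.loop 4 mE (cvpTrial mE))

end program

variable {p N : ℕ → ℕ} {Ω : Type*} [MeasurableSpace Ω] {W : Oracle p N Ω} {n : ℕ} {g : ℕ → ℝ}
  {w : ℕ → Ω} {env : ℕ → ℕ} {s : Core}

lemma den_addSquares {a : ℕ} {mE qE : NExp} {m q : ℕ} (ha : a ≠ 10)
    (hm : mE.ev env = m) (hq : ∀ k, qE.ev (Function.update env 2 k) = q) :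
    (addSquares a mE qE).den W n g w env s = s.fill 10 (fun i j => i = 0 ∧ j = 0) fun _ _ =>
      s.arr 10 0 0 + ∑ i ∈ Finset.range m, ∑ j ∈ Finset.range q, s.arr a i j * s.arr a i j := by
  have hself : ∀ (s : Core) (t : ℝ), t = s.arr 10 0 0 →
      s.fill 10 (fun i j => i = 0 ∧ j = 0) (fun _ _ => t) = s := by
    rintro s t rfl
    cases s
    simp only [Core.fill, Core.mk.injEq, and_self, and_true]
    funext a' i j
    split_ifs with h
    · obtain ⟨rfl, rfl, rfl⟩ := h
      rfl
    · rfl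
  have hff : ∀ (s : Core) (t t' : ℝ), (s.fill 10 (fun i j => i = 0 ∧ j = 0) fun _ _ => t).fill 10
      (fun i j => i = 0 ∧ j = 0) (fun _ _ => t') = s.fill 10 (fun i j => i = 0 ∧ j = 0) fun _ _ => t' := by
    intro s t t'
    simp only [Core.fill]
    congr 1
    funext a' i j
    by_cases h : a' = 10 ∧ i = 0 ∧ j = 0 <;> simp [h]
  refine Prog.den_loop_induct W n g w hm (fun k s' => s' = s.fill 10 (fun i j => i = 0 ∧ j = 0)
    fun _ _ => s.arr 10 0 0 + ∑ i ∈ Finset.range k, ∑ j ∈ Finset.range q, s.arr a i j * s.arr a i j)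
    (by rw [hself s _ (by simp)]) ?_
  rintro k - s' rfl
  refine Prog.den_loop_induct W n g w (hq k) (fun l s' => s' = s.fill 10 (fun i j => i = 0 ∧ j = 0)
    fun _ _ => s.arr 10 0 0 + ∑ i ∈ Finset.range k, ∑ j ∈ Finset.range q, s.arr a i j * s.arr a i j +
      ∑ j ∈ Finset.range l, s.arr a k j * s.arr a k j) (by simp) ?_ |>.trans ?_
  · rintro l - s' rfl
    rw [Prog.den_setR (fun _ _ => s.arr 10 0 0 + ∑ i ∈ Finset.range k, ∑ j ∈ Finset.range q,
      s.arr a i j * s.arr a i j + ∑ j ∈ Finset.range (l + 1), s.arr a k j * s.arr a k j)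
      (I := 0) (J := 0) rfl rfl, hff]
    simp [RExp.ev, NExp.ev, Core.fill, ha, Finset.sum_range_succ]
    ring
  · rw [Finset.sum_range_succ]
    simp only [add_assoc]

lemma Core.fill_self (s : Core) (a : ℕ) (D : ℕ → ℕ → Prop) (f f' : ℕ → ℕ → ℝ) :
    (s.fill a D f).fill a D f' = s.fill a D f' := by
  simp only [Core.fill]
  congr 1
  funext a' i j
  by_cases h : a' = a ∧ D i j <;> simp [h]

/-- In round i entry (0,0) of array 12 holds pⁱ and register 4 holds the guess j. The inner product
noise has variance proportional to r²‖z‖²/p²ⁱ, so the guessed part of α² reserved for it is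
(j+1)α²/(2m p²ⁱ), and the rest is supplied by the blur. -/
lemma cvpRound_spec {mE : NExp} {m : ℕ} (hmE : ∀ e : ℕ → ℕ, e 0 = n → mE.ev e = m) (h0 : env 0 = n) :
    ∃ s', (cvpRound mE).den W n g w env s = s' ∧
      ∃ rows : ℕ → ℕ → ℝ, (∀ l < m, ∀ j < n, rows l j = s.arr 8 l j) ∧
        (∀ l < m, rows l n = (∑ b ∈ Finset.range n, s.arr 11 0 b * s.arr 8 l b) / s.arr 1 0 0 +
          √(s.arr 1 0 1 * s.arr 1 0 1 - ((env 4 + 1 : ℕ) : ℝ) * (s.arr 1 0 1 * s.arr 1 0 1) /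
            (((2 * m : ℕ) : ℝ) * (s.arr 12 0 0 * s.arr 12 0 0))) * s.arr 9 0 l) ∧
        (∀ a : Fin n, s'.arr 11 0 a = (s.arr 11 0 a -
          (W.out n (fun l => decode n (p n) (rows l)) (w s.calls) a).val) / s.arr 1 0 0) ∧
        (∀ a : Fin n, s'.arr 13 0 a = s.arr 13 0 a + s.arr 12 0 0 *
          (W.out n (fun l => decode n (p n) (rows l)) (w s.calls) a).val) ∧
        s'.arr 12 0 0 = s.arr 12 0 0 * s.arr 1 0 0 ∧ s'.calls = s.calls + 1 := by
  refine ⟨_, rfl, ?_⟩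
  set E1 : ℕ → ℝ := fun l => (∑ b ∈ Finset.range n, s.arr 11 0 b * s.arr 8 l b) / s.arr 1 0 0 +
          √(s.arr 1 0 1 * s.arr 1 0 1 - ((env 4 + 1 : ℕ) : ℝ) * (s.arr 1 0 1 * s.arr 1 0 1) /
            (((2 * m : ℕ) : ℝ) * (s.arr 12 0 0 * s.arr 12 0 0))) * s.arr 9 0 l with hE1
  set s1 := s.fill 14 (fun i j => i < m ∧ j < n) fun i j => s.arr 8 i j with hs1
  have e1 : (Prog.loop 1 mE (.loop 2 (reg 0) (.setR 14 (reg 1) (reg 2) (.get 8 (reg 1) (reg 2))))).den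
      W n g w env s = s1 := by
    refine Prog.den_loop_rows (fun j => j < n) _ (hmE _ h0) fun i hi => ?_
    refine Prog.den_loop_row i _ (by simp [NExp.ev, h0]) fun j hj => ?_
    refine Prog.den_setR _ (by simp [NExp.ev]) (by simp [NExp.ev]) ?_
    simp [RExp.ev, NExp.ev, Core.fill]
  set s2 := s1.fill 14 (fun i j => i < m ∧ j = n) fun i _ => E1 i with hs2
  have e2 : (Prog.loop 1 mE (.seq (.sumTo 14 (reg 1) (reg 0) 2 (reg 0)
      (.mul (.get 11 (num 0) (reg 2)) (.get 8 (reg 1) (reg 2))))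
    (.setR 14 (reg 1) (reg 0) (.add (.div (.get 14 (reg 1) (reg 0)) (.get 1 (num 0) (num 0)))
      (.mul (.sqrt (.sub (.mul (.get 1 (num 0) (num 1)) (.get 1 (num 0) (num 1)))
        (.div (.mul (.ofNat (.add (reg 4) (num 1)))
          (.mul (.get 1 (num 0) (num 1)) (.get 1 (num 0) (num 1))))
          (.mul (.ofNat (.mul (num 2) mE)) (.mul (.get 12 (num 0) (num 0)) (.get 12 (num 0) (num 0)))))))
        (.get 9 (num 0) (reg 1))))))).den W n g w env s1 = s2 := by
    refine Prog.den_loop_rows (fun j => j = n) _ (hmE _ h0) fun i hi => ?_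
    have hmi : mE.ev (Function.update env 1 i) = m := hmE _ (by simp [h0])
    rw [Prog.den, Prog.den_sumTo (m := n) (I := i) (J := n)
      (fun _ _ => ∑ b ∈ Finset.range n, s.arr 11 0 b * s.arr 8 i b)
      (fun b => s.arr 11 0 b * s.arr 8 i b) (by simp [NExp.ev]) (by simp [NExp.ev, h0])
      (by simp [NExp.ev]) (by simp [NExp.ev, h0]) (by simp [NExp.ev, h0])
      (fun b hb t => by simp [RExp.ev, NExp.ev, Core.fill, hs1]) rfl,
      Prog.den_setR (I := i) (J := n) (fun i _ => E1 i) (by simp [NExp.ev]) (by simp [NExp.ev, h0]),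
      Core.fill_self]
    simp [RExp.ev, NExp.ev, Core.fill, hs1, h0, hmi, hE1]
  set s3 := s2.oracleCall W n (w s2.calls) 14 15 with hs3
  have e4 : ∀ s : Core, (Prog.loop 2 (reg 0) (.setR 13 (num 0) (reg 2) (.add (.get 13 (num 0) (reg 2))
    (.mul (.get 12 (num 0) (num 0)) (.get 15 (num 0) (reg 2)))))).den W n g w env s =
      s.fill 13 (fun i j => i = 0 ∧ j < n) fun _ j => s.arr 13 0 j + s.arr 12 0 0 * s.arr 15 0 j := by
    intro s
    refine Prog.den_loop_row 0 _ h0 fun j hj => ?_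
    refine Prog.den_setR _ (by simp [NExp.ev]) (by simp [NExp.ev]) ?_
    simp [RExp.ev, NExp.ev, Core.fill]
  have e5 : ∀ s : Core, (Prog.loop 2 (reg 0) (.setR 11 (num 0) (reg 2) (.div (.sub (.get 11 (num 0) (reg 2))
    (.get 15 (num 0) (reg 2))) (.get 1 (num 0) (num 0))))).den W n g w env s =
      s.fill 11 (fun i j => i = 0 ∧ j < n) fun _ j => (s.arr 11 0 j - s.arr 15 0 j) / s.arr 1 0 0 := by
    intro s
    refine Prog.den_loop_row 0 _ h0 fun j hj => ?_
    refine Prog.den_setR _ (by simp [NExp.ev]) (by simp [NExp.ev]) ?_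
    simp [RExp.ev, NExp.ev, Core.fill]
  have hcalls : s2.calls = s.calls := rfl
  rw [cvpRound, Prog.den, e1, Prog.den, e2, Prog.den, Prog.den, ← hs3, Prog.den, e4, Prog.den, e5,
    Prog.den]
  simp only [NExp.ev, RExp.ev]
  have h15 : ∀ a : Fin n, s3.arr 15 0 a =
      (W.out n (fun l => decode n (p n) (s2.arr 14 l)) (w s.calls) a).val := by
    intro a
    simp [hs3, Core.oracleCall, hcalls]
  have h3 : ∀ a, a ≠ 15 → a ≠ 14 → s3.arr a = s.arr a := by
    intro a ha ha'
    funext i j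
    simp [hs3, Core.oracleCall, ha, hs2, hs1, Core.fill, ha']
  refine ⟨s2.arr 14, ?_, ?_, ?_, ?_, ?_, rfl⟩
  · intro l hl j hj
    rw [hs2, Core.fill_arr_of_not _ _ _ _ (fun h => hj.ne h.2), hs1, Core.fill_arr _ _ _ _ ⟨hl, hj⟩]
  · intro l hl
    rw [hs2, Core.fill_arr _ _ _ _ ⟨hl, rfl⟩]
  · intro a
    rw [Core.fill_arr_of_ne (by decide), Core.fill_arr _ _ _ _ ⟨rfl, a.2⟩,
      Core.fill_arr_of_ne (by decide), Core.fill_arr_of_ne (by decide), Core.fill_arr_of_ne (by decide),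
      h15, h3 11 (by decide) (by decide), h3 1 (by decide) (by decide)]
  · intro a
    rw [Core.fill_arr_of_ne (by decide), Core.fill_arr_of_ne (by decide),
      Core.fill_arr _ _ _ _ ⟨rfl, a.2⟩, h15, h3 13 (by decide) (by decide), h3 12 (by decide) (by decide)]
  · rw [Core.fill_arr _ _ _ _ ⟨rfl, rfl⟩, Core.fill_arr_of_ne (by decide),
      Core.fill_arr_of_ne (by decide), Core.fill_arr_of_ne (by decide),
      Core.fill_arr_of_ne (by decide), h3 12 (by decide) (by decide), h3 1 (by decide) (by decide)]

lemma den_guardedFloor {a I J : ℕ} {i j : NExp} {e : RExp} (hi : i.ev env = I) (hj : j.ev env = J) :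
    (Prog.guardedFloor a i j e).den W n g w env s = s.fill a (fun i j => i = I ∧ j = J) fun _ _ =>
      if e.ev env s.arr * e.ev env s.arr ≤ s.arr 10 0 0 then (⌊e.ev env s.arr⌋ : ℝ) else 0 := by
  have h1 := Prog.den_setR (W := W) (n := n) (g := g) (w := w) (s := s) (a := a) (e := .floor e)
    (fun _ _ => (⌊e.ev env s.arr⌋ : ℝ)) hi hj rfl
  have h2 := Prog.den_setR (W := W) (n := n) (g := g) (w := w) (s := s) (a := a) (e := .lit 0)
    (fun _ _ => 0) hi hj (by simp [RExp.ev])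
  rw [Prog.guardedFloor, Prog.den, h1, h2]
  by_cases h : e.ev env s.arr * e.ev env s.arr ≤ s.arr 10 0 0
  · exact (if_pos h).trans (by simp only [if_pos h])
  · exact (if_neg h).trans (by simp only [if_neg h])

end LWERed

/-! ### Specifications of the setup and of the initialization of a trial -/

namespace LWERed

open Matrix

variable {p N : ℕ → ℕ} {Ω : Type*} [MeasurableSpace Ω] {W : Oracle p N Ω} {n : ℕ} {g : ℕ → ℝ}
  {w : ℕ → Ω} {env : ℕ → ℕ} {s : Core}

lemma floor_add_half_eq {t : ℝ} {k : ℤ} (h : |t - k| < 1 / 2) : ⌊t + 1 / 2⌋ = k := by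
  rw [Int.floor_eq_iff]
  obtain ⟨h1, h2⟩ := abs_lt.mp h
  constructor <;> linarith

/-- The bound on rounded numbers that the program computes. -/
def guardBound (n m : ℕ) (M : ℕ → ℕ → ℕ → ℝ) : ℝ :=
  1 + n + ∑ i ∈ Finset.range n, ∑ j ∈ Finset.range n, M 0 i j * M 0 i j +
    ∑ i ∈ Finset.range n, ∑ j ∈ Finset.range n, M 5 i j * M 5 i j +
    ∑ i ∈ Finset.range 1, ∑ j ∈ Finset.range n, M 7 i j * M 7 i j +
    ∑ i ∈ Finset.range m, ∑ j ∈ Finset.range n, M 8 i j * M 8 i j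

/-- The rounding bound uses only the input, the inverse basis and the coordinates of the target and
the samples. It is fixed before any oracle answer enters, so its length can be bounded
unconditionally. -/
lemma cvpSetup_spec {mE : NExp} {m : ℕ} (hmE : ∀ e : ℕ → ℕ, e 0 = n → mE.ev e = m) (h0 : env 0 = n)
    (hcoins : s.coins = 0) {B : Matrix (Fin n) (Fin n) ℝ} (hB : B.det ≠ 0)
    (hs : ∀ i j : Fin n, s.arr 0 i j = B i j) :
    ∃ s', (cvpSetup mE).den W n g w env s = s' ∧ (∀ a < 4, s'.arr a = s.arr a) ∧
      (∀ i j : Fin n, s'.arr 5 i j = B⁻¹ i j) ∧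
      (∀ j < n, s'.arr 7 0 j = ∑ b ∈ Finset.range n, s.arr 0 b j * s.arr 2 0 b) ∧
      (∀ l < m, ∀ j < n, s'.arr 8 l j = ∑ b ∈ Finset.range n, s'.arr 5 j b * s.arr 3 l b) ∧
      (∀ l < m, s'.arr 9 0 l = g l) ∧
      s'.arr 10 0 0 = 4 * (guardBound n m s'.arr * guardBound n m s'.arr) ∧ s'.calls = s.calls := by
  refine ⟨_, rfl, ?_⟩
  set s1 := invertBasis.den W n g w env s with hs1
  have h1f : ∀ a < 5, s1.arr a = s.arr a := by
    intro a ha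
    rw [hs1, Prog.den_frame W n g w invertBasis]
    interval_cases a <;> decide
  have h1c : s1.coins = 0 ∧ s1.calls = s.calls := by
    have h := Prog.den_counters W n g w invertBasis
      (by simp [invertBasis, setId, solve, solveStep, Prog.sumTo, Prog.Pure]) env s
    exact ⟨h.1.trans hcoins, h.2⟩
  have h1i : ∀ i j : Fin n, s1.arr 5 i j = B⁻¹ i j := den_invertBasis hB h0 hs
  set s2 := s1.fill 7 (fun i j => i = 0 ∧ j < n) fun _ j =>
    ∑ b ∈ Finset.range n, s1.arr 0 b j * s1.arr 2 0 b with hs2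
  have e2 : (Prog.loop 2 (reg 0) (.sumTo 7 (num 0) (reg 2) 3 (reg 0)
    (.mul (.get 0 (reg 3) (reg 2)) (.get 2 (num 0) (reg 3))))).den W n g w env s1 = s2 := by
    refine Prog.den_loop_row 0 _ h0 fun j hj => ?_
    refine Prog.den_sumTo (m := n) _ (fun b => s1.arr 0 b j * s1.arr 2 0 b) (by simp [NExp.ev])
      (by simp [NExp.ev]) (by simp [NExp.ev]) (by simp [NExp.ev]) (by simp [NExp.ev, h0])
      (fun b hb v => ?_) rfl
    simp [RExp.ev, NExp.ev, Core.fill]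
  set s3 := s2.fill 8 (fun i j => i < m ∧ j < n) fun i j =>
    ∑ b ∈ Finset.range n, s2.arr 5 j b * s2.arr 3 i b with hs3
  have e3 : (Prog.loop 4 mE (applyInv 8 3 (reg 4))).den W n g w env s2 = s3 := by
    refine Prog.den_loop_rows (fun j => j < n) _ (hmE _ h0) fun i hi => ?_
    rw [den_applyInv (I := i) (by simp [h0]) (fun e he => by simp [NExp.ev, he]) (by decide) (by decide)]
    refine Core.fill_congr _ _ (fun _ _ => Iff.rfl) fun a b hab => ?_
    simp only [Core.fill_arr_of_ne (show (5 : ℕ) ≠ 8 by decide),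
      Core.fill_arr_of_ne (show (3 : ℕ) ≠ 8 by decide), hab.1]
  set s4 : Core := { s3.fill 9 (fun i j => i = 0 ∧ j < m) (fun _ j => g j) with coins := m } with hs4
  have e4 : (Prog.loop 4 mE (.gauss 9 (num 0) (reg 4))).den W n g w env s3 = s4 := by
    refine Prog.den_loop_induct W n g w (hmE _ h0) (fun k s' => s' =
      { s3.fill 9 (fun i j => i = 0 ∧ j < k) (fun _ j => g j) with coins := k }) ?_ ?_
    · have : s3.coins = 0 := h1c.1
      cases h : s3
      simp_all [Core.fill]
    · rintro k - s' rfl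
      rw [Prog.den]
      simp only [NExp.ev, Function.update_self]
      congr 1
      simp only [Core.fill]
      funext a' i j
      by_cases h1 : a' = 9 <;> by_cases h2 : i = 0 <;> simp [h1, h2]
      rcases lt_trichotomy j k with h | h | h
      · simp [h, h.ne, h.le]
      · simp [h]
      · simp [h.not_gt, h.ne', h.not_ge]
  rw [cvpSetup, Prog.den, ← hs1, Prog.den, e2, Prog.den, e3, Prog.den, e4, Prog.den,
    Prog.den_setR (I := 0) (J := 0) (fun _ _ => 1 + n) rfl rfl (by simp [RExp.ev, NExp.ev, h0]), Prog.den,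
    den_addSquares (env := env) (mE := reg 0) (qE := reg 0) (by decide) (m := n) (q := n) h0 (by simp [NExp.ev, h0]), Core.fill_self, Prog.den,
    den_addSquares (env := env) (mE := reg 0) (qE := reg 0) (by decide) (m := n) (q := n) h0 (by simp [NExp.ev, h0]), Core.fill_self, Prog.den,
    den_addSquares (env := env) (mE := num 1) (qE := reg 0) (by decide) (m := 1) (q := n) rfl (by simp [NExp.ev, h0]), Core.fill_self, Prog.den,
    den_addSquares (env := env) (mE := mE) (qE := reg 0) (by decide) (m := m) (q := n) (hmE _ h0) (by simp [NExp.ev, h0]), Core.fill_self,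
    Prog.den_setR (I := 0) (J := 0) (fun _ _ => 4 * (guardBound n m s4.arr * guardBound n m s4.arr))
      rfl rfl (by
        simp only [RExp.ev, NExp.ev, Core.fill_single_arr, guardBound]
        simp [Core.fill]), Core.fill_self]
  have h4 : ∀ a, a ≠ 9 → s4.arr a = s3.arr a := fun a ha => by
    rw [hs4]
    exact Core.fill_arr_of_ne ha _ _
  have h49 : ∀ l < m, s4.arr 9 0 l = g l := fun l hl => by
    rw [hs4]
    exact Core.fill_arr (s := s3) (a := 9) (D := fun i j => i = 0 ∧ j < m) (f := fun _ j => g j)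
      (i := 0) (j := l) ⟨rfl, hl⟩
  have h35 : s3.arr 5 = s1.arr 5 := by
    rw [hs3, Core.fill_arr_of_ne (by decide), hs2, Core.fill_arr_of_ne (by decide)]
  have h4c : s4.calls = s.calls := h1c.2
  clear_value s4
  refine ⟨fun a ha => ?_, fun i j => ?_, fun j hj => ?_, fun l hl j hj => ?_, fun l hl => ?_, ?_, ?_⟩
  · rw [Core.fill_arr_of_ne (by omega), h4 a (by omega), hs3, Core.fill_arr_of_ne (by omega), hs2,
      Core.fill_arr_of_ne (by omega), h1f a (by omega)]
  · rw [Core.fill_arr_of_ne (by decide), h4 5 (by decide), hs3, Core.fill_arr_of_ne (by decide), hs2,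
      Core.fill_arr_of_ne (by decide), h1i]
  · rw [Core.fill_arr_of_ne (by decide), h4 7 (by decide), hs3, Core.fill_arr_of_ne (by decide), hs2,
      Core.fill_arr _ _ _ _ ⟨rfl, hj⟩, h1f 0 (by decide), h1f 2 (by decide)]
  · rw [Core.fill_arr_of_ne (a' := 8) (by decide), Core.fill_arr_of_ne (a' := 5) (by decide),
      h4 8 (by decide), h4 5 (by decide), h35, hs3, Core.fill_arr _ _ _ _ ⟨hl, hj⟩, hs2,
      Core.fill_arr_of_ne (a' := 5) (by decide),
      Core.fill_arr_of_ne (a' := 3) (by decide), h1f 3 (by decide)]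
  · rw [Core.fill_arr_of_ne (by decide), h49 l hl]
  · rw [Core.fill_single_arr]
    simp [guardBound, Core.fill]
  · exact h4c

lemma cvpInit_spec (h0 : env 0 = n) : ∃ s', cvpInit.den W n g w env s = s' ∧
    (∀ j < n, s'.arr 11 0 j = s.arr 7 0 j) ∧ s'.arr 12 0 0 = 1 ∧ (∀ j < n, s'.arr 13 0 j = 0) ∧
    s'.calls = s.calls := by
  refine ⟨_, rfl, ?_⟩
  have e1 : (Prog.loop 2 (reg 0) (.setR 11 (num 0) (reg 2) (.get 7 (num 0) (reg 2)))).den W n g w env s =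
      s.fill 11 (fun i j => i = 0 ∧ j < n) fun _ j => s.arr 7 0 j := by
    refine Prog.den_loop_row 0 _ h0 fun j hj => ?_
    refine Prog.den_setR _ (by simp [NExp.ev]) (by simp [NExp.ev]) ?_
    simp [RExp.ev, NExp.ev, Core.fill]
  have e2 : ∀ s : Core, (Prog.loop 2 (reg 0) (.setR 13 (num 0) (reg 2) (.lit 0))).den W n g w env s =
      s.fill 13 (fun i j => i = 0 ∧ j < n) fun _ _ => 0 := by
    intro s
    refine Prog.den_loop_row 0 _ h0 fun j hj => ?_
    exact Prog.den_setR _ (by simp [NExp.ev]) (by simp [NExp.ev]) (by simp [RExp.ev])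
  rw [cvpInit, Prog.den, e1, Prog.den, Prog.den_setR (I := 0) (J := 0) (fun _ _ => 1) rfl rfl
    (by simp [RExp.ev]), e2]
  refine ⟨fun j hj => ?_, ?_, fun j hj => ?_, rfl⟩
  · rw [Core.fill_arr_of_ne (by decide), Core.fill_arr_of_ne (by decide), Core.fill_arr _ _ _ _ ⟨rfl, hj⟩]
  · rw [Core.fill_arr_of_ne (by decide), Core.fill_single_arr]
  · rw [Core.fill_arr _ _ _ _ ⟨rfl, hj⟩]

end LWERed

/-! ### Specification of the final rounding and of the acceptance test -/

namespace LWERed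

open Matrix

variable {p N : ℕ → ℕ} {Ω : Type*} [MeasurableSpace Ω] {W : Oracle p N Ω} {n : ℕ} {g : ℕ → ℝ}
  {w : ℕ → Ω} {env : ℕ → ℕ} {s : Core}

/-- K is integral whatever the earlier rounds did, so every candidate is a dual lattice point and
can be judged by its distance alone. The last clause is for a trial whose rounds succeeded: if the
guards pass, rounding recovers the true coordinates. -/
lemma cvpFinish_spec {mE : NExp} {m : ℕ} (hmE : ∀ e : ℕ → ℕ, e 0 = n → mE.ev e = m)
    (h0 : env 0 = n) :
    ∃ s', (cvpFinish mE).den W n g w env s = s' ∧ s'.calls = s.calls ∧ ∃ K κ : ℕ → ℝ,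
      (∀ a, ∃ k : ℤ, K a = k) ∧ (∀ a, κ a = ∑ b ∈ Finset.range n, s.arr 5 b a * K b) ∧
      ((∑ a ∈ Finset.range n, (s.arr 2 0 a - κ a) * (s.arr 2 0 a - κ a)) *
          (2 * (s.arr 1 0 2 * s.arr 1 0 2)) ≤
          s.arr 1 0 1 * s.arr 1 0 1 * (s.arr 1 0 0 * s.arr 1 0 0) →
        ∀ a < n, s'.arr 4 0 a = κ a) ∧
      (¬ (∑ a ∈ Finset.range n, (s.arr 2 0 a - κ a) * (s.arr 2 0 a - κ a)) *
          (2 * (s.arr 1 0 2 * s.arr 1 0 2)) ≤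
          s.arr 1 0 1 * s.arr 1 0 1 * (s.arr 1 0 0 * s.arr 1 0 0) → s'.arr 4 = s.arr 4) ∧
      ∀ (c : Fin m → Fin n → ℤ) (y k : Fin n → ℤ),
        (∀ (l : Fin m) (a : Fin n), s.arr 8 l a = c l a) →
        (∀ z : Fin n → ℝ, (∀ l, (fun a => (c l a : ℝ)) ⬝ᵥ z = 0) → z = 0) →
        (∀ l : Fin m, |∑ b ∈ Finset.range n, s.arr 11 0 b * s.arr 8 l b - (c l ⬝ᵥ y : ℤ)| < 1 / 2) →
        (∀ l : Fin m, (∑ b ∈ Finset.range n, s.arr 11 0 b * s.arr 8 l b + 1 / 2) *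
          (∑ b ∈ Finset.range n, s.arr 11 0 b * s.arr 8 l b + 1 / 2) ≤ s.arr 10 0 0) →
        (∀ a : Fin n, s.arr 13 0 a + s.arr 12 0 0 * y a = k a) →
        (∀ a : Fin n, ((k a : ℝ) + 1 / 2) * ((k a : ℝ) + 1 / 2) ≤ s.arr 10 0 0) →
        ∀ a : Fin n, K a = k a := by
  refine ⟨_, rfl, (Prog.den_counters W n g w _ (by
    simp [cvpFinish, setId, solve, solveStep, Prog.sumTo, Prog.guardedFloor, Prog.Pure]) env s).2, ?_⟩
  set T : ℕ → ℝ := fun l => ∑ b ∈ Finset.range n, s.arr 11 0 b * s.arr 8 l b with hT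
  set s1 := s.fill 16 (fun i j => i < m ∧ j = 0) fun l _ =>
    if (T l + 1 / 2) * (T l + 1 / 2) ≤ s.arr 10 0 0 then (⌊T l + 1 / 2⌋ : ℝ) else 0 with hs1
  have e1 : (Prog.loop 1 mE (.seq (.sumTo 16 (reg 1) (num 0) 2 (reg 0)
      (.mul (.get 11 (num 0) (reg 2)) (.get 8 (reg 1) (reg 2))))
    (.guardedFloor 16 (reg 1) (num 0) (.add (.get 16 (reg 1) (num 0)) (.lit (1 / 2)))))).den W n g w
      env s = s1 := by
    refine Prog.den_loop_rows (fun j => j = 0) _ (hmE _ h0) fun i hi => ?_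
    rw [Prog.den, Prog.den_sumTo (m := n) (I := i) (J := 0) (fun _ _ => T i)
      (fun b => s.arr 11 0 b * s.arr 8 i b) (by simp [NExp.ev]) (by simp [NExp.ev])
      (by simp [NExp.ev]) (by simp [NExp.ev]) (by simp [NExp.ev, h0])
      (fun b hb t => by simp [RExp.ev, NExp.ev, Core.fill]) rfl,
      den_guardedFloor (I := i) (J := 0) (by simp [NExp.ev]) (by simp [NExp.ev]), Core.fill_self]
    refine Core.fill_congr _ _ (fun _ _ => Iff.rfl) fun a b hab => ?_
    simp [RExp.ev, NExp.ev, Core.fill, hab.1]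
  set s2 := (solve 8 16 17 mE (num 1)).den W n g w env s1 with hs2
  have h2f : ∀ a, a ∉ ({16, 17, 20, 21, 22, 23} : Finset ℕ) → s2.arr a = s.arr a := by
    intro a ha
    simp only [Finset.mem_insert, Finset.mem_singleton, not_or] at ha
    obtain ⟨h16, h17, h20, h21, h22, h23⟩ := ha
    rw [hs2, Prog.den_frame W n g w, hs1, Core.fill_arr_of_ne h16]
    simp [solve, setId, solveStep, Prog.sumTo, Prog.writes, h17, h20, h21, h22, h23]
  set V : ℕ → ℝ := fun j => s2.arr 13 0 j + s2.arr 12 0 0 * s2.arr 17 j 0 with hV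
  set K : ℕ → ℝ := fun j => if (V j + 1 / 2) * (V j + 1 / 2) ≤ s2.arr 10 0 0 then
    (⌊V j + 1 / 2⌋ : ℝ) else 0 with hK
  set s3 := s2.fill 18 (fun i j => i = 0 ∧ j < n) fun _ j => K j with hs3
  have e3 : (Prog.loop 2 (reg 0) (.guardedFloor 18 (num 0) (reg 2) (.add (.add (.get 13 (num 0) (reg 2))
    (.mul (.get 12 (num 0) (num 0)) (.get 17 (reg 2) (num 0)))) (.lit (1 / 2))))).den W n g w env s2 =
      s3 := by
    refine Prog.den_loop_row 0 _ h0 fun j hj => ?_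
    rw [den_guardedFloor (I := 0) (J := j) (by simp [NExp.ev]) (by simp [NExp.ev])]
    refine Core.fill_congr _ _ (fun _ _ => Iff.rfl) fun a b hab => ?_
    simp [RExp.ev, NExp.ev, Core.fill, hab.2, hK, hV]
  set κ : ℕ → ℝ := fun a => ∑ b ∈ Finset.range n, s.arr 5 b a * K b with hκ
  set s4 := s3.fill 19 (fun i j => i = 0 ∧ j < n) fun _ j => κ j with hs4
  have e4 : (Prog.loop 2 (reg 0) (.sumTo 19 (num 0) (reg 2) 3 (reg 0)
    (.mul (.get 5 (reg 3) (reg 2)) (.get 18 (num 0) (reg 3))))).den W n g w env s3 = s4 := by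
    refine Prog.den_loop_row 0 _ h0 fun j hj => ?_
    refine Prog.den_sumTo (m := n) _ (fun b => s.arr 5 b j * K b) (by simp [NExp.ev])
      (by simp [NExp.ev]) (by simp [NExp.ev]) (by simp [NExp.ev]) (by simp [NExp.ev, h0])
      (fun b hb v => ?_) rfl
    have h5 : s2.arr 5 b j = s.arr 5 b j := by rw [h2f 5 (by decide)]
    simp [RExp.ev, NExp.ev, Core.fill, hs3, hb, h5]
  set D : ℝ := ∑ a ∈ Finset.range n, (s.arr 2 0 a - κ a) * (s.arr 2 0 a - κ a) with hD
  set s5 := s4.fill 24 (fun i j => i = 0 ∧ j = 0) fun _ _ => D with hs5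
  have e5 : (Prog.sumTo 24 (num 0) (num 0) 2 (reg 0)
    (.mul (.sub (.get 2 (num 0) (reg 2)) (.get 19 (num 0) (reg 2)))
      (.sub (.get 2 (num 0) (reg 2)) (.get 19 (num 0) (reg 2))))).den W n g w env s4 = s5 := by
    refine Prog.den_sumTo (m := n) _ (fun a => (s.arr 2 0 a - κ a) * (s.arr 2 0 a - κ a))
      (by simp [NExp.ev]) (by simp [NExp.ev]) (by simp [NExp.ev]) (by simp [NExp.ev])
      (by simp [NExp.ev, h0]) (fun b hb v => ?_) rfl
    have h5 : s2.arr 2 0 b = s.arr 2 0 b := by rw [h2f 2 (by decide)]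
    simp [RExp.ev, NExp.ev, Core.fill, hs3, hs4, hb, h5]
  have e6 : (Prog.loop 2 (reg 0) (.setR 4 (num 0) (reg 2) (.get 19 (num 0) (reg 2)))).den W n g w env s5
      = s5.fill 4 (fun i j => i = 0 ∧ j < n) fun _ j => s5.arr 19 0 j := by
    refine Prog.den_loop_row 0 _ h0 fun j hj => ?_
    refine Prog.den_setR _ (by simp [NExp.ev]) (by simp [NExp.ev]) ?_
    simp [RExp.ev, NExp.ev, Core.fill]
  have h5f : ∀ a, a ∉ ({16, 17, 18, 19, 20, 21, 22, 23, 24} : Finset ℕ) → s5.arr a = s.arr a := by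
    intro a ha
    simp only [Finset.mem_insert, Finset.mem_singleton, not_or] at ha
    obtain ⟨h16, h17, h18, h19, h20, h21, h22, h23, h24⟩ := ha
    rw [hs5, Core.fill_arr_of_ne h24, hs4, Core.fill_arr_of_ne h19, hs3, Core.fill_arr_of_ne h18,
      h2f a (by simp [h16, h17, h20, h21, h22, h23])]
  have hden : (cvpFinish mE).den W n g w env s =
      if D * (2 * (s.arr 1 0 2 * s.arr 1 0 2)) ≤
        s.arr 1 0 1 * s.arr 1 0 1 * (s.arr 1 0 0 * s.arr 1 0 0) then
      s5.fill 4 (fun i j => i = 0 ∧ j < n) fun _ j => s5.arr 19 0 j else s5 := by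
    rw [cvpFinish, Prog.den, e1, Prog.den, ← hs2, Prog.den, e3, Prog.den, e4, Prog.den, e5, Prog.den,
      e6]
    have h1 : s5.arr 1 = s.arr 1 := h5f 1 (by decide)
    have h24 : s5.arr 24 0 0 = D := Core.fill_single_arr _ _ _ _ _
    simp only [RExp.ev, NExp.ev, h1, h24, Rat.cast_ofNat]
    rfl
  rw [hden]
  refine ⟨K, κ, fun a => ?_, fun a => rfl, fun h a ha => ?_, fun h => ?_, ?_⟩
  · by_cases h : (V a + 1 / 2) * (V a + 1 / 2) ≤ s2.arr 10 0 0
    · exact ⟨_, if_pos h⟩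
    · exact ⟨0, (if_neg h).trans (by simp)⟩
  · rw [if_pos h, Core.fill_arr _ _ _ _ ⟨rfl, ha⟩, hs5, Core.fill_arr_of_ne (by decide), hs4,
      Core.fill_arr _ _ _ _ ⟨rfl, ha⟩]
  · rw [if_neg h, h5f 4 (by decide)]
  · intro c y k hc hspan hclose hg1 hk hg2 a
    -- Each inner product is within 1/2 of the integer c_l · y, so rounding makes the system
    -- consistent with exact solution y.
    have h17 : ∀ a : Fin n, s2.arr 17 a 0 = y a := by
      intro a
      have := den_solve_arr (W := W) (g := g) (w := w) (env := env) (s := s1) (vA := 8) (rA := 16)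
        (yA := 17) (mE := mE) (qE := num 1) (m := m) (q := 1) (by decide) (by decide) (by decide) h0
        (hmE _ h0) (fun e _ => rfl) (Matrix.of fun b _ => (y b : ℝ)) (fun l a => (c l a : ℝ)) (by
          intro l a
          rw [hs1, Core.fill_arr_of_ne (by decide), hc]) (by
          intro l b
          have hb : (b : ℕ) = 0 := by omega
          rw [hb, hs1, Core.fill_arr _ _ _ _ ⟨l.2, rfl⟩, if_pos (hg1 l), floor_add_half_eq (hclose l)]
          push_cast [dotProduct]
          rfl) hspan a 0
      simpa using this
    have hVa : V a = k a := by
      rw [hV]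
      simp only
      rw [h17, h2f 13 (by decide), h2f 12 (by decide), hk]
    have h10 : s2.arr 10 = s.arr 10 := h2f 10 (by decide)
    rw [hK]
    simp only
    rw [hVa, h10, if_pos (hg2 a), floor_add_half_eq (k := k a) (by simp)]

end LWERed

/-! ### Base-p digits of the coordinates, and the rounds of one trial -/

namespace LWERed

open Matrix

/-- Integer division by a positive number rounds down and the remainder is its representative in 0,
…, p - 1, so the identity also holds for negative k. -/
lemma digit_step (p : ℕ) [NeZero p] (k : ℤ) (i : ℕ) :
    ((k / (p : ℤ) ^ i : ℤ) : ℝ) - ((((k / (p : ℤ) ^ i : ℤ) : ZMod p)).val : ℝ) =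
      p * ((k / (p : ℤ) ^ (i + 1) : ℤ) : ℝ) := by
  have h1 : (((((k / (p : ℤ) ^ i : ℤ) : ZMod p)).val : ℤ) : ℝ) = (((k / (p : ℤ) ^ i) % p : ℤ) : ℝ) := by
    rw [ZMod.val_intCast]
  rw [Int.cast_natCast] at h1
  have h2 : k / (p : ℤ) ^ (i + 1) = k / (p : ℤ) ^ i / p := by
    rw [pow_succ, Int.ediv_ediv_of_nonneg (by positivity)]
  rw [h1, h2, ← Int.cast_sub, ← Int.cast_natCast (R := ℝ) p, ← Int.cast_mul]
  congr 1
  have := Int.emod_add_mul_ediv (k / (p : ℤ) ^ i) p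
  linarith

/-- Shows that the guard 4T² lets X pass: (X + 1/2)² ≤ 2X² + 1/2 ≤ 4ab + 1/2. -/
lemma sq_add_half_le {X a b : ℝ} (h : X ^ 2 ≤ 2 * a * b) (ha : 0 ≤ a) (hb : 0 ≤ b) {T : ℝ}
    (hT : 1 + a + b ≤ T) : (X + 1 / 2) * (X + 1 / 2) ≤ 4 * (T * T) := by
  have h1 : (1 + a + b) * (1 + a + b) ≤ T * T := by
    have : 0 ≤ 1 + a + b := by positivity
    exact mul_self_le_mul_self this hT
  nlinarith [sq_nonneg (X - 1 / 2), mul_nonneg ha hb, sq_nonneg a, sq_nonneg b]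

/-- As before, for an X known only to be close to y: X² ≤ 2(X - y)² + 2y². -/
lemma sq_add_half_le' {X y a b c : ℝ} (hy : y ^ 2 ≤ c) (h : (X - y) ^ 2 ≤ a * b) (ha : 0 ≤ a)
    (hb : 0 ≤ b) (hc : 0 ≤ c) {T : ℝ} (hT : 1 + a + b + c ≤ T) :
    (X + 1 / 2) * (X + 1 / 2) ≤ 4 * (T * T) := by
  have h1 : (1 + a + b + c) * (1 + a + b + c) ≤ T * T := by
    have : 0 ≤ 1 + a + b + c := by positivity
    exact mul_self_le_mul_self this hT
  have h2 : X ^ 2 ≤ 2 * (a * b) + 2 * c := by nlinarith [sq_nonneg (X - 2 * y)]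
  nlinarith [sq_nonneg (X - 1 / 2), mul_nonneg ha hb, sq_nonneg a, sq_nonneg b, sq_nonneg c,
    mul_nonneg ha hc, mul_nonneg hb hc]

/-- The expression is (x - R)/pⁱ with R the remainder of k modulo pⁱ. The possibly huge k cancels,
and the target after i rounds is bounded by the input alone. -/
lemma sq_div_sub_le {p : ℕ} [NeZero p] (k : ℤ) (x : ℝ) (i : ℕ) :
    (((k / (p : ℤ) ^ i : ℤ) : ℝ) + (x - k) / (p : ℝ) ^ i) ^ 2 ≤ 2 * (x ^ 2 + 1) := by
  have hp : (1 : ℝ) ≤ (p : ℝ) ^ i := one_le_pow₀ (by exact_mod_cast NeZero.one_le)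
  have hpz : (0 : ℤ) < (p : ℤ) ^ i := pow_pos (by exact_mod_cast NeZero.pos p) i
  set R : ℝ := ((k % (p : ℤ) ^ i : ℤ) : ℝ) with hR
  have h0 : 0 ≤ R := by
    rw [hR]
    exact_mod_cast Int.emod_nonneg k hpz.ne'
  have h1 : R ≤ (p : ℝ) ^ i := by
    rw [hR]
    exact_mod_cast (Int.emod_lt_of_pos k hpz).le
  have h2 : (k : ℝ) = R + (p : ℝ) ^ i * ((k / (p : ℤ) ^ i : ℤ) : ℝ) := by
    rw [hR]
    exact_mod_cast (Int.emod_add_mul_ediv k ((p : ℤ) ^ i)).symm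
  have h3 : ((k / (p : ℤ) ^ i : ℤ) : ℝ) + (x - k) / (p : ℝ) ^ i = (x - R) / (p : ℝ) ^ i := by
    rw [h2]
    field_simp
    ring
  have h4 : (x / (p : ℝ) ^ i) ^ 2 ≤ x ^ 2 := by
    rw [div_pow]
    exact div_le_self (sq_nonneg x) (one_le_pow₀ hp)
  have h5 : (R / (p : ℝ) ^ i) ^ 2 ≤ 1 := by
    refine pow_le_one₀ (by positivity) ((div_le_one (by positivity)).mpr h1)
  rw [h3, sub_div]
  nlinarith [sq_nonneg (x / (p : ℝ) ^ i + R / (p : ℝ) ^ i)]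

variable {p N : ℕ → ℕ} {Ω : Type*} [MeasurableSpace Ω] {W : Oracle p N Ω} {n : ℕ} {g : ℕ → ℝ}
  {w : ℕ → Ω} {env : ℕ → ℕ} {s : Core}

/-- The array numbers that a trial preserves. -/
def keptArrays : Finset ℕ := {0, 1, 2, 5, 7, 8, 9, 10}

lemma keptArrays_frame (mE : NExp) {a : ℕ} (ha : a ∈ keptArrays) :
    a ∉ cvpInit.writes ∧ a ∉ (cvpRound mE).writes ∧ a ∉ (cvpFinish mE).writes := by
  have h : ∀ a ∈ keptArrays, a ∉ ({4, 11, 12, 13, 14, 15, 16, 17, 18, 19, 20, 21, 22, 23, 24} : Finset ℕ) := by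
    decide
  have h' := h a ha
  simp only [Finset.mem_insert, Finset.mem_singleton, not_or] at h'
  simp [cvpInit, cvpRound, cvpFinish, Prog.writes, Prog.sumTo, Prog.guardedFloor, solve, setId,
    solveStep, h']

/-- After i correct rounds the target has coordinates ⌊k/pⁱ⌋ + (u - k)/pⁱ and the digits found add
up to k - pⁱ⌊k/pⁱ⌋. The hypothesis on the oracle is phrased with the true digits of k rather than
with earlier answers, so the probability of each round's failure can be bounded without conditioning
on the others. -/
lemma cvpRounds_spec [NeZero (p n)] {mE : NExp} {m : ℕ} (hmE : ∀ e : ℕ → ℕ, e 0 = n → mE.ev e = m)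
    (hNm : N n ≤ m) (h0 : env 0 = n) {B : Matrix (Fin n) (Fin n) ℝ} (hB : B.det ≠ 0) {α : ℝ}
    {u : Fin n → ℝ} {k : Fin n → ℤ} {c : Fin m → Fin n → ℤ}
    (hs1 : s.arr 1 0 0 = p n) (hs2 : s.arr 1 0 1 = α)
    (hs8 : ∀ (l : Fin m) (a : Fin n), s.arr 8 l a = c l a) (hs9 : ∀ l < m, s.arr 9 0 l = g l)
    (hs11 : ∀ a : Fin n, s.arr 11 0 a = u a) (hs12 : s.arr 12 0 0 = 1)
    (hs13 : ∀ a < n, s.arr 13 0 a = 0) :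
    ∃ s', (Prog.loop 5 (reg 0) (cvpRound mE)).den W n g w env s = s' ∧
      (∀ a ∈ keptArrays, s'.arr a = s.arr a) ∧ s'.arr 4 = s.arr 4 ∧ s'.calls = s.calls + n ∧
      ((∀ i < n, W.out n (fun l : Fin (N n) => lweMap (fun a => ((k a / (p n : ℤ) ^ i : ℤ) : ZMod (p n)))
          (jointMap B (p n) (((p n : ℝ) ^ i)⁻¹ • ((p n : ℝ)⁻¹ • (B⁻¹ᵀ *ᵥ (u - fun a => (k a : ℝ)))))
            √(α * α - ((env 4 + 1 : ℕ) : ℝ) * (α * α) / (((2 * m : ℕ) : ℝ) * ((p n : ℝ) ^ i * (p n : ℝ) ^ i)))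
            (latVec B (c (Fin.castLE hNm l)), g l))) (w (s.calls + i)) =
          fun a => ((k a / (p n : ℤ) ^ i : ℤ) : ZMod (p n))) →
        (∀ a : Fin n, s'.arr 11 0 a = ((k a / (p n : ℤ) ^ n : ℤ) : ℝ) + (u a - k a) / (p n : ℝ) ^ n) ∧
        s'.arr 12 0 0 = (p n : ℝ) ^ n ∧
        ∀ a : Fin n, s'.arr 13 0 a = k a - (p n : ℝ) ^ n * ((k a / (p n : ℤ) ^ n : ℤ) : ℝ)) := by
  refine ⟨_, rfl, ?_⟩
  have hp0 : (p n : ℝ) ≠ 0 := by exact_mod_cast NeZero.ne (p n)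
  set good : ℕ → Prop := fun i => W.out n (fun l : Fin (N n) =>
    lweMap (fun a => ((k a / (p n : ℤ) ^ i : ℤ) : ZMod (p n)))
          (jointMap B (p n) (((p n : ℝ) ^ i)⁻¹ • ((p n : ℝ)⁻¹ • (B⁻¹ᵀ *ᵥ (u - fun a => (k a : ℝ)))))
            √(α * α - ((env 4 + 1 : ℕ) : ℝ) * (α * α) / (((2 * m : ℕ) : ℝ) * ((p n : ℝ) ^ i * (p n : ℝ) ^ i)))
            (latVec B (c (Fin.castLE hNm l)), g l))) (w (s.calls + i)) =
          fun a => ((k a / (p n : ℤ) ^ i : ℤ) : ZMod (p n)) with hgood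
  refine Prog.den_loop_induct W n g w (x := 5) (e := reg 0) h0 (fun i s' =>
      (∀ a ∈ keptArrays, s'.arr a = s.arr a) ∧ s'.arr 4 = s.arr 4 ∧ s'.calls = s.calls + i ∧
      ((∀ i < n, good i) →
        (∀ a : Fin n, s'.arr 11 0 a = ((k a / (p n : ℤ) ^ i : ℤ) : ℝ) + (u a - k a) / (p n : ℝ) ^ i) ∧
        s'.arr 12 0 0 = (p n : ℝ) ^ i ∧
        ∀ a : Fin n, s'.arr 13 0 a = k a - (p n : ℝ) ^ i * ((k a / (p n : ℤ) ^ i : ℤ) : ℝ))) ?_ ?_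
  · refine ⟨fun _ _ => rfl, rfl, rfl, fun _ => ⟨fun a => ?_, by simp [hs12], fun a => ?_⟩⟩
    · rw [hs11]; simp
    · rw [hs13 a a.2]; simp
  · rintro i hi s' ⟨hk, h4, hcalls, hinv⟩
    obtain ⟨s'', hs'', rows, hrow1, hrow2, h11, h13, h12, hc'⟩ := cvpRound_spec (W := W) (g := g) (w := w)
      (env := Function.update env 5 i) (s := s') hmE (by simp [h0])
    rw [hs'']
    refine ⟨fun a ha => ?_, ?_, by rw [hc', hcalls]; ring, fun hg => ?_⟩
    · rw [← hs'', Prog.den_frame W n g w _ (keptArrays_frame mE ha).2.1, hk a ha]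
    · rw [← hs'', Prog.den_frame W n g w _ _, h4]
      simp [cvpRound, Prog.writes, Prog.sumTo]
    · obtain ⟨i11, i12, i13⟩ := hinv hg
      have h1' : s'.arr 1 = s.arr 1 := hk 1 (by decide)
      have h8' : s'.arr 8 = s.arr 8 := hk 8 (by decide)
      have h9' : s'.arr 9 = s.arr 9 := hk 9 (by decide)
      set d : Fin n → ℤ := fun a => k a / (p n : ℤ) ^ i with hd
      set u' : Fin n → ℝ := fun a => (d a : ℝ) + (u a - k a) / (p n : ℝ) ^ i with hu'
      -- With the correct digits removed, the current target differs from its dual lattice point by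
      -- (u - k)/pⁱ in coordinates; hence the rows are LWE samples with secret ⌊k/pⁱ⌋ mod p and
      -- error vector z/pⁱ.
      have hdec : ∀ l : Fin (N n), decode n (p n) (rows l) =
          lweMap (fun a => (d a : ZMod (p n)))
          (jointMap B (p n) (((p n : ℝ) ^ i)⁻¹ • ((p n : ℝ)⁻¹ • (B⁻¹ᵀ *ᵥ (u - fun a => (k a : ℝ)))))
            √(α * α - ((env 4 + 1 : ℕ) : ℝ) * (α * α) / (((2 * m : ℕ) : ℝ) * ((p n : ℝ) ^ i * (p n : ℝ) ^ i)))
            (latVec B (c (Fin.castLE hNm l)), g l)) := by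
        intro l
        have hl : (l : ℕ) < m := l.2.trans_le hNm
        have hcl : ∀ a : Fin n, s.arr 8 l a = c (Fin.castLE hNm l) a := fun a =>
          hs8 (Fin.castLE hNm l) a
        have hz : ((p n : ℝ) ^ i)⁻¹ • ((p n : ℝ)⁻¹ • (B⁻¹ᵀ *ᵥ (u - fun a => (k a : ℝ)))) =
            (p n : ℝ)⁻¹ • (B⁻¹ᵀ *ᵥ (u' - fun a => (d a : ℝ))) := by
          have : (u' - fun a => (d a : ℝ)) = ((p n : ℝ) ^ i)⁻¹ • (u - fun a => (k a : ℝ)) := by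
            funext a
            simp [hu', div_eq_inv_mul]
          rw [this, mulVec_smul, smul_comm]
        rw [hz]
        refine decode_eq_lweMap hB (c (Fin.castLE hNm l)) d u' _ (g l) (fun j => ?_) ?_
        · rw [hrow1 l hl j j.2, h8', hcl]
        · rw [hrow2 l hl, h1', h8', h9', hs1, hs2, i12, hs9 l hl, Finset.sum_range]
          simp only [hcl, i11]
          simp only [Function.update_of_ne (show (4 : ℕ) ≠ 5 by decide)]
          rfl
      have hans : W.out n (fun l => decode n (p n) (rows l)) (w s'.calls) =
          fun a => ((d a : ℤ) : ZMod (p n)) := by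
        have := hg i hi
        rw [hgood] at this
        simp only [hdec, hcalls]
        exact this
      have hdig : ∀ a, (d a : ℝ) - ((d a : ZMod (p n)).val : ℝ) =
          p n * ((k a / (p n : ℤ) ^ (i + 1) : ℤ) : ℝ) := fun a => digit_step (p n) (k a) i
      refine ⟨fun a => ?_, ?_, fun a => ?_⟩
      · rw [h11, hans, i11, h1', hs1]
        have := hdig a
        have h2 : (d a : ℝ) = p n * ((k a / (p n : ℤ) ^ (i + 1) : ℤ) : ℝ) + ((d a : ZMod (p n)).val : ℝ) := by
          linarith
        change ((d a : ℝ) + (u a - k a) / (p n : ℝ) ^ i - ((d a : ZMod (p n)).val : ℝ)) / p n = _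
        rw [h2]
        field_simp
        ring
      · rw [h12, i12, h1', hs1, pow_succ]
      · rw [h13, hans, i13, i12]
        have := hdig a
        change (k a : ℝ) - (p n : ℝ) ^ i * (d a : ℝ) + (p n : ℝ) ^ i * ((d a : ZMod (p n)).val : ℝ) = _
        have h2 : ((d a : ZMod (p n)).val : ℝ) = (d a : ℝ) - p n * ((k a / (p n : ℤ) ^ (i + 1) : ℤ) : ℝ) := by
          linarith
        rw [h2]
        ring

end LWERed

/-! ### Deterministic correctness of the closest vector program -/

namespace LWERed

open Matrix

lemma guardBound_eq {n m : ℕ} {M : ℕ → ℕ → ℕ → ℝ} {B C : Matrix (Fin n) (Fin n) ℝ} {u : Fin n → ℝ}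
    {t : Fin m → Fin n → ℝ} (h0 : ∀ i j : Fin n, M 0 i j = B i j) (h5 : ∀ i j : Fin n, M 5 i j = C i j)
    (h7 : ∀ j : Fin n, M 7 0 j = u j) (h8 : ∀ (l : Fin m) (a : Fin n), M 8 l a = t l a) :
    guardBound n m M = 1 + n + ∑ i, ∑ j, B i j ^ 2 + ∑ i, ∑ j, C i j ^ 2 + ∑ j, u j ^ 2 +
      ∑ l, ∑ j, t l j ^ 2 := by
  simp only [guardBound, Finset.sum_range, h0, h5, h8, ← sq]
  simp [h7]

variable {p N : ℕ → ℕ} {Ω : Type*} [MeasurableSpace Ω] {W : Oracle p N Ω} {n : ℕ} {g : ℕ → ℝ}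
  {w : ℕ → Ω} {env : ℕ → ℕ} {s : Core}

/-- The program finds the closest point if the oracle answers correctly for one guess of the
distance. -/
theorem cvpProg_output [NeZero (p n)] {mE : NExp} {m : ℕ} (hmE : ∀ e : ℕ → ℕ, e 0 = n → mE.ev e = m)
    (hmI : ∀ X : Finset ℕ, 0 ∈ X → mE.In X) (hNm : N n ≤ m)
    {B : Matrix (Fin n) (Fin n) ℝ} (hB : B.det ≠ 0) {α r : ℝ} {x : E n} {u : Fin n → ℝ}
    (hu : u = Bᵀ *ᵥ x.ofLp) {k : Fin n → ℤ} {c : Fin m → Fin n → ℤ}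
    (hkd : ∀ a, ((k a : ℝ) - u a) ^ 2 ≤ (∑ i, ∑ j, B i j ^ 2) * ∑ i, ∑ j, B⁻¹ i j ^ 2)
    (hspan : ∀ z : Fin n → ℝ, (∀ l, (fun a => (c l a : ℝ)) ⬝ᵥ z = 0) → z = 0)
    (hsmall : ∀ l, |(u - fun a => (k a : ℝ)) ⬝ᵥ fun a => (c l a : ℝ)| < (p n : ℝ) ^ n / 2)
    (hclose : ‖x - latVec B⁻¹ᵀ k‖ ^ 2 * (2 * (r * r)) ≤ α * α * ((p n : ℝ) * p n))
    (huniq : ∀ K : Fin n → ℤ, ‖x - latVec B⁻¹ᵀ K‖ ^ 2 * (2 * (r * r)) ≤ α * α * ((p n : ℝ) * p n) →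
      latVec B⁻¹ᵀ K = latVec B⁻¹ᵀ k) {j₀ : ℕ} (hj₀ : j₀ < m)
    (horacle : ∀ i < n, W.out n (fun l : Fin (N n) =>
        lweMap (fun a => ((k a / (p n : ℤ) ^ i : ℤ) : ZMod (p n)))
          (jointMap B (p n) (((p n : ℝ) ^ i)⁻¹ • ((p n : ℝ)⁻¹ • (B⁻¹ᵀ *ᵥ (u - fun a => (k a : ℝ)))))
            √(α * α - ((j₀ + 1 : ℕ) : ℝ) * (α * α) / (((2 * m : ℕ) : ℝ) * ((p n : ℝ) ^ i * (p n : ℝ) ^ i)))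
            (latVec B (c (Fin.castLE hNm l)), g l))) (w (j₀ * n + i)) =
          fun a => ((k a / (p n : ℤ) ^ i : ℤ) : ZMod (p n))) :
    ((cvpProg mE).exec W n g w (initState B (p n) α r x fun l => latVec B (c l))).outputVec n =
      latVec B⁻¹ᵀ k := by
  have hp0 : (0 : ℝ) < (p n : ℝ) ^ n := pow_pos (by exact_mod_cast NeZero.pos (p n)) n
  set σ := initState B (p n) α r x fun l => latVec B (c l) with hσ
  set env : ℕ → ℕ := fun k => if k = 0 then n else 0 with henv
  have h0 : env 0 = n := by simp [henv]
  have hsc : (cvpProg mE).Scoped {0} := by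
    simp [cvpProg, cvpSetup, cvpTrial, cvpInit, cvpRound, cvpFinish, addSquares, Prog.guardedFloor,
      invertBasis, setId, solve, solveStep, applyInv, Prog.sumTo, Prog.Scoped,
      NExp.In, RExp.In, hmI]
  have hcore := (Prog.exec_core_eq_den W n g w (cvpProg mE) {0} hsc σ env
    (by simp [hσ, henv, initState])).2
  have hout : ((cvpProg mE).exec W n g w σ).outputVec n =
      WithLp.toLp 2 fun j : Fin n => ((cvpProg mE).den W n g w env σ.core).arr 4 0 j := by
    rw [← hcore]; rfl
  rw [hout]
  obtain ⟨s0, hs0, f03, f5, f7, f8, f9, f10, fcalls⟩ := cvpSetup_spec (W := W) (g := g) (w := w)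
    (s := σ.core) hmE h0 rfl hB (by simp [State.core, hσ, initState])
  have f0 : ∀ i j : Fin n, s0.arr 0 i j = B i j := fun i j => by
    rw [f03 0 (by decide)]; simp [State.core, hσ, initState]
  have f1 : s0.arr 1 0 0 = p n ∧ s0.arr 1 0 1 = α ∧ s0.arr 1 0 2 = r := by
    rw [f03 1 (by decide)]; simp [State.core, hσ, initState]
  have f2 : ∀ j : Fin n, s0.arr 2 0 j = x j := fun j => by
    rw [f03 2 (by decide)]; simp [State.core, hσ, initState]
  have f7' : ∀ j : Fin n, s0.arr 7 0 j = u j := fun j => by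
    rw [f7 j j.2, hu, Finset.sum_range]
    simp [State.core, hσ, initState, mulVec, dotProduct]
  have f8' : ∀ (l : Fin m) (a : Fin n), s0.arr 8 l a = c l a := fun l a => by
    rw [f8 l l.2 a a.2, Finset.sum_range]
    have h1 : ∀ b : Fin n, s0.arr 5 a b * σ.core.arr 3 l b = B⁻¹ a b * (latVec B (c l)).ofLp b := by
      intro b
      rw [f5]
      simp [State.core, hσ, initState]
    simp only [h1]
    have h2 := congrFun (inv_mulVec_mulVec hB fun i => (c l i : ℝ)) a
    exact h2
  rw [guardBound_eq f0 f5 f7' f8'] at f10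
  set T := 1 + (n : ℝ) + ∑ i, ∑ j, B i j ^ 2 + ∑ i, ∑ j, B⁻¹ i j ^ 2 + ∑ j, u j ^ 2 +
      ∑ l, ∑ j, (c l j : ℝ) ^ 2 with hT
  have nB : 0 ≤ ∑ i, ∑ j, B i j ^ 2 := by positivity
  have nC : 0 ≤ ∑ i, ∑ j, B⁻¹ i j ^ 2 := by positivity
  have nu' : 0 ≤ ∑ j, u j ^ 2 := by positivity
  have nc : 0 ≤ ∑ l, ∑ j, (c l j : ℝ) ^ 2 := by positivity
  have nn : (0 : ℝ) ≤ n := Nat.cast_nonneg n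
  -- Invariant over the guesses: once guess j₀ has been tried, the output array holds the closest
  -- point, and later trials cannot spoil it. Every trial makes n oracle calls, which fixes the
  -- indices of the oracle's randomness.
  have key := Prog.den_loop_induct W n g w (x := 4) (e := mE) (c := cvpTrial mE) (env := env)
    (hmE _ h0) (fun j s' => (∀ a ∈ keptArrays, s'.arr a = s0.arr a) ∧ s'.calls = j * n ∧
      (j₀ < j → ∀ a : Fin n, s'.arr 4 0 a = (latVec B⁻¹ᵀ k).ofLp a)) (s := s0)
    ⟨fun _ _ => rfl, by rw [fcalls]; simp [State.core, hσ, initState],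
      fun h => absurd h (Nat.not_lt_zero _)⟩ ?_
  · rw [cvpProg, Prog.den, hs0]
    ext a
    exact key.2.2 hj₀ a
  rintro j hj s' ⟨hk, hcalls, hgood⟩
  have he0 : Function.update env 4 j 0 = n := by simp [h0]
  obtain ⟨s1, hs1, i11, i12, i13, icalls⟩ := cvpInit_spec (W := W) (g := g) (w := w)
    (env := Function.update env 4 j) (s := s') he0
  have k1 : ∀ a ∈ keptArrays, s1.arr a = s0.arr a := fun a ha => by
    rw [← hs1, Prog.den_frame W n g w _ (keptArrays_frame mE ha).1, hk a ha]
  have k14 : s1.arr 4 = s'.arr 4 := by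
    rw [← hs1, Prog.den_frame W n g w _ _]
    simp [cvpInit, Prog.writes]
  obtain ⟨s2, hs2, k2, k24, c2, g2⟩ := cvpRounds_spec (W := W) (g := g) (w := w)
    (env := Function.update env 4 j) (s := s1) (u := u) (k := k) (c := c) (α := α) hmE hNm he0 hB
    (by rw [k1 1 (by decide), f1.1]) (by rw [k1 1 (by decide), f1.2.1])
    (by rw [k1 8 (by decide)]; exact f8') (by rw [k1 9 (by decide)]; exact f9)
    (fun a => by rw [i11 a a.2, hk 7 (by decide), f7']) i12 i13
  have k2' : ∀ a ∈ keptArrays, s2.arr a = s0.arr a := fun a ha => by rw [k2 a ha, k1 a ha]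
  obtain ⟨s3, hs3, c3, K, κ, hKint, hκ, hyes, hno, hKgood⟩ := cvpFinish_spec (W := W) (g := g) (w := w)
    (env := Function.update env 4 j) (s := s2) hmE he0
  rw [cvpTrial, Prog.den, hs1, Prog.den, hs2, hs3]
  refine ⟨fun a ha => ?_, ?_, fun hlt a => ?_⟩
  · rw [← hs3, Prog.den_frame W n g w _ (keptArrays_frame mE ha).2.2, k2' a ha]
  · rw [c3, c2, icalls, hcalls]; ring
  choose KI hKI using hKint
  have hκvec : ∀ a : Fin n, κ a = (latVec B⁻¹ᵀ fun b : Fin n => KI b).ofLp a := by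
    intro a
    rw [hκ, Finset.sum_range, k2' 5 (by decide)]
    simp only [f5, hKI]
    rfl
  have hdist : ∑ a ∈ Finset.range n, (s2.arr 2 0 a - κ a) * (s2.arr 2 0 a - κ a) =
      ‖x - latVec B⁻¹ᵀ fun b : Fin n => KI b‖ ^ 2 := by
    rw [norm_sq_eq_dot, Finset.sum_range, k2' 2 (by decide)]
    simp only [f2, hκvec]
    rfl
  rw [hdist, k2' 1 (by decide), f1.1, f1.2.1, f1.2.2] at hyes hno
  by_cases hif : ‖x - latVec B⁻¹ᵀ fun b : Fin n => KI b‖ ^ 2 * (2 * (r * r)) ≤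
      α * α * ((p n : ℝ) * p n)
  -- An accepted candidate is the closest point, by uniqueness. A rejected one leaves the previous
  -- output; it remains to exclude rejection in trial j₀ itself.
  · rw [hyes hif a a.2, hκvec, huniq _ hif]
  rcases Nat.lt_succ_iff_lt_or_eq.mp hlt with hlt | rfl
  · rw [hno hif, k24, k14]
    exact hgood hlt a
  exfalso
  obtain ⟨g11, g12, g13⟩ := g2 (by
    simp only [icalls, hcalls, Function.update_self]
    exact horacle)
  have hsum : ∀ l : Fin m, ∑ b ∈ Finset.range n, s2.arr 11 0 b * s2.arr 8 l b =
      (fun a => ((k a / (p n : ℤ) ^ n : ℤ) : ℝ) + (u a - k a) / (p n : ℝ) ^ n) ⬝ᵥ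
        fun a => (c l a : ℝ) := by
    intro l
    rw [Finset.sum_range, k2' 8 (by decide)]
    simp only [g11, f8']
    rfl
  refine hif ?_
  have hKk : ∀ a : Fin n, K a = k a := by
    refine hKgood c (fun a => k a / (p n : ℤ) ^ n) k (fun l a => ?_) hspan (fun l => ?_) (fun l => ?_)
      (fun a => ?_) fun a => ?_
    · rw [k2' 8 (by decide), f8']
    · rw [hsum]
      have h1 : (fun a => ((k a / (p n : ℤ) ^ n : ℤ) : ℝ) + (u a - k a) / (p n : ℝ) ^ n) ⬝ᵥ
          (fun a => (c l a : ℝ)) - ((c l ⬝ᵥ fun a => k a / (p n : ℤ) ^ n : ℤ) : ℝ) =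
          ((u - fun a => (k a : ℝ)) ⬝ᵥ fun a => (c l a : ℝ)) / (p n : ℝ) ^ n := by
        simp only [dotProduct, Pi.sub_apply, Int.cast_sum, Int.cast_mul]
        rw [← Finset.sum_sub_distrib, Finset.sum_div]
        exact Finset.sum_congr rfl fun i _ => by ring
      rw [h1, abs_div, abs_of_pos hp0, div_lt_iff₀ hp0]
      linarith [hsmall l]
    · rw [hsum, k2' 10 (by decide), f10]
      -- Cauchy–Schwarz: the target has squared length at most 2(n + ‖u‖²) by `sq_div_sub_le`, and
      -- ‖c_l‖² is part of the sum over all samples.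
      refine sq_add_half_le (a := n + ∑ j, u j ^ 2) (b := ∑ l, ∑ j, (c l j : ℝ) ^ 2) ?_ (by positivity)
        nc (by linarith)
      refine (dot_sq_le _ _).trans ?_
      have h1 : (fun a => ((k a / (p n : ℤ) ^ n : ℤ) : ℝ) + (u a - k a) / (p n : ℝ) ^ n) ⬝ᵥ
          (fun a => ((k a / (p n : ℤ) ^ n : ℤ) : ℝ) + (u a - k a) / (p n : ℝ) ^ n) ≤
          2 * (n + ∑ j, u j ^ 2) := by
        calc _ ≤ ∑ a, 2 * (u a ^ 2 + 1) := Finset.sum_le_sum fun a _ => by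
              rw [← sq]
              exact sq_div_sub_le (k a) (u a) n
          _ = _ := by
            rw [← Finset.mul_sum, Finset.sum_add_distrib]
            simp [add_comm]
      have h2 : (fun a => (c l a : ℝ)) ⬝ᵥ (fun a => (c l a : ℝ)) ≤ ∑ l, ∑ j, (c l j : ℝ) ^ 2 := by
        have := Finset.single_le_sum (f := fun l => ∑ j, (c l j : ℝ) ^ 2)
          (fun i _ => by positivity) (Finset.mem_univ l)
        refine le_trans (le_of_eq ?_) this
        exact Finset.sum_congr rfl fun j _ => (sq _).symm
      exact mul_le_mul h1 h2 (dot_self_nonneg _) (by positivity)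
    · rw [g13, g12]; ring
    · rw [k2' 10 (by decide), f10]
      have h3 : u a ^ 2 ≤ ∑ j, u j ^ 2 := Finset.single_le_sum (f := fun j => u j ^ 2)
        (fun i _ => sq_nonneg _) (Finset.mem_univ a)
      exact sq_add_half_le' h3 (hkd a) nB nC nu' (by linarith)
  have : (fun b : Fin n => KI b) = k := by
    funext b
    have := hKk b
    rw [hKI] at this
    exact_mod_cast this
  rw [this]
  exact hclose

end LWERed

/-! ### Running time of the closest vector program -/

namespace LWERed

open Matrix

lemma bits_le_of_le_two_pow {t : ℝ} {e : ℕ} (h : |t| ≤ 2 ^ e) : bits t ≤ e + 1 := by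
  rw [bits, Nat.size_le]
  have : ⌈|t|⌉₊ ≤ 2 ^ e := Nat.ceil_le.mpr (by exact_mod_cast h)
  exact this.trans_lt (Nat.pow_lt_pow_right (by norm_num) (Nat.lt_succ_self e))

lemma abs_le_two_pow_bits (t : ℝ) {S : ℕ} (h : bits t ≤ S) : |t| ≤ 2 ^ S := by
  have h1 : ⌈|t|⌉₊ < 2 ^ S := Nat.size_le.mp h
  exact (Nat.le_ceil _).trans (by exact_mod_cast h1.le)

lemma abs_sum_mul_le {n S : ℕ} {a b : Fin n → ℝ} (hn : n ≤ S) (ha : ∀ i, |a i| ≤ 2 ^ S)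
    (hb : ∀ i, |b i| ≤ 2 ^ S) : |∑ i, a i * b i| ≤ 2 ^ (3 * S) := by
  have hn2 : (n : ℝ) ≤ 2 ^ S := by exact_mod_cast hn.trans Nat.lt_two_pow_self.le
  calc |∑ i, a i * b i| ≤ ∑ i, |a i * b i| := Finset.abs_sum_le_sum_abs _ _
    _ ≤ ∑ _i : Fin n, (2 : ℝ) ^ S * 2 ^ S := Finset.sum_le_sum fun i _ => by
        rw [abs_mul]
        exact mul_le_mul (ha i) (hb i) (abs_nonneg _) (by positivity)
    _ = n * (2 ^ S * 2 ^ S) := by simp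
    _ ≤ 2 ^ S * (2 ^ S * 2 ^ S) := by gcongr
    _ = 2 ^ (3 * S) := by ring

lemma sum_sum_sq_le {m n e f : ℕ} {a : Fin m → Fin n → ℝ} (hm : m ≤ f) (hn : n ≤ e)
    (ha : ∀ i j, |a i j| ≤ 2 ^ e) : ∑ i, ∑ j, a i j ^ 2 ≤ 2 ^ (f + 3 * e) := by
  have hn2 : (n : ℝ) ≤ 2 ^ e := by exact_mod_cast hn.trans Nat.lt_two_pow_self.le
  have hm2 : (m : ℝ) ≤ 2 ^ f := by exact_mod_cast hm.trans Nat.lt_two_pow_self.le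
  calc ∑ i, ∑ j, a i j ^ 2 ≤ ∑ _i : Fin m, ∑ _j : Fin n, ((2 : ℝ) ^ e) ^ 2 :=
        Finset.sum_le_sum fun i _ => Finset.sum_le_sum fun j _ => by
          rw [← sq_abs]
          exact pow_le_pow_left₀ (abs_nonneg _) (ha i j) 2
    _ = m * (n * (2 ^ e) ^ 2) := by simp
    _ ≤ 2 ^ f * (2 ^ e * (2 ^ e) ^ 2) := by gcongr
    _ = 2 ^ (f + 3 * e) := by ring

section time

variable {p N : ℕ → ℕ} {Ω : Type*} [MeasurableSpace Ω] {W : Oracle p N Ω}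

lemma Prog.polyTimed_cvpSetup {mE : NExp} (hm : mE.In {0}) : (cvpSetup mE).PolyTimed W False := by
  have h0 : (reg 0).In {0} := by simp [NExp.In]
  have hsq : ∀ {a : ℕ} {mE qE : NExp}, mE.In {0} → qE.In {0} →
      (addSquares a mE qE).PolyTimed W False := fun hm hq =>
    ((polyTimed_setR False.elim (by simp [RExp.FloorFree])).loop (by decide) hq).loop (by decide) hm
  exact polyTimed_invertBasis.seq
    (((polyTimed_sumTo False.elim (by decide) h0 (by simp [RExp.FloorFree])).loop (by decide) h0).seq
    (((polyTimed_applyInv False.elim).loop (by decide) hm).seq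
    (((polyTimed_gauss False.elim).loop (by decide) hm).seq
    ((polyTimed_setR False.elim (by simp [RExp.FloorFree])).seq
    ((hsq h0 h0).seq ((hsq h0 h0).seq ((hsq (by simp [NExp.In]) h0).seq ((hsq hm h0).seq
      (polyTimed_setR False.elim (by simp [RExp.FloorFree]))))))))))

lemma Prog.polyTimed_cvpTrial (hN : PolyBdd N) {mE : NExp} (hm : mE.In {0}) :
    (cvpTrial mE).PolyTimed W True := by
  have h0 : (reg 0).In {0} := by simp [NExp.In]
  have hinit : cvpInit.PolyTimed W True :=
    ((polyTimed_setR (fun _ => by decide) (by simp [RExp.FloorFree])).loop (by decide) h0).seq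
    ((polyTimed_setR (fun _ => by decide) (by simp [RExp.FloorFree])).seq
    ((polyTimed_setR (fun _ => by decide) (by simp [RExp.FloorFree])).loop (by decide) h0))
  have hround : (cvpRound mE).PolyTimed W True :=
    (((polyTimed_setR (fun _ => by decide) (by simp [RExp.FloorFree])).loop (by decide) h0).loop
      (by decide) hm).seq
    ((((polyTimed_sumTo (fun _ => by decide) (by decide) h0 (by simp [RExp.FloorFree])).seq
      (polyTimed_setR (fun _ => by decide) (by simp [RExp.FloorFree]))).loop (by decide) hm).seq
    ((polyTimed_call hN (fun _ => by decide)).seq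
    (((polyTimed_setR (fun _ => by decide) (by simp [RExp.FloorFree])).loop (by decide) h0).seq
    (((polyTimed_setR (fun _ => by decide) (by simp [RExp.FloorFree])).loop (by decide) h0).seq
    (polyTimed_setR (fun _ => by decide) (by simp [RExp.FloorFree]))))))
  have hfinish : (cvpFinish mE).PolyTimed W True :=
    (((polyTimed_sumTo (fun _ => by decide) (by decide) h0 (by simp [RExp.FloorFree])).seq
      (polyTimed_guardedFloor trivial (by decide) (by simp [RExp.FloorFree]))).loop (by decide) hm).seq
    ((polyTimed_solve hm (by simp [NExp.In]) (fun _ => by decide)).seq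
    (((polyTimed_guardedFloor trivial (by decide) (by simp [RExp.FloorFree])).loop (by decide) h0).seq
    (((polyTimed_sumTo (fun _ => by decide) (by decide) h0 (by simp [RExp.FloorFree])).loop
      (by decide) h0).seq
    ((polyTimed_sumTo (fun _ => by decide) (by decide) h0 (by simp [RExp.FloorFree])).seq
    (PolyTimed.ifLe ((polyTimed_setR (fun _ => by decide) (by simp [RExp.FloorFree])).loop
      (by decide) h0) polyTimed_skip (by simp [RExp.FloorFree]) (by simp [RExp.FloorFree]))))))
  exact hinit.seq ((hround.loop (by decide) h0).seq hfinish)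

/-- The setup never rounds and is timed without reference to the guard, which it is still computing.
The trials are timed relative to the actual guard H, whose length is polynomial: H comes from sums
of squares of numbers obtained from the input and the inverse basis, and the entries of the latter
count in the input length. -/
lemma cvpProg_polyTime {mE : NExp} {m : ℕ → ℕ} (hmE : ∀ (n : ℕ) (e : ℕ → ℕ), e 0 = n → mE.ev e = m n)
    (hmI : ∀ X : Finset ℕ, 0 ∈ X → mE.In X) (hm : PolyBdd m) (hN : PolyBdd N) (α : ℕ → ℝ) :
    (cvpProg mE).PolyTime W α m := by
  obtain ⟨f₁, ⟨K₁, hK₁⟩, hf₁⟩ := Prog.polyTimed_cvpSetup (W := W) (hmI {0} (by simp))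
  obtain ⟨f₂, ⟨K₂, hK₂⟩, hf₂⟩ := (Prog.polyTimed_cvpTrial (W := W) hN (hmI {0} (by simp))).loop
    (x := 4) (by decide) (hmI {0} (by simp))
  obtain ⟨K₃, hK₃⟩ := hm
  have hpoly : PolyBdd fun S => K₁ * (S + 1) ^ K₁ +
      K₂ * (S + (2 * (K₃ * (S + 1) ^ K₃) + 18 * S + 9) + 1) ^ K₂ := by
    have hP : ∀ K, PolyBdd fun S => K * (S + 1) ^ K := fun K => .of_pow fun s => le_rfl
    exact (hP K₁).add ((PolyBdd.const K₂).mul ((((PolyBdd.id.add ((((PolyBdd.const 2).mul (hP K₃)).add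
      ((PolyBdd.const 18).mul .id)).add (.const 9))).add (.const 1))).pow K₂))
  obtain ⟨K, hK⟩ := hpoly
  refine ⟨K, fun n B hB r _ x v g w => le_trans ?_ (hK (inputSize B (p n) (α n) r x v))⟩
  set S := inputSize B (p n) (α n) r x v with hS
  set σ := initState B (p n) (α n) r x v with hσ
  obtain ⟨ht1, -, ht2⟩ := hf₁ n g w 0 σ rfl (fun h => h.elim)
  set τ := (cvpSetup mE).exec W n g w σ with hτ
  obtain ⟨-, -, ht3⟩ := hf₂ n g w (τ.arr 10 0 0) τ ht1 (fun _ => rfl)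
  have hnS : n ≤ S := by rw [hS, inputSize]; omega
  have hBS : ∀ i j, bits (B i j) + bits (B⁻¹ i j) ≤ S := fun i j => by
    have h1 := Finset.single_le_sum (f := fun i => ∑ j, (bits (B i j) + bits (B⁻¹ i j)))
      (fun _ _ => Nat.zero_le _) (Finset.mem_univ i)
    have h2 := Finset.single_le_sum (f := fun j => bits (B i j) + bits (B⁻¹ i j))
      (fun _ _ => Nat.zero_le _) (Finset.mem_univ j)
    rw [hS, inputSize]
    beta_reduce at h1 h2
    omega
  have hxS : ∀ j, bits (x j) ≤ S := fun j => by
    have h1 := Finset.single_le_sum (f := fun j => bits (x j)) (fun _ _ => Nat.zero_le _)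
      (Finset.mem_univ j)
    rw [hS, inputSize]
    beta_reduce at h1
    omega
  have hvS : ∀ l j, bits (v l j) ≤ S := fun l j => by
    have h1 := Finset.single_le_sum (f := fun l => ∑ j, bits (v l j))
      (fun _ _ => Nat.zero_le _) (Finset.mem_univ l)
    have h2 := Finset.single_le_sum (f := fun j => bits (v l j))
      (fun _ _ => Nat.zero_le _) (Finset.mem_univ j)
    rw [hS, inputSize]
    beta_reduce at h1 h2
    omega
  have hB' : ∀ i j, |B i j| ≤ 2 ^ S := fun i j =>
    abs_le_two_pow_bits _ ((Nat.le_add_right _ _).trans (hBS i j))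
  have hC' : ∀ i j, |B⁻¹ i j| ≤ 2 ^ S := fun i j =>
    abs_le_two_pow_bits _ ((Nat.le_add_left _ _).trans (hBS i j))
  have hx' : ∀ j, |x j| ≤ 2 ^ S := fun j => abs_le_two_pow_bits _ (hxS j)
  have hv' : ∀ l j, |v l j| ≤ 2 ^ S := fun l j => abs_le_two_pow_bits _ (hvS l j)
  have hbits : bits (τ.arr 10 0 0) ≤ 2 * m n + 18 * S + 9 := by
    set env : ℕ → ℕ := fun k => if k = 0 then n else 0 with henv
    have h0 : env 0 = n := by simp [henv]
    have hsc : (cvpSetup mE).Scoped {0} := by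
      simp [cvpSetup, addSquares, invertBasis, setId, solve, solveStep, applyInv, Prog.sumTo,
        Prog.Scoped, NExp.In, RExp.In, hmI]
    have hcore := (Prog.exec_core_eq_den W n g w (cvpSetup mE) {0} hsc σ env
      (by simp [hσ, henv, initState])).2
    obtain ⟨s0, hs0, f03, f5, f7, f8, f9, f10, -⟩ := cvpSetup_spec (W := W) (g := g) (w := w)
      (s := σ.core) (hmE n) h0 rfl hB (by simp [State.core, hσ, initState])
    have f0 : ∀ i j : Fin n, s0.arr 0 i j = B i j := fun i j => by
      rw [f03 0 (by decide)]; simp [State.core, hσ, initState]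
    have f7' : ∀ j : Fin n, s0.arr 7 0 j = ∑ b, B b j * x b := fun j => by
      rw [f7 j j.2, Finset.sum_range]
      simp [State.core, hσ, initState]
    have f8' : ∀ (l : Fin (m n)) (a : Fin n), s0.arr 8 l a = ∑ b, B⁻¹ a b * v l b := fun l a => by
      rw [f8 l l.2 a a.2, Finset.sum_range]
      simp only [f5]
      simp [State.core, hσ, initState]
    have harr : τ.arr 10 0 0 = s0.arr 10 0 0 := by
      rw [← hs0, ← hcore]; rfl
    rw [guardBound_eq f0 f5 f7' f8'] at f10
    -- Coordinates are inner products of vectors with entries up to 2^S, hence at most 2^(3S); the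
    -- sum of their squares over m samples is at most 2^(m + 9S). The crude m ≤ 2^m suffices as m is
    -- polynomial.
    set M : ℝ := 2 ^ (m n + 9 * S) with hM
    have hle : ∀ e, e ≤ m n + 9 * S → (2 : ℝ) ^ e ≤ M := fun e he =>
      pow_le_pow_right₀ (by norm_num) he
    have g0 : (1 : ℝ) ≤ M := one_le_pow₀ (by norm_num)
    have g1 : ∑ i, ∑ j, B i j ^ 2 ≤ M := (sum_sum_sq_le (f := S) hnS hnS hB').trans (hle _ (by omega))
    have g2 : ∑ i, ∑ j, B⁻¹ i j ^ 2 ≤ M :=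
      (sum_sum_sq_le (f := S) hnS hnS hC').trans (hle _ (by omega))
    have g3 : ∑ j, (∑ b, B b j * x b) ^ 2 ≤ 2 * M := by
      have := sum_sum_sq_le (m := 1) (f := 1) (e := 3 * S) (a := fun _ j => ∑ b, B b j * x b) le_rfl
        (by omega : n ≤ 3 * S) (fun _ j => abs_sum_mul_le hnS (fun b => hB' b j) hx')
      simp only [Finset.univ_unique, Finset.sum_const, Finset.card_singleton, one_smul] at this
      refine this.trans ?_
      rw [pow_add, pow_one]
      exact mul_le_mul_of_nonneg_left (hle _ (by omega)) (by norm_num)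
    have g4 : ∑ l, ∑ j, (∑ b, B⁻¹ j b * v l b) ^ 2 ≤ M :=
      (sum_sum_sq_le (f := m n) (e := 3 * S) le_rfl (by omega : n ≤ 3 * S)
        (fun l j => abs_sum_mul_le hnS (hC' j) (hv' l))).trans (hle _ (by omega))
    have g5 : (n : ℝ) ≤ M := by
      refine le_trans ?_ (hle S (by omega))
      exact_mod_cast hnS.trans Nat.lt_two_pow_self.le
    set T := 1 + (n : ℝ) + ∑ i, ∑ j, B i j ^ 2 + ∑ i, ∑ j, B⁻¹ i j ^ 2 +
      ∑ j, (∑ b, B b j * x b) ^ 2 + ∑ l, ∑ j, (∑ b, B⁻¹ j b * v l b) ^ 2 with hT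
    have hT0 : 0 ≤ T := by positivity
    have hT8 : T ≤ 8 * M := by linarith
    refine (bits_le_of_le_two_pow (e := 2 * m n + 18 * S + 8) ?_)
    rw [harr, f10, abs_of_nonneg (by positivity)]
    calc 4 * (T * T) ≤ 4 * ((8 * M) * (8 * M)) := by gcongr
      _ = 2 ^ (2 * m n + 18 * S + 8) := by rw [hM]; ring
  refine ht3.trans ?_
  have h2 : σ.time = 0 := rfl
  rw [h2, zero_add] at ht2
  have hb0 : bits 0 = 0 := by simp [bits]
  refine Nat.add_le_add (ht2.trans ((hK₁ _).trans (Nat.mul_le_mul_left _ (Nat.pow_le_pow_left ?_ _))))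
    ((hK₂ _).trans (Nat.mul_le_mul_left _ (Nat.pow_le_pow_left ?_ _)))
  · rw [hb0]; omega
  · have h3 : m n ≤ K₃ * (S + 1) ^ K₃ := (hK₃ n).trans
      (Nat.mul_le_mul_left _ (Nat.pow_le_pow_left (by omega) _))
    omega

end time

end LWERed

namespace LWERed

open Matrix

/-! ### Probabilities of failure -/

/-- On boxes the inequality is a product of inequalities. It extends to all measurable sets because
the outer measure defining the product is the largest one with the given bounds on boxes. -/
lemma pi_le_pow_smul_pi {N : ℕ} {X : Type*} [MeasurableSpace X] {μ ν : Measure X} [SigmaFinite μ]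
    [SigmaFinite ν] {C : ENNReal} (hC0 : C ≠ 0) (hC : C ≠ ⊤) (h : μ ≤ C • ν) :
    (Measure.pi fun _ : Fin N => μ) ≤ C ^ N • Measure.pi fun _ : Fin N => ν := by
  have hN0 : C ^ N ≠ 0 := pow_ne_zero _ hC0
  have hN : C ^ N ≠ ⊤ := ENNReal.pow_ne_top hC
  have h1 : ((C ^ N)⁻¹ • Measure.pi fun _ : Fin N => μ).toOuterMeasure ≤
      OuterMeasure.pi fun _ : Fin N => ν.toOuterMeasure := by
    rw [OuterMeasure.le_pi]
    intro s _
    change (C ^ N)⁻¹ * (Measure.pi fun _ : Fin N => μ) (Set.univ.pi s) ≤ ∏ i, ν (s i)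
    rw [Measure.pi_pi]
    calc (C ^ N)⁻¹ * ∏ i, μ (s i) ≤ (C ^ N)⁻¹ * ∏ i, C * ν (s i) := by
          gcongr with i
          exact h (s i)
      _ = (C ^ N)⁻¹ * C ^ N * ∏ i, ν (s i) := by
          rw [Finset.prod_mul_distrib, Finset.prod_const, Finset.card_univ, Fintype.card_fin, mul_assoc]
      _ = ∏ i, ν (s i) := by rw [ENNReal.inv_mul_cancel hN0 hN, one_mul]
  refine Measure.le_iff.mpr fun S hS => ?_
  have h2 : (C ^ N)⁻¹ * (Measure.pi fun _ : Fin N => μ) S ≤ (Measure.pi fun _ : Fin N => ν) S := by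
    rw [Measure.pi_def (fun _ : Fin N => ν), toMeasure_apply _ _ hS]
    exact h1 S
  rw [Measure.smul_apply, smul_eq_mul]
  calc (Measure.pi fun _ : Fin N => μ) S = C ^ N * ((C ^ N)⁻¹ * (Measure.pi fun _ : Fin N => μ) S) := by
        rw [← mul_assoc, ENNReal.mul_inv_cancel hN0 hN, one_mul]
    _ ≤ _ := by gcongr

/-- The oracle errs rarely on samples whose noise is slightly too small and whose law is slightly
wrong. -/
lemma oracle_failure_le {p N : ℕ → ℕ} {Ω : Type*} [MeasurableSpace Ω] (W : Oracle p N Ω)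
    (P : Measure Ω) [IsProbabilityMeasure P] {n : ℕ} [NeZero (p n)] {B : Matrix (Fin n) (Fin n) ℝ}
    (hB : B.det ≠ 0) {r : ℝ} (hr : 0 < r) {m : ℕ} (hNm : N n ≤ m) (j : ℕ) {z : Fin n → ℝ}
    {σ β α C : ℝ} (hβ : 0 < β) (hβα : β ≤ α) (hC : 0 < C)
    (hle : ((discreteGaussian (lattice B) r).prod (nu 1)).map (jointMap B (p n) z σ) ≤
      ENNReal.ofReal C • (uniformOn (Set.univ : Set (Fin n → ZMod (p n)))).prod (nu β))
    (s : Fin n → ZMod (p n)) {η : ENNReal}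
    (hs : ((Measure.pi fun _ : Fin (N n) => lweDist s (Psi α)).prod P) {q | W.out n q.1 q.2 ≠ s} ≤ η) :
    runLaw (lattice B) r m P {q | W.out n (fun l : Fin (N n) => lweMap s
        (jointMap B (p n) z σ (q.1 (Fin.castLE hNm l), q.2.1 l))) (q.2.2 j) ≠ s} ≤
      ENNReal.ofReal (C * (α / β)) ^ N n * η := by
  have := isProbabilityMeasure_discreteGaussian hB hr
  set D := (discreteGaussian (lattice B) r).prod (nu 1) with hD
  have hjm := measurable_jointMap B (p n) z σ
  have hlm := measurable_lweMap s
  have hpj : IsProbabilityMeasure ((D.map (jointMap B (p n) z σ)).map (lweMap s)) := by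
    have := Measure.isProbabilityMeasure_map (μ := D) hjm.aemeasurable
    exact Measure.isProbabilityMeasure_map hlm.aemeasurable
  have hlwe : IsProbabilityMeasure (lweDist s (Psi α)) := by
    rw [lweDist_Psi]
    exact Measure.isProbabilityMeasure_map hlm.aemeasurable
  have hα : 0 < α := hβ.trans_le hβα
  have h1 : (D.map (jointMap B (p n) z σ)).map (lweMap s) ≤
      ENNReal.ofReal (C * (α / β)) • lweDist s (Psi α) := by
    calc _ ≤ (ENNReal.ofReal C • (uniformOn (Set.univ : Set (Fin n → ZMod (p n)))).prod (nu β)).map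
          (lweMap s) := Measure.map_mono hle hlm
      _ ≤ (ENNReal.ofReal C • (uniformOn (Set.univ : Set (Fin n → ZMod (p n)))).prod
          (ENNReal.ofReal (α / β) • nu α)).map (lweMap s) := by
          refine Measure.map_mono ?_ hlm
          have := Measure.prod_mono (le_refl (uniformOn (Set.univ : Set (Fin n → ZMod (p n)))))
            (nu_le_smul_nu hβ hβα)
          gcongr
      _ = _ := by
          rw [Measure.prod_smul_right, smul_smul, Measure.map_smul, ← lweDist_Psi,
            ENNReal.ofReal_mul hC.le]
  have hC' : 0 < C * (α / β) := by positivity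
  have h2 := pi_le_pow_smul_pi (N := N n) (by simpa using hC') ENNReal.ofReal_ne_top h1
  have hmp : MeasurePreserving (fun q : (Fin m → E n) × (ℕ → ℝ) × (ℕ → Ω) =>
      ((fun l : Fin (N n) => lweMap s (jointMap B (p n) z σ (q.1 (Fin.castLE hNm l), q.2.1 l))), q.2.2 j))
      (runLaw (lattice B) r m P)
      ((Measure.pi fun _ : Fin (N n) => (D.map (jointMap B (p n) z σ)).map (lweMap s)).prod P) := by
    have h3 := (measurePreserving_pi_comp (ι := Fin m) D (Fin.castLE_injective hNm)).prod
      (MeasurePreserving.id P) |>.comp (measurePreserving_runLaw P (lattice B) r m j)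
    have h4 : MeasurePreserving (fun (x : Fin (N n) → E n × ℝ) l => lweMap s (jointMap B (p n) z σ (x l)))
        (Measure.pi fun _ => D)
        (Measure.pi fun _ : Fin (N n) => (D.map (jointMap B (p n) z σ)).map (lweMap s)) := by
      have h5 : IsProbabilityMeasure (D.map fun x => lweMap s (jointMap B (p n) z σ x)) :=
        Measure.isProbabilityMeasure_map (hlm.comp hjm).aemeasurable
      refine ⟨measurable_pi_lambda _ fun l => hlm.comp (hjm.comp (measurable_pi_apply l)), ?_⟩
      rw [Measure.pi_map_pi (f := fun _ x => lweMap s (jointMap B (p n) z σ x))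
        (fun _ => (hlm.comp hjm).aemeasurable)]
      congr 1
      funext _
      exact (Measure.map_map hlm hjm).symm
    exact (h4.prod (MeasurePreserving.id P)).comp h3
  -- Only an upper bound is needed, so no measurability of the failure event is required.
  refine (Measure.le_map_apply hmp.aemeasurable {q | W.out n q.1 q.2 ≠ s}).trans ?_
  rw [hmp.map_eq]
  refine (Measure.prod_mono h2 (le_refl P) _).trans ?_
  rw [Measure.prod_smul_left, Measure.smul_apply, smul_eq_mul]
  gcongr

/-! ### Large inner products -/

/-- Chebyshev's inequality; the variance β²/(2π) is at most 1. -/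
lemma nu_tail {β R : ℝ} (hβ1 : β ^ 2 ≤ 1) (hR : 0 < R) :
    nu β {t | R ≤ |t|} ≤ ENNReal.ofReal (1 / R ^ 2) := by
  have h := meas_ge_le_variance_div_sq (μ := nu β) (X := id) (memLp_id_gaussianReal 2) hR
  rw [nu, variance_id_gaussianReal, ← nu] at h
  have hint : ∫ x, x ∂(nu β) = 0 := by
    rw [nu]
    exact integral_id_gaussianReal
  simp only [id, hint, sub_zero] at h
  refine h.trans (ENNReal.ofReal_le_ofReal ?_)
  gcongr
  rw [Real.coe_toNNReal _ (by positivity), div_le_one (by positivity)]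
  nlinarith [Real.pi_gt_three]

/-- Write ⟨z,v⟩ as the blurred inner product minus the blur. Both have normal tails, the first up to
the factor C, so one of them must exceed R. -/
lemma dot_tail {n : ℕ} {B : Matrix (Fin n) (Fin n) ℝ} (hB : B.det ≠ 0) {r : ℝ} (hr : 0 < r)
    {q : ℕ} [NeZero q] {z : Fin n → ℝ} {σ β C R : ℝ} (hσ : σ ^ 2 ≤ 1) (hβ1 : β ^ 2 ≤ 1) (hC : 0 ≤ C)
    (hR : 0 < R)
    (hle : ((discreteGaussian (lattice B) r).prod (nu 1)).map (jointMap B q z σ) ≤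
      ENNReal.ofReal C • (uniformOn (Set.univ : Set (Fin n → ZMod q))).prod (nu β)) :
    ((discreteGaussian (lattice B) r).prod (nu 1)) {a | 2 * R ≤ |z ⬝ᵥ a.1.ofLp|} ≤
      ENNReal.ofReal ((C + 1) / R ^ 2) := by
  have := isProbabilityMeasure_discreteGaussian hB hr
  set D := (discreteGaussian (lattice B) r).prod (nu 1) with hD
  have hsub : {a : E n × ℝ | 2 * R ≤ |z ⬝ᵥ a.1.ofLp|} ⊆
      (jointMap B q z σ ⁻¹' (Prod.snd ⁻¹' {t | R ≤ |t|})) ∪ (Prod.snd ⁻¹' ((fun g => σ * g) ⁻¹' {t | R ≤ |t|})) := by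
    intro a ha
    by_contra hcon
    simp only [Set.mem_union, Set.mem_preimage, Set.mem_ofPred_eq, jointMap, not_or, not_le] at hcon ha
    have : |z ⬝ᵥ a.1.ofLp| ≤ |z ⬝ᵥ a.1.ofLp + σ * a.2| + |σ * a.2| := by
      have := abs_sub (z ⬝ᵥ a.1.ofLp + σ * a.2) (σ * a.2)
      rwa [add_sub_cancel_right] at this
    linarith
  refine (measure_mono hsub).trans ((measure_union_le _ _).trans ?_)
  rw [add_div, ENNReal.ofReal_add (by positivity) (by positivity)]
  refine add_le_add ?_ ?_
  · refine (Measure.le_map_apply (measurable_jointMap B q z σ).aemeasurable _).trans ((hle _).trans ?_)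
    rw [Measure.smul_apply, smul_eq_mul, div_eq_mul_one_div, ENNReal.ofReal_mul hC]
    gcongr
    refine (Measure.le_map_apply measurable_snd.aemeasurable _).trans ?_
    rw [Measure.map_snd_prod, measure_univ, one_smul]
    exact nu_tail hβ1 hR
  · refine (Measure.le_map_apply measurable_snd.aemeasurable _).trans ?_
    rw [hD, Measure.map_snd_prod, measure_univ, one_smul]
    refine (Measure.le_map_apply (by fun_prop) _).trans ?_
    rw [nu_map_mul]
    exact nu_tail hσ hR

end LWERed

namespace LWERed

open Matrix

/-! ### Samples span the space -/

/-- Translation by a basis vector at a coordinate where ζ is nonzero maps the hyperplane to a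
disjoint set of equal measure. -/
lemma uniformOn_orthogonal_le {n : ℕ} {ζ : Fin n → ZMod 2} (hζ : ζ ≠ 0) :
    uniformOn (Set.univ : Set (Fin n → ZMod 2)) {a | a ⬝ᵥ ζ = 0} ≤ ENNReal.ofReal (1 / 2) := by
  obtain ⟨i, hi⟩ : ∃ i, ζ i ≠ 0 := by
    by_contra! h
    exact hζ (funext h)
  set S : Set (Fin n → ZMod 2) := {a | a ⬝ᵥ ζ = 0} with hS
  set f : (Fin n → ZMod 2) → (Fin n → ZMod 2) := fun a => a + Pi.single i 1 with hf
  have hinj : f.Injective := add_left_injective _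
  have hdisj : Disjoint S (f '' S) := by
    rw [Set.disjoint_left]
    rintro _ ha ⟨b, hb, rfl⟩
    simp only [hS, Set.mem_ofPred_eq, hf, add_dotProduct, single_one_dotProduct] at ha hb
    rw [hb, zero_add] at ha
    exact hi ha
  have himg : uniformOn (Set.univ : Set (Fin n → ZMod 2)) (f '' S) = uniformOn Set.univ S := by
    rw [uniformOn_univ, uniformOn_univ, Measure.count_injective_image hinj]
  have h1 : uniformOn (Set.univ : Set (Fin n → ZMod 2)) S + uniformOn Set.univ S ≤ 1 := by
    nth_rw 2 [← himg]
    rw [← measure_union hdisj (Set.toFinite _).measurableSet]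
    exact prob_le_one
  have h2 : ENNReal.ofReal (1 / 2) = 2⁻¹ := by
    rw [one_div, ENNReal.ofReal_inv_of_pos (by norm_num)]
    norm_num
  rw [h2, ENNReal.le_inv_iff_mul_le, mul_two]
  exact h1

/-- Taking z = 0 leaves only the residues modulo 2, nearly uniform up to the factor C. Each of the
at most 2ⁿ vectors ζ is orthogonal to all m samples with probability at most (C/2)^m. -/
lemma span_failure_le {Ω : Type*} [MeasurableSpace Ω] (P : Measure Ω) [IsProbabilityMeasure P]
    {n : ℕ} {B : Matrix (Fin n) (Fin n) ℝ} (hB : B.det ≠ 0) {r : ℝ} (hr : 0 < r) (m : ℕ)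
    {C σ β : ℝ} (hC : 0 ≤ C)
    (hle : ((discreteGaussian (lattice B) r).prod (nu 1)).map (jointMap B 2 0 σ) ≤
      ENNReal.ofReal C • (uniformOn (Set.univ : Set (Fin n → ZMod 2))).prod (nu β)) :
    runLaw (lattice B) r m P {q | ∃ ζ : Fin n → ZMod 2, ζ ≠ 0 ∧ ∀ l, coordMod B 2 (q.1 l) ⬝ᵥ ζ = 0} ≤
      ENNReal.ofReal (2 ^ n * (C / 2) ^ m) := by
  have := isProbabilityMeasure_discreteGaussian hB hr
  have hcm := measurable_coordMod B 2
  have h1 : ∀ ζ : Fin n → ZMod 2, ζ ≠ 0 → discreteGaussian (lattice B) r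
      {v | coordMod B 2 v ⬝ᵥ ζ = 0} ≤ ENNReal.ofReal (C / 2) := by
    intro ζ hζ
    have hpre : discreteGaussian (lattice B) r {v | coordMod B 2 v ⬝ᵥ ζ = 0} =
        ((discreteGaussian (lattice B) r).prod (nu 1)) (jointMap B 2 0 σ ⁻¹' (Prod.fst ⁻¹' {a | a ⬝ᵥ ζ = 0})) := by
      have : jointMap B 2 0 σ ⁻¹' (Prod.fst ⁻¹' {a | a ⬝ᵥ ζ = 0}) =
          {v | coordMod B 2 v ⬝ᵥ ζ = 0} ×ˢ (Set.univ : Set ℝ) := by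
        ext a
        simp [jointMap]
      rw [this, Measure.prod_prod, measure_univ, mul_one]
    rw [hpre]
    refine (Measure.le_map_apply (measurable_jointMap B 2 0 σ).aemeasurable _).trans ((hle _).trans ?_)
    rw [Measure.smul_apply, smul_eq_mul, div_eq_mul_one_div, ENNReal.ofReal_mul hC]
    gcongr
    refine (Measure.le_map_apply measurable_fst.aemeasurable _).trans ?_
    rw [Measure.map_fst_prod, measure_univ, one_smul]
    exact uniformOn_orthogonal_le hζ
  have h2 : ∀ ζ : Fin n → ZMod 2, runLaw (lattice B) r m P
      {q | ζ ≠ 0 ∧ ∀ l, coordMod B 2 (q.1 l) ⬝ᵥ ζ = 0} ≤ ENNReal.ofReal ((C / 2) ^ m) := by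
    intro ζ
    by_cases hζ : ζ = 0
    · simp [hζ]
    have hsub : {q : (Fin m → E n) × (ℕ → ℝ) × (ℕ → Ω) | ζ ≠ 0 ∧ ∀ l, coordMod B 2 (q.1 l) ⬝ᵥ ζ = 0} ⊆
        Prod.fst ⁻¹' (Set.univ.pi fun _ : Fin m => {v | coordMod B 2 v ⬝ᵥ ζ = 0}) := by
      rintro q ⟨-, hq⟩ l -
      exact hq l
    refine (measure_mono hsub).trans ((Measure.le_map_apply measurable_fst.aemeasurable _).trans ?_)
    rw [runLaw, Measure.map_fst_prod, measure_univ, one_smul, Measure.pi_pi, Finset.prod_const,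
      Finset.card_univ, Fintype.card_fin, ENNReal.ofReal_pow (by positivity)]
    gcongr
    exact h1 ζ hζ
  have hset : {q : (Fin m → E n) × (ℕ → ℝ) × (ℕ → Ω) | ∃ ζ : Fin n → ZMod 2, ζ ≠ 0 ∧
      ∀ l, coordMod B 2 (q.1 l) ⬝ᵥ ζ = 0} =
      ⋃ ζ : Fin n → ZMod 2, {q | ζ ≠ 0 ∧ ∀ l, coordMod B 2 (q.1 l) ⬝ᵥ ζ = 0} := by
    ext q
    simp
  rw [hset]
  refine (measure_iUnion_fintype_le _ _).trans ((Finset.sum_le_sum fun ζ _ => h2 ζ).trans ?_)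
  rw [Finset.sum_const, Finset.card_univ, Fintype.card_fun, ZMod.card, Fintype.card_fin, nsmul_eq_mul,
    ENNReal.ofReal_mul (by positivity)]
  gcongr
  rw [ENNReal.ofReal_pow (by norm_num)]
  norm_num

/-- Integer vectors that span modulo `2` span over the reals. -/
lemma spans_of_spans_mod_two {m n : ℕ} {c : Fin m → Fin n → ℤ}
    (h : ∀ ζ : Fin n → ZMod 2, (∀ l, (fun a => (c l a : ZMod 2)) ⬝ᵥ ζ = 0) → ζ = 0)
    (z : Fin n → ℝ) (hz : ∀ l, (fun a => (c l a : ℝ)) ⬝ᵥ z = 0) : z = 0 := by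
  set M : Matrix (Fin m) (Fin n) ℤ := Matrix.of c with hM
  set M2 : Matrix (Fin m) (Fin n) (ZMod 2) := M.map (Int.castRingHom (ZMod 2)) with hM2
  have hker : (Matrix.toLin' M2).ker = ⊥ := by
    rw [LinearMap.ker_eq_bot']
    intro ζ hζ
    exact h ζ fun l => congrFun hζ l
  obtain ⟨G, hG⟩ := LinearMap.exists_leftInverse_of_injective _ hker
  set L2 : Matrix (Fin n) (Fin m) (ZMod 2) := LinearMap.toMatrix' G with hL2
  have hLM : L2 * M2 = 1 := by
    have := congrArg LinearMap.toMatrix' hG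
    rwa [LinearMap.toMatrix'_comp, LinearMap.toMatrix'_toLin', LinearMap.toMatrix'_id] at this
  set L : Matrix (Fin n) (Fin m) ℤ := Matrix.of fun i j => ((L2 i j).val : ℤ) with hL
  have hLmap : L.map (Int.castRingHom (ZMod 2)) = L2 := by
    ext i j
    simp [hL]
  -- A left inverse modulo 2, lifted to the integers, gives a product whose determinant is odd,
  -- hence nonzero over the reals.
  have hdet : (L * M).det ≠ 0 := by
    intro h0
    have h1 : (Int.castRingHom (ZMod 2)) (L * M).det = 1 := by
      rw [RingHom.map_det, RingHom.mapMatrix_apply, Matrix.map_mul, hLmap, hLM, det_one]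
    rw [h0, map_zero] at h1
    exact zero_ne_one h1
  have hdetR : ((L * M).map (Int.castRingHom ℝ)).det ≠ 0 := by
    rw [← RingHom.mapMatrix_apply, ← RingHom.map_det]
    simpa using hdet
  refine eq_zero_of_mulVec_eq_zero hdetR ?_
  have hMz : (M.map (Int.castRingHom ℝ)) *ᵥ z = 0 := funext hz
  rw [Matrix.map_mul, ← mulVec_mulVec, hMz, mulVec_zero]

end LWERed

namespace LWERed

open Matrix

/-! ### The dual lattice is sparse -/

/-- A nonzero dual vector shorter than 1/s would by itself contribute at least exp(-π) > ε to the
dual mass. -/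
lemma one_le_mul_norm_latVec {n : ℕ} {B : Matrix (Fin n) (Fin n) ℝ} (hB : B.det ≠ 0) {s ε : ℝ}
    (hs : 0 < s) (hsε : dualMass B s ≤ ε) (hε : ε < Real.exp (-Real.pi)) {K : Fin n → ℤ} (hK : K ≠ 0) :
    1 ≤ s * ‖latVec B⁻¹ᵀ K‖ := by
  by_contra! h
  have h1 := (summable_dualMass hB hs).le_tsum (⟨K, hK⟩ : {m : Fin n → ℤ // m ≠ 0})
    fun _ _ => (gaussMat_pos _ _).le
  have h2 : Real.exp (-Real.pi) ≤ gaussMat (s • B⁻¹ᵀ) fun i => (K i : ℝ) := by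
    rw [gaussMat, Real.exp_le_exp, smul_mulVec, smul_dotProduct, dotProduct_smul]
    have h3 : (B⁻¹ᵀ *ᵥ fun i => (K i : ℝ)) ⬝ᵥ (B⁻¹ᵀ *ᵥ fun i => (K i : ℝ)) = ‖latVec B⁻¹ᵀ K‖ ^ 2 :=
      (norm_sq_eq_dot (latVec B⁻¹ᵀ K)).symm
    rw [h3, smul_eq_mul, smul_eq_mul]
    have h4 : s * (s * ‖latVec B⁻¹ᵀ K‖ ^ 2) ≤ 1 := by
      have := mul_le_one₀ h.le (by positivity) h.le
      calc s * (s * ‖latVec B⁻¹ᵀ K‖ ^ 2) = s * ‖latVec B⁻¹ᵀ K‖ * (s * ‖latVec B⁻¹ᵀ K‖) := by ring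
        _ ≤ 1 := this
    nlinarith [Real.pi_pos]
  exact absurd (h2.trans (h1.trans hsε)) (not_le.mpr hε)

lemma latVec_sub {n : ℕ} (B : Matrix (Fin n) (Fin n) ℝ) (K K' : Fin n → ℤ) :
    latVec B (K - K') = latVec B K - latVec B K' := by
  have : (fun i => ((K - K') i : ℝ)) = (fun i => (K i : ℝ)) - fun i => (K' i : ℝ) := by
    funext i
    simp
  simp only [latVec]
  rw [this, mulVec_sub]
  rfl

lemma eq_of_close {n : ℕ} {B : Matrix (Fin n) (Fin n) ℝ} {s d : ℝ} (hs : 0 < s)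
    (hsep : ∀ K : Fin n → ℤ, K ≠ 0 → 1 ≤ s * ‖latVec B⁻¹ᵀ K‖) (hd : s * (2 * d) < 1) {x : E n}
    {K K' : Fin n → ℤ} (h : ‖x - latVec B⁻¹ᵀ K‖ ≤ d) (h' : ‖x - latVec B⁻¹ᵀ K'‖ ≤ d) : K = K' := by
  by_contra hne
  have h1 := hsep (K - K') (sub_ne_zero.mpr hne)
  have h2 : ‖latVec B⁻¹ᵀ (K - K')‖ ≤ 2 * d := by
    have h3 : latVec B⁻¹ᵀ (K - K') = (x - latVec B⁻¹ᵀ K') - (x - latVec B⁻¹ᵀ K) := by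
      rw [latVec_sub]
      abel
    rw [h3]
    exact (norm_sub_le _ _).trans (by linarith)
  have := mul_le_mul_of_nonneg_left h2 hs.le
  linarith

/-- The distance to the lattice is an infimum; separation makes it attained. Slightly above d the
candidate is still unique, so a single point is within every d' > d of x. -/
lemma exists_closest {n : ℕ} {B : Matrix (Fin n) (Fin n) ℝ} (hB : B.det ≠ 0) {s d : ℝ} (hs : 0 < s)
    (hsep : ∀ K : Fin n → ℤ, K ≠ 0 → 1 ≤ s * ‖latVec B⁻¹ᵀ K‖) (hd : s * (2 * d) < 1) {x : E n}
    (hx : Metric.infDist x (dualLattice (lattice B) : Set (E n)) ≤ d) :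
    ∃ k : Fin n → ℤ, ‖x - latVec B⁻¹ᵀ k‖ ≤ d ∧
      IsClosest (dualLattice (lattice B)) x (latVec B⁻¹ᵀ k) := by
  have hne : (dualLattice (lattice B) : Set (E n)).Nonempty := ⟨0, zero_mem _⟩
  have hlt : ∀ d', d < d' → ∃ k : Fin n → ℤ, ‖x - latVec B⁻¹ᵀ k‖ < d' := by
    intro d' hd'
    obtain ⟨y, hy, hyd⟩ := (Metric.infDist_lt_iff hne).mp (hx.trans_lt hd')
    obtain ⟨k, rfl⟩ := (mem_dualLattice_iff hB y).mp hy
    exact ⟨k, by rwa [dist_eq_norm] at hyd⟩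
  obtain ⟨e, he, hes⟩ : ∃ e, d < e ∧ s * (2 * e) < 1 := by
    have : d < 1 / (2 * s) := by
      rw [lt_div_iff₀ (by positivity)]
      linarith
    obtain ⟨e, he1, he2⟩ := exists_between this
    refine ⟨e, he1, ?_⟩
    rw [lt_div_iff₀ (by positivity)] at he2
    linarith
  obtain ⟨k, hk⟩ := hlt e he
  have hkd : ‖x - latVec B⁻¹ᵀ k‖ ≤ d := by
    refine le_of_forall_gt_imp_ge_of_dense fun d' hd' => ?_
    obtain ⟨k', hk'⟩ := hlt (min d' e) (lt_min hd' he)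
    have : k = k' := eq_of_close hs hsep hes hk.le (hk'.le.trans (min_le_right _ _))
    rw [this]
    exact hk'.le.trans (min_le_left _ _)
  refine ⟨k, hkd, (mem_dualLattice_iff hB _).mpr ⟨k, rfl⟩, fun z hz => ?_⟩
  obtain ⟨k', rfl⟩ := (mem_dualLattice_iff hB z).mp hz
  rw [dist_eq_norm, dist_eq_norm]
  by_contra! hlt'
  have : k = k' := eq_of_close hs hsep hd hkd (hlt'.le.trans hkd)
  rw [this] at hlt'
  exact lt_irrefl _ hlt'

/-- The error in coordinate a is the inner product of x - κ with the basis vector b_a. The error x -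
κ is shorter than any nonzero dual vector, in particular than the a-th dual basis vector, so the
entries of B and B⁻¹ bound it. This keeps the true coordinates below the rounding guard. -/
lemma coordinate_error_le {n : ℕ} {B : Matrix (Fin n) (Fin n) ℝ} (hB : B.det ≠ 0) {s d : ℝ} (hs : 0 < s)
    (hsep : ∀ K : Fin n → ℤ, K ≠ 0 → 1 ≤ s * ‖latVec B⁻¹ᵀ K‖) (hd : s * (2 * d) < 1) {x : E n}
    {k : Fin n → ℤ} (hk : ‖x - latVec B⁻¹ᵀ k‖ ≤ d) (a : Fin n) :
    ((k a : ℝ) - (Bᵀ *ᵥ x.ofLp) a) ^ 2 ≤ (∑ i, ∑ j, B i j ^ 2) * ∑ i, ∑ j, B⁻¹ i j ^ 2 := by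
  have h1 : (k a : ℝ) - (Bᵀ *ᵥ x.ofLp) a = -((Bᵀ a) ⬝ᵥ (x - latVec B⁻¹ᵀ k).ofLp) := by
    have h2 : (Bᵀ *ᵥ (latVec B⁻¹ᵀ k).ofLp) a = k a := by
      have : Bᵀ *ᵥ (B⁻¹ᵀ *ᵥ fun i => (k i : ℝ)) = fun i => (k i : ℝ) := by
        rw [mulVec_mulVec, ← transpose_mul, nonsing_inv_mul _ (isUnit_iff_ne_zero.mpr hB),
          transpose_one, one_mulVec]
      exact congrFun this a
    have h3 : (Bᵀ a) ⬝ᵥ (x - latVec B⁻¹ᵀ k).ofLp = (Bᵀ *ᵥ x.ofLp) a - (Bᵀ *ᵥ (latVec B⁻¹ᵀ k).ofLp) a := by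
      rw [WithLp.ofLp_sub, dotProduct_sub]
      rfl
    rw [h3, h2]
    ring
  rw [h1, neg_sq]
  refine (dot_sq_le _ _).trans ?_
  rw [← norm_sq_eq_dot (x - latVec B⁻¹ᵀ k)]
  have h4 : (Bᵀ a) ⬝ᵥ (Bᵀ a) ≤ ∑ i, ∑ j, B i j ^ 2 := by
    refine Finset.sum_le_sum fun i _ => ?_
    have := Finset.single_le_sum (f := fun j => B i j ^ 2) (fun _ _ => sq_nonneg _) (Finset.mem_univ a)
    rw [transpose_apply, ← sq]
    exact this
  have h5 : ‖x - latVec B⁻¹ᵀ k‖ ^ 2 ≤ ∑ i, ∑ j, B⁻¹ i j ^ 2 := by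
    have h6 : ‖x - latVec B⁻¹ᵀ k‖ ≤ ‖latVec B⁻¹ᵀ (Pi.single a 1)‖ := by
      have h7 := hsep (Pi.single a 1) (by simp)
      have h8 : s * ‖x - latVec B⁻¹ᵀ k‖ ≤ s * ‖latVec B⁻¹ᵀ (Pi.single a 1)‖ := by
        have := mul_le_mul_of_nonneg_left hk hs.le
        have h0 := mul_nonneg hs.le (norm_nonneg (x - latVec B⁻¹ᵀ k))
        linarith
      exact le_of_mul_le_mul_left h8 hs
    refine (pow_le_pow_left₀ (norm_nonneg _) h6 2).trans ?_
    have h9 : (latVec B⁻¹ᵀ (Pi.single a 1)).ofLp = B⁻¹ a := by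
      have : (fun i => ((Pi.single a 1 : Fin n → ℤ) i : ℝ)) = Pi.single a 1 := by
        funext i
        by_cases h : i = a
        · subst h; simp
        · simp [h]
      rw [latVec, this, mulVec_single_one]
      rfl
    rw [norm_sq_eq_dot (latVec B⁻¹ᵀ (Pi.single a 1)), h9]
    refine le_trans (le_of_eq ?_) (Finset.single_le_sum (f := fun i => ∑ j, B⁻¹ i j ^ 2)
      (fun _ _ => by positivity) (Finset.mem_univ a))
    exact Finset.sum_congr rfl fun j _ => (sq _).symm
  exact mul_le_mul h4 h5 (sq_nonneg _) (by positivity)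

lemma exists_grid_index {a A : ℝ} {m : ℕ} (hm : 0 < m) (hA : 0 < A) (ha : 0 ≤ a) (haA : a ≤ A / 2) :
    ∃ j < m, j * A / (2 * m) ≤ a ∧ a ≤ (j + 1 : ℝ) * A / (2 * m) := by
  have hm' : (0 : ℝ) < m := by exact_mod_cast hm
  set t := 2 * m * a / A with ht
  have ht0 : 0 ≤ t := by positivity
  have hta : a = t * A / (2 * m) := by
    rw [ht]
    field_simp
  have htm : t ≤ m := by
    rw [ht, div_le_iff₀ hA]
    nlinarith
  rw [hta]
  rcases lt_or_ge ⌊t⌋₊ m with h | h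
  · refine ⟨⌊t⌋₊, h, ?_, ?_⟩
    · gcongr
      exact Nat.floor_le ht0
    · gcongr
      exact (Nat.lt_floor_add_one t).le
  -- Only the endpoint a = A/2 lands here; it belongs to the last cell.
  · have h1 : (m : ℝ) ≤ t := (Nat.le_floor_iff ht0).mp h
    refine ⟨m - 1, by omega, ?_, ?_⟩
    · gcongr
      exact le_trans (by exact_mod_cast Nat.sub_le m 1) h1
    · rw [Nat.cast_sub hm]
      gcongr
      push_cast
      linarith

/-- The two factors are at most exp(3ε) and exp(1/m), so N ≤ m of them give at most exp(2) < 8. This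
determines how fine the grid of guesses must be. -/
lemma ratio_pow_le {ε α β : ℝ} {N m : ℕ} (hN : N ≤ m) (hm : 0 < m) (hε : 0 ≤ ε) (hεm : 3 * ε * m ≤ 1)
    (hα : 0 < α) (hβ : 0 < β) (h : α ^ 2 * (1 - 1 / (2 * m)) ≤ β ^ 2) :
    ((1 + ε) / (1 - ε) * (α / β)) ^ N ≤ 8 := by
  have hm1 : (1 : ℝ) ≤ m := by exact_mod_cast hm
  have hε3 : ε ≤ 1 / 3 := by nlinarith
  have h1 : (1 + ε) / (1 - ε) ≤ Real.exp (3 * ε) := by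
    refine le_trans ?_ (Real.add_one_le_exp _)
    rw [div_le_iff₀ (by linarith)]
    nlinarith
  have h2 : α / β ≤ Real.exp (1 / m) := by
    refine le_trans ?_ (Real.add_one_le_exp _)
    rw [div_le_iff₀ hβ]
    refine abs_le_of_sq_le_sq' ?_ (by positivity) |>.2
    -- With y = 1/m this is (1 + y)²(1 - y/2) ≥ 1 for 0 ≤ y ≤ 1.
    have h3 : (1 : ℝ) ≤ (1 / m + 1) ^ 2 * (1 - 1 / (2 * m)) := by
      set y : ℝ := 1 / m with hy
      have hy0 : 0 ≤ y := by positivity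
      have hy1 : y ≤ 1 := by rw [hy, div_le_one (by positivity)]; exact hm1
      have : 1 / (2 * (m : ℝ)) = y / 2 := by rw [hy]; field_simp
      rw [this]
      nlinarith [mul_nonneg hy0 (sub_nonneg.mpr hy1), mul_nonneg hy0 (mul_nonneg hy0 (sub_nonneg.mpr hy1))]
    calc α ^ 2 ≤ α ^ 2 * ((1 / m + 1) ^ 2 * (1 - 1 / (2 * m))) := le_mul_of_one_le_right (sq_nonneg _) h3
      _ = (1 / m + 1) ^ 2 * (α ^ 2 * (1 - 1 / (2 * m))) := by ring
      _ ≤ (1 / m + 1) ^ 2 * β ^ 2 := by gcongr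
      _ = ((1 / m + 1) * β) ^ 2 := by ring
  have h0 : 0 ≤ (1 + ε) / (1 - ε) := div_nonneg (by linarith) (by linarith)
  calc ((1 + ε) / (1 - ε) * (α / β)) ^ N ≤ (Real.exp (3 * ε) * Real.exp (1 / m)) ^ N := by
        gcongr
    _ = Real.exp (N * (3 * ε + 1 / m)) := by rw [← Real.exp_add, ← Real.exp_nat_mul]
    _ ≤ Real.exp 2 := by
        rw [Real.exp_le_exp]
        have hNm : (N : ℝ) ≤ m := by exact_mod_cast hN
        calc (N : ℝ) * (3 * ε + 1 / m) ≤ m * (3 * ε + 1 / m) := by gcongr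
          _ = 3 * ε * m + 1 := by field_simp
          _ ≤ 2 := by linarith
    _ ≤ 8 := by
        have h4 := Real.exp_one_lt_d9
        have h5 : Real.exp 2 = Real.exp 1 ^ 2 := by rw [← Real.exp_nat_mul]; norm_num
        rw [h5]
        nlinarith [Real.exp_pos 1]

end LWERed

namespace LWERed

open Matrix

/-! ### The probability that the algorithm fails -/

/-- Here A = α², a = r²‖z‖² and Q = p²ⁱ; the middle expression is the square of the blur. In order:
the blur is positive, it dominates the inner product noise, the total noise is at most α, and it is
short of α² by at most α²/(2m) in square. -/
lemma noise_bounds {a A Q : ℝ} {j m : ℕ} (hA : 0 < A) (hQ : 1 ≤ Q) (hj : j < m)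
    (haA : a ≤ A / 2) (hja : j * A / (2 * m) ≤ a) (haj : a ≤ (j + 1 : ℝ) * A / (2 * m)) :
    A / 2 ≤ A - (j + 1 : ℝ) * A / (2 * m * Q) ∧
      a / Q ≤ A - (j + 1 : ℝ) * A / (2 * m * Q) ∧
      A - (j + 1 : ℝ) * A / (2 * m * Q) + a / Q ≤ A ∧
      A * (1 - 1 / (2 * m)) ≤ A - (j + 1 : ℝ) * A / (2 * m * Q) + a / Q := by
  have hm : (0 : ℝ) < m := by exact_mod_cast (Nat.zero_le j).trans_lt hj
  have hjm : (j + 1 : ℝ) ≤ m := by exact_mod_cast hj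
  have hQ0 : 0 < Q := by linarith
  set t := (j + 1 : ℝ) * A / (2 * m) with ht
  have h1 : (j + 1 : ℝ) * A / (2 * m * Q) = t / Q := by rw [ht, div_div]
  have h2 : t = j * A / (2 * m) + A / (2 * m) := by rw [ht]; ring
  have h3 : t ≤ A / 2 := by
    rw [ht, div_le_iff₀ (by positivity)]
    nlinarith
  have h4 : 0 ≤ t := by positivity
  have h5 : t / Q ≤ t := div_le_self h4 hQ
  have h6 : a / Q ≤ A / 2 := by
    rw [div_le_iff₀ hQ0]
    nlinarith
  have h7 : a / Q ≤ t / Q := by gcongr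
  have h8 : (t - a) / Q ≤ A / (2 * m) := by
    refine (div_le_self (by linarith) hQ).trans ?_
    linarith
  rw [sub_div] at h8
  rw [h1]
  refine ⟨by linarith, by linarith, by linarith, ?_⟩
  have : A * (1 - 1 / (2 * m)) = A - A / (2 * m) := by ring
  linarith

-- Union bound over an oracle error in the trial with the right guess, samples that fail to span
-- modulo 2, and a large inner product with the error. The events refer only to the true k, so the
-- same samples can serve in all rounds and trials without any independence between the events.
set_option maxHeartbeats 1000000 in
theorem cvpProg_failure_le {p N : ℕ → ℕ} {Ω : Type*} [MeasurableSpace Ω] (W : Oracle p N Ω)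
    (P : Measure Ω) [IsProbabilityMeasure P] {n : ℕ} (hn : 1 ≤ n) (hp : 2 ≤ p n) {mE : NExp} {m : ℕ}
    (hmE : ∀ e : ℕ → ℕ, e 0 = n → mE.ev e = m) (hmI : ∀ X : Finset ℕ, 0 ∈ X → mE.In X)
    (hm : 0 < m) (hNm : N n ≤ m) {ε α r : ℝ} (hε : 0 < ε) (hεπ : ε < Real.exp (-Real.pi))
    (hε9 : ε ≤ 1 / 9) (hεm : 3 * ε * m ≤ 1) (hα : 0 < α) (hα1 : α < 1) {η : ENNReal}
    (hW : ∀ s : Fin n → ZMod (p n),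
      ((Measure.pi fun _ : Fin (N n) => lweDist s (Psi α)).prod P) {q | W.out n q.1 q.2 ≠ s} ≤ η)
    {B : Matrix (Fin n) (Fin n) ℝ} (hB : B.det ≠ 0)
    (hr : √2 * p n * smoothing (lattice B) ε < r) {x : E n}
    (hx : Metric.infDist x (dualLattice (lattice B) : Set (E n)) ≤ α * p n / (√2 * r)) :
    runLaw (lattice B) r m P {q | ¬ IsClosest (dualLattice (lattice B)) x
        (((cvpProg mE).exec W n q.2.1 q.2.2 (initState B (p n) α r x q.1)).outputVec n)} ≤
      n * (8 * η) + ENNReal.ofReal (2 ^ n * (5 / 8) ^ m) + m * ENNReal.ofReal (144 / 4 ^ n) := by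
  have : NeZero (p n) := ⟨by omega⟩
  have hr0 : 0 < r := pos_of_mul_smoothing_lt (by positivity) hr
  have hp0 : (0 : ℝ) < p n := by exact_mod_cast NeZero.pos (p n)
  have hp2 : (2 : ℝ) ≤ p n := by exact_mod_cast hp
  have := isProbabilityMeasure_discreteGaussian hB hr0
  have hε1 : ε < 1 := by linarith
  obtain ⟨s, hs, hsr, hsε⟩ := exists_lt_of_mul_smoothing_lt hB hε (by positivity) hr
  have hsep : ∀ K : Fin n → ℤ, K ≠ 0 → 1 ≤ s * ‖latVec B⁻¹ᵀ K‖ :=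
    fun K hK => one_le_mul_norm_latVec hB hs hsε hεπ hK
  set d : ℝ := α * p n / (√2 * r) with hd
  have h2 : √2 * √2 = (2 : ℝ) := Real.mul_self_sqrt (by norm_num)
  -- 2 d s = α(√2 p s)/r, which is below 1 because √2 p s < r and α < 1: the decoding radius is less
  -- than half the separation of the dual lattice.
  have hsd : s * (2 * d) < 1 := by
    have h3 : s * (2 * d) = α * (√2 * p n * s) / r := by
      rw [hd]
      field_simp
      linear_combination -h2
    rw [h3, div_lt_one hr0]
    have : 0 < √2 * p n * s := by positivity
    nlinarith
  obtain ⟨k, hkd, hk⟩ := exists_closest hB hs hsep hsd hx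
  have hd2 : ∀ K, ‖x - latVec B⁻¹ᵀ K‖ ≤ d ↔
      ‖x - latVec B⁻¹ᵀ K‖ ^ 2 * (2 * (r * r)) ≤ α * α * ((p n : ℝ) * p n) := by
    intro K
    rw [← sq_le_sq₀ (norm_nonneg _) (by positivity), hd, div_pow, le_div_iff₀ (by positivity)]
    have h4 : (√2 * r) ^ 2 = 2 * (r * r) := by rw [mul_pow, sq √2, h2]; ring
    rw [h4, mul_pow, sq α, sq (p n : ℝ)]
  set u : Fin n → ℝ := Bᵀ *ᵥ x.ofLp with hu
  set z : Fin n → ℝ := (p n : ℝ)⁻¹ • (B⁻¹ᵀ *ᵥ (u - fun j => (k j : ℝ))) with hz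
  have hzx : z = (p n : ℝ)⁻¹ • (x - latVec B⁻¹ᵀ k).ofLp := by
    rw [hz, mulVec_sub, hu, mulVec_mulVec, ← transpose_mul, mul_nonsing_inv _
      (isUnit_iff_ne_zero.mpr hB), transpose_one, one_mulVec]
    rfl
  set a : ℝ := r ^ 2 * (z ⬝ᵥ z) with ha
  have ha0 : 0 ≤ a := mul_nonneg (sq_nonneg _) (dot_self_nonneg z)
  have haA : a ≤ α ^ 2 / 2 := by
    have h5 : z ⬝ᵥ z = ((p n : ℝ)⁻¹) ^ 2 * ‖x - latVec B⁻¹ᵀ k‖ ^ 2 := by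
      rw [norm_sq_eq_dot, hzx, smul_dotProduct, dotProduct_smul, smul_eq_mul, smul_eq_mul]
      ring
    have h6 := (hd2 k).mp hkd
    rw [ha, h5, le_div_iff₀ (by norm_num)]
    field_simp
    nlinarith
  have hA : 0 < α ^ 2 := by positivity
  obtain ⟨j₀, hj₀, hj1, hj2⟩ := exists_grid_index hm hA ha0 haA
  set C := (1 + ε) / (1 - ε) with hC
  have hC0 : 0 < C := div_pos (by linarith) (by linarith)
  have hC5 : C ≤ 5 / 4 := by
    rw [hC, div_le_iff₀ (by linarith)]
    linarith
  set sec : ℕ → Fin n → ZMod (p n) := fun i a => ((k a / (p n : ℤ) ^ i : ℤ) : ZMod (p n)) with hsec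
  set zi : ℕ → Fin n → ℝ := fun i => ((p n : ℝ) ^ i)⁻¹ • z with hzi
  set σ : ℕ → ℝ := fun i => √(α * α - ((j₀ + 1 : ℕ) : ℝ) * (α * α) /
    (((2 * m : ℕ) : ℝ) * ((p n : ℝ) ^ i * (p n : ℝ) ^ i))) with hσ
  -- each oracle call fails rarely
  have hF : ∀ i, runLaw (lattice B) r m P {q | W.out n (fun l : Fin (N n) => lweMap (sec i)
      (jointMap B (p n) (zi i) (σ i) (q.1 (Fin.castLE hNm l), q.2.1 l))) (q.2.2 (j₀ * n + i)) ≠ sec i}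
      ≤ 8 * η := by
    intro i
    set Q : ℝ := (p n : ℝ) ^ i * (p n : ℝ) ^ i with hQ
    have hpi : 1 ≤ (p n : ℝ) ^ i := one_le_pow₀ (by linarith)
    have hQ1 : 1 ≤ Q := by nlinarith
    obtain ⟨b1, b2, b3, b4⟩ := noise_bounds hA hQ1 hj₀ haA hj1 hj2
    have hσsq : σ i ^ 2 = α ^ 2 - (j₀ + 1 : ℝ) * α ^ 2 / (2 * m * Q) := by
      have : α * α - ((j₀ + 1 : ℕ) : ℝ) * (α * α) / (((2 * m : ℕ) : ℝ) * Q) =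
          α ^ 2 - (j₀ + 1 : ℝ) * α ^ 2 / (2 * m * Q) := by
        push_cast
        ring
      rw [hσ]
      dsimp only
      rw [Real.sq_sqrt (by rw [this]; linarith), this]
    have hσ0 : 0 < σ i := by
      have h7 : 0 ≤ σ i := Real.sqrt_nonneg _
      refine h7.lt_of_ne fun h0 => ?_
      rw [← h0] at hσsq
      nlinarith
    have hzz : r ^ 2 * (zi i ⬝ᵥ zi i) = a / Q := by
      rw [hzi, ha]
      dsimp only
      rw [smul_dotProduct, dotProduct_smul, smul_eq_mul, smul_eq_mul, hQ]
      field_simp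
    set β := √(σ i ^ 2 + r ^ 2 * (zi i ⬝ᵥ zi i)) with hβ
    have hβ2 : β ^ 2 = α ^ 2 - (j₀ + 1 : ℝ) * α ^ 2 / (2 * m * Q) + a / Q := by
      rw [hβ, Real.sq_sqrt (by rw [hzz]; positivity), hzz, hσsq]
    have hβ0 : 0 < β := Real.sqrt_pos.mpr (by rw [hzz]; positivity)
    have hβα : β ≤ α := by
      rw [← sq_le_sq₀ hβ0.le hα.le, hβ2]
      exact b3
    have hle := (jointLaw_le_of_smoothing hB le_rfl hε hε1 hr hσ0 (z := zi i)
      (by rw [hzz, hσsq]; exact b2)).1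
    refine (oracle_failure_le W P hB hr0 hNm (j₀ * n + i) hβ0 hβα hC0 hle (sec i) (hW (sec i))).trans ?_
    gcongr
    rw [← ENNReal.ofReal_pow (by positivity)]
    refine (ENNReal.ofReal_le_ofReal (ratio_pow_le hNm hm hε.le hεm hα hβ0 (by rw [hβ2]; exact b4))).trans ?_
    simp
  -- the samples span
  have hS : runLaw (lattice B) r m P {q | ∃ ζ : Fin n → ZMod 2, ζ ≠ 0 ∧
      ∀ l, coordMod B 2 (q.1 l) ⬝ᵥ ζ = 0} ≤ ENNReal.ofReal (2 ^ n * (5 / 8) ^ m) := by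
    -- With z = 0 the blur is irrelevant and may have width 1; the modulus 2 is allowed as 2 ≤ p.
    have hle := (jointLaw_le_of_smoothing hB (q := 2) hp hε hε1 hr one_pos (z := 0) (by simp)).1
    refine (span_failure_le P hB hr0 m hC0.le hle).trans (ENNReal.ofReal_le_ofReal ?_)
    have : C / 2 ≤ 5 / 8 := by linarith
    gcongr
  -- the inner products are small
  have hT : ∀ l, runLaw (lattice B) r m P {q | 2 * ((p n : ℝ) ^ (n - 1) / 4) ≤ |z ⬝ᵥ (q.1 l).ofLp|} ≤
      ENNReal.ofReal (144 / 4 ^ n) := by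
    intro l
    have hσ0 : 0 < α * √(1 / 2) := by positivity
    have hσ2 : (α * √(1 / 2)) ^ 2 = α ^ 2 / 2 := by
      rw [mul_pow, Real.sq_sqrt (by norm_num)]
      ring
    have hα2 : α ^ 2 ≤ 1 := by nlinarith
    have hle := (jointLaw_le_of_smoothing hB (q := p n) le_rfl hε hε1 hr hσ0 (z := z)
      (by rw [hσ2]; exact haA)).1
    have hmp : MeasurePreserving (fun q : (Fin m → E n) × (ℕ → ℝ) × (ℕ → Ω) => (q.1 l, q.2.1 l))
        (runLaw (lattice B) r m P) ((discreteGaussian (lattice B) r).prod (nu 1)) :=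
      (measurePreserving_eval (fun _ : Fin m => (discreteGaussian (lattice B) r).prod (nu 1)) l).comp
        (measurePreserving_fst.comp (measurePreserving_runLaw P (lattice B) r m 0))
    have hdot := dot_tail hB hr0 (R := (p n : ℝ) ^ (n - 1) / 4) (by rw [hσ2]; linarith)
      (by rw [Real.sq_sqrt (by positivity), hσ2]; linarith) hC0.le (by positivity) hle
    refine (Measure.le_map_apply hmp.aemeasurable {a : E n × ℝ |
      2 * ((p n : ℝ) ^ (n - 1) / 4) ≤ |z ⬝ᵥ a.1.ofLp|}).trans ?_
    rw [hmp.map_eq]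
    refine hdot.trans (ENNReal.ofReal_le_ofReal ?_)
    have h8 : (2 : ℝ) ^ (n - 1) ≤ (p n : ℝ) ^ (n - 1) := by gcongr
    -- With C + 1 ≤ 9/4 and R = pⁿ⁻¹/4, the tail is at most 36/4ⁿ⁻¹ = 144/4ⁿ.
    have h9 : (4 : ℝ) ^ n = 4 * (2 ^ (n - 1)) ^ 2 := by
      obtain ⟨t, rfl⟩ := Nat.exists_eq_add_of_le hn
      rw [add_tsub_cancel_left, ← pow_mul, mul_comm t 2, pow_mul, pow_add]
      norm_num
    have h10 : ((2 : ℝ) ^ (n - 1)) ^ 2 ≤ ((p n : ℝ) ^ (n - 1)) ^ 2 := by gcongr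
    have h11 : (0 : ℝ) < (2 ^ (n - 1)) ^ 2 := by positivity
    rw [div_le_div_iff₀ (by positivity) (by positivity), h9]
    nlinarith
  have hcount := countable_lattice hB
  have hae : ∀ᵐ q ∂(runLaw (lattice B) r m P), ∀ l, q.1 l ∈ lattice B := by
    rw [ae_all_iff]
    intro l
    have hmp : MeasurePreserving (fun q : (Fin m → E n) × (ℕ → ℝ) × (ℕ → Ω) => (q.1 l, q.2.1 l))
        (runLaw (lattice B) r m P) ((discreteGaussian (lattice B) r).prod (nu 1)) :=
      (measurePreserving_eval (fun _ : Fin m => (discreteGaussian (lattice B) r).prod (nu 1)) l).comp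
        (measurePreserving_fst.comp (measurePreserving_runLaw P (lattice B) r m 0))
    exact (measurePreserving_fst.comp hmp).quasiMeasurePreserving.ae
      (ae_mem_discreteGaussian (lattice B) r)
  set F : ℕ → Set ((Fin m → E n) × (ℕ → ℝ) × (ℕ → Ω)) := fun i =>
    {q | W.out n (fun l : Fin (N n) => lweMap (sec i)
      (jointMap B (p n) (zi i) (σ i) (q.1 (Fin.castLE hNm l), q.2.1 l))) (q.2.2 (j₀ * n + i)) ≠ sec i}
    with hFdef
  set S : Set ((Fin m → E n) × (ℕ → ℝ) × (ℕ → Ω)) := {q | ∃ ζ : Fin n → ZMod 2, ζ ≠ 0 ∧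
      ∀ l, coordMod B 2 (q.1 l) ⬝ᵥ ζ = 0} with hSdef
  set T : Fin m → Set ((Fin m → E n) × (ℕ → ℝ) × (ℕ → Ω)) := fun l =>
    {q | 2 * ((p n : ℝ) ^ (n - 1) / 4) ≤ |z ⬝ᵥ (q.1 l).ofLp|} with hTdef
  calc _ ≤ runLaw (lattice B) r m P (((⋃ i : Fin n, F i) ∪ S) ∪ ⋃ l, T l) := by
        refine measure_mono_ae ?_
        filter_upwards [hae] with q hq hbad
        by_contra hcon
        refine hbad ?_
        obtain ⟨⟨hqF, hqS⟩, hqT⟩ : ((∀ i : Fin n, q ∉ F i) ∧ q ∉ S) ∧ ∀ l, q ∉ T l := by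
          have : ¬ (q ∈ ((⋃ i : Fin n, F i) ∪ S) ∪ ⋃ l, T l) := hcon
          simpa only [Set.mem_union, Set.mem_iUnion, not_or, not_exists] using this
        choose c hc using fun l => (mem_lattice_iff B _).mp (hq l)
        have hq1 : q.1 = fun l => latVec B (c l) := funext fun l => (hc l).symm
        have hout := cvpProg_output (W := W) (g := q.2.1) (w := q.2.2) hmE hmI hNm hB (α := α) (r := r)
          hu (c := c) (coordinate_error_le hB hs hsep hsd hkd)
          (spans_of_spans_mod_two fun ζ hζ => by
            by_contra hζ0
            refine hqS ⟨ζ, hζ0, fun l => ?_⟩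
            rw [← hc l, coordMod_latVec hB]
            exact hζ l)
          (fun l => by
            -- As z contains the factor 1/p, the bound |⟨z,v⟩| < pⁿ⁻¹/2 is the required |⟨u - k,c⟩|
            -- < pⁿ/2.
            have h12 := hqT l
            simp only [hTdef, Set.mem_ofPred_eq, not_le] at h12
            rw [← hc l, hz, smul_dotProduct, latVec, inv_transpose_mulVec_dot hB, smul_eq_mul,
              abs_mul, abs_inv, abs_of_pos hp0, inv_mul_lt_iff₀ hp0] at h12
            refine h12.trans_le (le_of_eq ?_)
            obtain ⟨t, ht⟩ := Nat.exists_eq_add_of_le hn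
            rw [ht, add_tsub_cancel_left, pow_add]
            ring)
          ((hd2 k).mp hkd)
          (fun K hK => by rw [eq_of_close hs hsep hsd ((hd2 K).mpr hK) hkd]) hj₀
          (fun i hi => by
            have h13 := hqF ⟨i, hi⟩
            simp only [hFdef, Set.mem_ofPred_eq, not_not] at h13
            simpa only [hc] using h13)
        rw [hq1, hout]
        exact hk
    _ ≤ (∑ i : Fin n, runLaw (lattice B) r m P (F i) + runLaw (lattice B) r m P S) +
        ∑ l, runLaw (lattice B) r m P (T l) := by
        refine (measure_union_le _ _).trans (add_le_add ((measure_union_le _ _).trans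
          (add_le_add ?_ le_rfl)) ?_)
        · exact measure_iUnion_fintype_le _ _
        · exact measure_iUnion_fintype_le _ _
    _ ≤ _ := by
        refine add_le_add (add_le_add ?_ hS) ?_
        · refine (Finset.sum_le_sum fun (i : Fin n) _ => hF i).trans (le_of_eq ?_)
          rw [Finset.sum_const, Finset.card_univ, Fintype.card_fin, nsmul_eq_mul]
        · refine (Finset.sum_le_sum fun l _ => hT l).trans (le_of_eq ?_)
          rw [Finset.sum_const, Finset.card_univ, Fintype.card_fin, nsmul_eq_mul]

end LWERed

namespace LWERed

open Matrix

/-! ### Solving the closest vector problem with probability exponentially close to one -/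

/-- The `c`-th power of the dimension. -/
def dimPow : ℕ → NExp
  | 0 => .lit 1
  | c + 1 => .mul (dimPow c) (.var 0)

lemma ev_dimPow (c n : ℕ) (e : ℕ → ℕ) (he : e 0 = n) : (dimPow c).ev e = n ^ c := by
  induction c with
  | zero => rfl
  | succ c ih =>
    rw [pow_succ, ← ih, ← he]
    rfl

lemma in_dimPow (c : ℕ) (X : Finset ℕ) (hX : 0 ∈ X) : (dimPow c).In X := by
  induction c with
  | zero => trivial
  | succ c ih => exact ⟨ih, hX⟩

/-- The number of samples must be a power of n that the program can compute itself. It has to exceed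
both what the oracle needs and 4n, the latter for the spanning probability. -/
lemma eventually_le_dim_pow {N : ℕ → ℕ} {K : ℕ} (hN : ∀ n, N n ≤ K * (n + 1) ^ K) :
    ∀ᶠ n : ℕ in Filter.atTop, N n ≤ n ^ (2 * K + 2) ∧ 4 * n ≤ n ^ (2 * K + 2) := by
  filter_upwards [Filter.eventually_ge_atTop (K + 4)] with n hn
  have h1 : 1 ≤ n := by omega
  refine ⟨(hN n).trans ?_, ?_⟩
  · calc K * (n + 1) ^ K ≤ n * (n ^ 2) ^ K := by
          gcongr
          · omega
          · nlinarith
      _ = n ^ (2 * K + 1) := by rw [← pow_mul]; ring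
      _ ≤ _ := Nat.pow_le_pow_right h1 (by omega)
  · calc 4 * n ≤ n ^ 2 := by nlinarith
      _ ≤ _ := Nat.pow_le_pow_right h1 (by omega)

/-- With γ = min(δ,1)/2 and ρ = 2^(-γ), each term is at most a constant times n^c ρ^(2n). The
constants add up to 8 + 1 + 144 = 153, and one factor ρⁿ absorbs 153 n^c. -/
lemma eventually_failure_le {δ : ℝ} (hδ : 0 < δ) {c : ℕ} (hc : 0 < c) :
    ∀ᶠ n : ℕ in Filter.atTop, 4 * n ≤ n ^ c →
      n * (8 * (2 : ℝ) ^ (-(δ * n))) + 2 ^ n * (5 / 8 : ℝ) ^ n ^ c + (n ^ c : ℕ) * (144 / 4 ^ n : ℝ) ≤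
        (2 : ℝ) ^ (-(min δ 1 / 2 * n)) := by
  set γ := min δ 1 / 2 with hγ
  have hγ0 : 0 < γ := by positivity
  have hγδ : 2 * γ ≤ δ := by rw [hγ]; linarith [min_le_left δ 1]
  have hγ1 : 2 * γ ≤ 1 := by rw [hγ]; linarith [min_le_right δ 1]
  set ρ := (2 : ℝ) ^ (-γ) with hρ
  have hρ0 : 0 < ρ := by positivity
  have hρ1 : ρ < 1 := Real.rpow_lt_one_of_one_lt_of_neg (by norm_num) (by linarith)
  have ht := (tendsto_pow_const_mul_const_pow_of_abs_lt_one c (by rwa [abs_of_pos hρ0])).const_mul 153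
  rw [mul_zero] at ht
  filter_upwards [ht.eventually_le_const one_pos, Filter.eventually_ge_atTop 1] with n h1 hn h4
  have hpow : ∀ t : ℝ, (2 : ℝ) ^ (-(t * n)) = ((2 : ℝ) ^ (-t)) ^ n := fun t => by
    rw [← Real.rpow_natCast, ← Real.rpow_mul (by norm_num)]
    congr 1
    ring
  have hn1 : (1 : ℝ) ≤ n := by exact_mod_cast hn
  have hnc : (n : ℝ) ≤ (n : ℝ) ^ c := le_self_pow₀ hn1 hc.ne'
  have hρ2 : ∀ t : ℝ, 2 * γ ≤ t → (2 : ℝ) ^ (-(t * n)) ≤ ρ ^ n * ρ ^ n := by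
    intro t htγ
    rw [← hpow γ, ← Real.rpow_add (by norm_num)]
    refine Real.rpow_le_rpow_of_exponent_le (by norm_num) ?_
    nlinarith
  have e1 := hρ2 δ hγδ
  have e2 : ((2 : ℝ)⁻¹) ^ n ≤ ρ ^ n * ρ ^ n := by
    have := hρ2 1 hγ1
    rwa [hpow 1, Real.rpow_neg_one] at this
  have e3 : (2 : ℝ) ^ n * (5 / 8 : ℝ) ^ n ^ c ≤ (2⁻¹) ^ n := by
    -- Four samples per dimension suffice, since 2·(5/8)⁴ < 1/2.
    calc (2 : ℝ) ^ n * (5 / 8 : ℝ) ^ n ^ c ≤ 2 ^ n * (5 / 8) ^ (4 * n) :=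
          mul_le_mul_of_nonneg_left (pow_le_pow_of_le_one (by norm_num) (by norm_num) h4) (by positivity)
      _ = (2 * (5 / 8) ^ 4) ^ n := by rw [pow_mul, mul_pow]
      _ ≤ _ := by
          gcongr
          norm_num
  have e4 : (144 / 4 ^ n : ℝ) ≤ 144 * (ρ ^ n * ρ ^ n) := by
    have h5 : (1 / 4 ^ n : ℝ) ≤ (2⁻¹) ^ n := by
      rw [inv_pow, ← one_div]
      gcongr
      norm_num
    calc (144 / 4 ^ n : ℝ) = 144 * (1 / 4 ^ n) := by ring
      _ ≤ _ := mul_le_mul_of_nonneg_left (h5.trans e2) (by norm_num)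
  have hR : 0 < ρ ^ n * ρ ^ n := by positivity
  rw [hpow γ]
  push_cast
  calc n * (8 * (2 : ℝ) ^ (-(δ * n))) + 2 ^ n * (5 / 8 : ℝ) ^ n ^ c + (n : ℝ) ^ c * (144 / 4 ^ n : ℝ)
      ≤ n ^ c * (8 * (ρ ^ n * ρ ^ n)) + n ^ c * (ρ ^ n * ρ ^ n) +
        (n : ℝ) ^ c * (144 * (ρ ^ n * ρ ^ n)) := by
        refine add_le_add (add_le_add ?_ ?_) ?_
        · gcongr
        · exact (e3.trans e2).trans (le_mul_of_one_le_left hR.le (hn1.trans hnc))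
        · gcongr
    _ = (153 * (n ^ c * ρ ^ n)) * ρ ^ n := by ring
    _ ≤ 1 * ρ ^ n := by gcongr
    _ = ρ ^ n := one_mul _

theorem exists_cvp_algorithm {ε : ℕ → ℝ} (hε : ∀ n, 0 < ε n)
    (hε_negl : Asymptotics.SuperpolynomialDecay Filter.atTop (fun n : ℕ => (n : ℝ)) ε)
    {p : ℕ → ℕ} (hp : ∀ n, 2 ≤ p n) {α : ℕ → ℝ} (hα : ∀ n, 0 < α n ∧ α n < 1)
    {N : ℕ → ℕ} (hN : ∃ K : ℕ, ∀ n, N n ≤ K * (n + 1) ^ K)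
    {Ω : Type*} [MeasurableSpace Ω] (P : Measure Ω) [IsProbabilityMeasure P]
    (W : Oracle p N Ω) (hW : W.Solves P (fun n => Psi (α n))) :
    ∃ (c : ℕ) (Q : Prog), 0 < c ∧ Q.PolyTime W α (fun n => n ^ c) ∧
      ∃ δ : ℝ, 0 < δ ∧ ∃ n₀ : ℕ, ∀ n, n₀ ≤ n → ∀ B : Matrix (Fin n) (Fin n) ℝ, B.det ≠ 0 →
        ∀ r : ℝ, √2 * p n * smoothing (lattice B) (ε n) < r → ∀ x : E n,
          Metric.infDist x (dualLattice (lattice B) : Set (E n)) ≤ α n * p n / (√2 * r) →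
          runLaw (lattice B) r (n ^ c) P
            {q | ¬ IsClosest (dualLattice (lattice B)) x
              ((Q.exec W n q.2.1 q.2.2 (initState B (p n) (α n) r x q.1)).outputVec n)}
            ≤ ENNReal.ofReal ((2 : ℝ) ^ (-(δ * n))) := by
  obtain ⟨K, hK⟩ := hN
  obtain ⟨δ, hδ, n₁, hδW⟩ := hW
  set c := 2 * K + 2 with hc
  refine ⟨c, cvpProg (dimPow c), by omega, cvpProg_polyTime (fun n e he => ev_dimPow c n e he)
    (in_dimPow c) ⟨c + 1, fun s => ?_⟩ ⟨K, hK⟩ α, min δ 1 / 2, by positivity, ?_⟩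
  · calc s ^ c ≤ (s + 1) ^ c := Nat.pow_le_pow_left (by omega) c
      _ ≤ (s + 1) ^ (c + 1) := Nat.pow_le_pow_right (by omega) (by omega)
      _ ≤ _ := Nat.le_mul_of_pos_left _ (by omega)
  -- ε ≤ 1/9 gives (1+ε)/(1-ε) ≤ 5/4, the source of 5/8; ε < exp(-π) separates the dual lattice
  -- points.
  have hε0 : ∀ᶠ n in Filter.atTop, ε n < min (1 / 9) (Real.exp (-Real.pi)) := by
    have h := hε_negl 0
    simp only [pow_zero, one_mul] at h
    exact h.eventually_lt_const (lt_min (by norm_num) (Real.exp_pos _))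
  -- Here negligibility enters: the deviation of n^c samples together must stay bounded, for the
  -- polynomial n^c dictated by the oracle.
  have hεc : ∀ᶠ n : ℕ in Filter.atTop, (n : ℝ) ^ c * ε n < 1 / 3 :=
    (hε_negl c).eventually_lt_const (by norm_num)
  refine Filter.eventually_atTop.mp ?_
  filter_upwards [hε0, hεc, eventually_le_dim_pow hK, eventually_failure_le hδ (c := c) (by omega),
    Filter.eventually_ge_atTop n₁, Filter.eventually_ge_atTop 1] with n h1 h2 h3 h4 h5 hn B hB r hr x hx
  have hfail := cvpProg_failure_le W P hn (hp n) (ev_dimPow c n) (in_dimPow c) (Nat.pow_pos hn) h3.1 (hε n)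
    (h1.trans_le (min_le_right _ _)) (h1.le.trans (min_le_left _ _)) (by push_cast; linarith)
    (hα n).1 (hα n).2 (hδW n h5) hB hr hx
  refine hfail.trans (le_trans (le_of_eq ?_) (ENNReal.ofReal_le_ofReal (h4 h3.2)))
  have h8 : (n : ENNReal) * (8 * ENNReal.ofReal ((2 : ℝ) ^ (-(δ * n)))) =
      ENNReal.ofReal (n * (8 * (2 : ℝ) ^ (-(δ * n)))) := by
    rw [ENNReal.ofReal_mul (by positivity), ENNReal.ofReal_mul (by norm_num), ENNReal.ofReal_natCast]
    norm_num
  rw [h8, ENNReal.ofReal_add (by positivity) (by positivity), ENNReal.ofReal_add (by positivity)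
    (by positivity), ENNReal.ofReal_mul (p := ((n ^ c : ℕ) : ℝ)) (by positivity), ENNReal.ofReal_natCast]

end LWERed

end

theorem mainTheorem5
    (ε : ℕ → ℝ) (hε : ∀ n, 0 < ε n)
    (hε_negl : Asymptotics.SuperpolynomialDecay Filter.atTop (fun n : ℕ => (n : ℝ)) ε)
    (p : ℕ → ℕ) (hp : ∀ n, 2 ≤ p n)
    (α : ℕ → ℝ) (hα : ∀ n, 0 < α n ∧ α n < 1)
    (N : ℕ → ℕ) (hN : ∃ K : ℕ, ∀ n, N n ≤ K * (n + 1) ^ K)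
    {Ω : Type*} [MeasurableSpace Ω] (P : MeasureTheory.Measure Ω)
    [MeasureTheory.IsProbabilityMeasure P]
    (W : LWERed.Oracle p N Ω) (hW : W.Solves P (fun n => LWERed.Psi (α n))) :
    -- an efficient algorithm for the closest vector problem on the dual lattice
    (∃ (c : ℕ) (Q : LWERed.Prog), 0 < c ∧ Q.PolyTime W α (fun n => n ^ c) ∧
      ∃ δ : ℝ, 0 < δ ∧ ∃ n₀ : ℕ, ∀ n, n₀ ≤ n →
        ∀ B : Matrix (Fin n) (Fin n) ℝ, B.det ≠ 0 →
        ∀ r : ℝ, Real.sqrt 2 * p n * LWERed.smoothing (LWERed.lattice B) (ε n) < r →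
        ∀ x : LWERed.E n,
          Metric.infDist x (LWERed.dualLattice (LWERed.lattice B) : Set (LWERed.E n))
            ≤ α n * p n / (Real.sqrt 2 * r) →
          LWERed.runLaw (LWERed.lattice B) r (n ^ c) P
            {q | ¬ LWERed.IsClosest (LWERed.dualLattice (LWERed.lattice B)) x
              ((Q.exec W n q.2.1 q.2.2
                (LWERed.initState B (p n) (α n) r x q.1)).outputVec n)}
            ≤ ENNReal.ofReal ((2 : ℝ) ^ (-(δ * n)))) ∧
    -- an efficient procedure, without oracle, turning a target point and one sample from `D_{L,r}`
    -- into an LWE sample with noise `Ψ_β` for some `β ≤ α`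
    (∃ Q : LWERed.Prog, Q.OracleFree ∧ Q.PolyTime W α (fun _ => 1) ∧
      ∃ μ : ℕ → ℝ, Asymptotics.SuperpolynomialDecay Filter.atTop (fun n : ℕ => (n : ℝ)) μ ∧
        ∀ (n : ℕ) (B : Matrix (Fin n) (Fin n) ℝ), B.det ≠ 0 →
        ∀ r : ℝ, Real.sqrt 2 * p n * LWERed.smoothing (LWERed.lattice B) (ε n) < r →
        ∀ x : LWERed.E n,
          Metric.infDist x (LWERed.dualLattice (LWERed.lattice B) : Set (LWERed.E n))
            ≤ α n * p n / (Real.sqrt 2 * r) →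
        -- `k` is the coefficient vector, in the dual basis, of the closest dual lattice point
        ∀ k : Fin n → ℤ,
          LWERed.IsClosest (LWERed.dualLattice (LWERed.lattice B)) x
            (WithLp.toLp 2 (Matrix.mulVec B⁻¹.transpose fun i => (k i : ℝ))) →
          ∃ β : ℝ, 0 < β ∧ β ≤ α n ∧
            ∀ S : Set (LWERed.Sample n (p n)), MeasurableSet S →
              |(LWERed.runLaw (LWERed.lattice B) r 1 P).real
                  {q | LWERed.decode n (p n) (Q.exec W n q.2.1 q.2.2
                    (LWERed.initState B (p n) (α n) r x q.1)).output ∈ S}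
                - (LWERed.lweDist (fun i => (k i : ZMod (p n))) (LWERed.Psi β)).real S|
              ≤ μ n) := by
  refine ⟨?_, LWERed.sampleProg, LWERed.oracleFree_sampleProg,
    LWERed.Prog.polyTimed_sampleProg.polyTime α _, fun n => 3 * ε n, ?_, ?_⟩
  · exact LWERed.exists_cvp_algorithm hε hε_negl hp hα hN P W hW
  · exact hε_negl.const_mul 3
  · intro n B hB r hr x hx k hk
    exact LWERed.sampleProg_close W P (hp n) (hε n) (hα n).1 hB hr hx hk
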